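/- Let $k$ be a field of characteristic different from $2$, let $k^s$ be a separable closure of $k$ and $G=\mathrm{Gal}(k^s/k)$, and let $f\in k[X]$ be a separable polynomial of degree $6$ with set of roots $\Omega\subset k^s$. Let $C$ be the smooth projective curve of genus $2$ over $k$ with affine equation $y^2=f(x)$, and let $J[2]$ be the group of two-torsion points over $k^s$ of its Jacobian, that is, the two-torsion subgroup of $\mathrm{Pic}^0(C_{k^s})$, with its natural $G$-action. Put $L=k[X]/(f)$ and $L^s=L\otimes_k k^s$; for $\omega\in\Omega$ let $\varphi_\omega\colon L^s\to k^s$ be the $k^s$-algebra homomorphism with $X\mapsto\omega$, and let $N(\alpha)=\prod_{\omega\in\Omega}\varphi_\omega(\alpha)$ be the norm on $L^s$, which extends the norm $N=N_{L/k}$ on $L$. Let $\mu_2=\{\pm1\}\subset k^s$ and let $M$ be the group of all $\alpha\in (L^s)^*$ with $\alpha^2=1$ and $N(\alpha)=1$. Write $H^i(-)$ for continuous cohomology of the profinite group $G$ with coefficients in a discrete $G$-module, and $\mathrm{Br}(k)=H^2((k^s)^*)$. There is a unique homomorphism $\beta\colon M\to J[2]$ such that, for all $\omega_1\ne\omega_2$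 in $\Omega$, the element $\alpha_{\omega_1,\omega_2}\in M$ with $\varphi_\omega(\alpha_{\omega_1,\omega_2})=-1$ exactly for $\omega\in\{\omega_1,\omega_2\}$ is sent to the class of the divisor $(\omega_1,0)-(\omega_2,0)$. It is $G$-equivariant and $1\to\mu_2\to M\xrightarrow{\ \beta\ }J[2]\to 1$ is exact. Let $\beta_*\colon H^1(M)\to H^1(J[2])$ be the induced map, and let $\Upsilon\colon H^1(J[2])\to \mathrm{Br}(k)[2]$ be the connecting homomorphism $H^1(J[2])\to H^2(\mu_2)$ of this sequence followed by the natural map $H^2(\mu_2)\to\mathrm{Br}(k)[2]$. Put $P^1(J[2])=\ker\Upsilon$. Let $$\Gamma=\{(\delta,n)\in L^*\times k^* : N(\delta)=n^2\},\qquad \chi\colon L^*\to\Gamma,\quad \chi(\varepsilon)=(\varepsilon^2,N(\varepsilon)).$$ For every $(\delta,n)\in\Gamma$ there is an $\varepsilon\in (L^s)^*$ with $\varepsilon^2=\delta$ and $N(\varepsilon)=n$, and there is a unique homomorphism $\gamma\colon\Gamma/\mathrm{im}\,\chi\to H^1(M)$ which sends the class of each $(\delta,n)$ to the class of the cocycle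 $\sigma\mapsto\sigma(\varepsilon)/\varepsilon$ for every such $\varepsilon$; it is an isomorphism. Regard $k^*$ as mapping to $\Gamma$ by $a\mapsto(a,a^3)$, and let $k^*\cdot\mathrm{im}\,\chi\subset\Gamma$ be the subgroup generated by the image of $k^*$ and by $\mathrm{im}\,\chi$. Then $\beta_*\circ\gamma$ induces an isomorphism $$\Gamma/(k^*\cdot\mathrm{im}\,\chi)\ \xrightarrow{\ \sim\ }\ P^1(J[2])=\ker\Upsilon .$$ -/

import Mathlib

open Polynomial
open scoped TensorProduct WithZero

noncomputable section

namespace GenusTwo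

universe u v w

/-! ### Continuous cohomology in degrees one and two

`G` is a topological group acting on a commutative group `A`, written multiplicatively and carrying
the discrete topology, so that a map to `A` is continuous exactly when it is locally constant. -/

section Cohomology

variable (G : Type u) [Group G] [TopologicalSpace G]
variable (A : Type v) [CommGroup A] [MulDistribMulAction G A]
variable {B : Type w} [CommGroup B] [MulDistribMulAction G B]

/-- Continuous `1`-cocycles. -/
def Z1 : Subgroup (G → A) where
  carrier := {c | IsLocallyConstant c ∧ ∀ σ τ, c (σ * τ) = c σ * σ • c τ}
  one_mem' := ⟨IsLocallyConstant.const 1, fun σ τ => by simp⟩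
  mul_mem' := by
    rintro c d ⟨hc, hc'⟩ ⟨hd, hd'⟩
    refine ⟨hc.mul hd, fun σ τ => ?_⟩
    simp only [Pi.mul_apply, hc', hd', smul_mul']
    exact mul_mul_mul_comm _ _ _ _
  inv_mem' := by
    rintro c ⟨hc, hc'⟩
    refine ⟨hc.inv, fun σ τ => ?_⟩
    simp only [Pi.inv_apply, hc', smul_inv', mul_inv]

/-- `1`-coboundaries. -/
def B1 : Subgroup (Z1 G A) where
  carrier := {c | ∃ a : A, ∀ σ, c.1 σ = σ • a / a}
  one_mem' := ⟨1, fun σ => by simp⟩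
  mul_mem' := by
    rintro c d ⟨a, ha⟩ ⟨b, hb⟩
    refine ⟨a * b, fun σ => ?_⟩
    rw [smul_mul', mul_div_mul_comm, ← ha, ← hb]
    rfl
  inv_mem' := by
    rintro c ⟨a, ha⟩
    refine ⟨a⁻¹, fun σ => ?_⟩
    rw [smul_inv', inv_div_inv, ← inv_div, ← ha]
    rfl

/-- The first continuous cohomology group. -/
def H1 := Z1 G A ⧸ B1 G A

instance : CommGroup (H1 G A) := inferInstanceAs (CommGroup (Z1 G A ⧸ B1 G A))

/-- The class of a `1`-cocycle. -/
def H1.mk : Z1 G A →* H1 G A := QuotientGroup.mk' (B1 G A)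

/-- Continuous `2`-cocycles. -/
def Z2 : Subgroup (G × G → A) where
  carrier := {a | IsLocallyConstant a ∧
    ∀ σ τ ρ, σ • a (τ, ρ) * a (σ, τ * ρ) = a (σ * τ, ρ) * a (σ, τ)}
  one_mem' := ⟨IsLocallyConstant.const 1, fun σ τ ρ => by simp⟩
  mul_mem' := by
    rintro c d ⟨hc, hc'⟩ ⟨hd, hd'⟩
    refine ⟨hc.mul hd, fun σ τ ρ => ?_⟩
    simp only [Pi.mul_apply, smul_mul']
    rw [mul_mul_mul_comm, hc', hd', mul_mul_mul_comm]
  inv_mem' := by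
    rintro c ⟨hc, hc'⟩
    refine ⟨hc.inv, fun σ τ ρ => ?_⟩
    simp only [Pi.inv_apply, smul_inv', ← mul_inv, hc']

variable {G A} in
/-- The coboundary of a `1`-cochain. -/
def coboundary (b : G → A) : G × G → A :=
  fun p => b p.1 * p.1 • b p.2 / b (p.1 * p.2)

/-- `2`-coboundaries: the coboundaries of continuous `1`-cochains. -/
def B2 : Subgroup (Z2 G A) where
  carrier := {a | ∃ b : G → A, IsLocallyConstant b ∧ a.1 = coboundary b}
  one_mem' := ⟨1, IsLocallyConstant.const 1, by ext p; simp [coboundary]⟩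
  mul_mem' := by
    rintro c d ⟨a, ha, ha'⟩ ⟨b, hb, hb'⟩
    refine ⟨a * b, ha.mul hb, ?_⟩
    rw [Subgroup.coe_mul, ha', hb']
    ext p
    simp only [coboundary, Pi.mul_apply, smul_mul']
    rw [← mul_div_mul_comm, mul_mul_mul_comm]
  inv_mem' := by
    rintro c ⟨a, ha, ha'⟩
    refine ⟨a⁻¹, ha.inv, ?_⟩
    rw [Subgroup.coe_inv, ha']
    ext p
    simp only [coboundary, Pi.inv_apply, smul_inv', ← mul_inv, inv_div_inv, inv_div]

/-- The second continuous cohomology group. -/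
def H2 := Z2 G A ⧸ B2 G A

instance : CommGroup (H2 G A) := inferInstanceAs (CommGroup (Z2 G A ⧸ B2 G A))

/-- The class of a `2`-cocycle. -/
def H2.mk : Z2 G A →* H2 G A := QuotientGroup.mk' (B2 G A)

variable {G A}

/-- The map on `1`-cocycles induced by an equivariant homomorphism. -/
def Z1.map (φ : A →* B) (hφ : ∀ (σ : G) (a : A), φ (σ • a) = σ • φ a) : Z1 G A →* Z1 G B where
  toFun c := ⟨fun σ => φ (c.1 σ), c.2.1.comp φ, fun σ τ => by
    simp only [c.2.2, map_mul, hφ]⟩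
  map_one' := by ext; simp
  map_mul' c d := by ext; simp

/-- The map on `H¹` induced by an equivariant homomorphism. -/
def H1.map (φ : A →* B) (hφ : ∀ (σ : G) (a : A), φ (σ • a) = σ • φ a) : H1 G A →* H1 G B :=
  QuotientGroup.map (B1 G A) (B1 G B) (Z1.map φ hφ) (by
    rintro c ⟨a, ha⟩
    exact ⟨φ a, fun σ => by
      rw [← hφ, ← MonoidHom.map_div, ← ha]
      rfl⟩)

/-- The map on `2`-cocycles induced by an equivariant homomorphism. -/
def Z2.map (φ : A →* B) (hφ : ∀ (σ : G) (a : A), φ (σ • a) = σ • φ a) : Z2 G A →* Z2 G B where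
  toFun c := ⟨fun p => φ (c.1 p), c.2.1.comp φ, fun σ τ ρ => by
    rw [← hφ, ← map_mul, c.2.2, map_mul]⟩
  map_one' := by ext; simp
  map_mul' c d := by ext; simp

/-- The map on `H²` induced by an equivariant homomorphism. -/
def H2.map (φ : A →* B) (hφ : ∀ (σ : G) (a : A), φ (σ • a) = σ • φ a) : H2 G A →* H2 G B :=
  QuotientGroup.map (B2 G A) (B2 G B) (Z2.map φ hφ) (by
    rintro c ⟨b, hb, hb'⟩
    refine ⟨fun σ => φ (b σ), hb.comp φ, ?_⟩
    ext p
    change φ (c.1 p) = _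
    rw [hb']
    simp [coboundary, hφ])

/-- The action on a stable subgroup. -/
@[reducible] def subgroupAction (S : Subgroup A) (hS : ∀ (σ : G), ∀ a ∈ S, σ • a ∈ S) :
    MulDistribMulAction G S where
  smul σ a := ⟨σ • a.1, hS σ a.1 a.2⟩
  one_smul a := Subtype.ext (one_smul G a.1)
  mul_smul σ τ a := Subtype.ext (mul_smul σ τ a.1)
  smul_mul σ a b := Subtype.ext (smul_mul' σ a.1 b.1)
  smul_one σ := Subtype.ext (smul_one σ)

end Cohomology

variable {k : Type u} [Field k] (f : k[X]) (K : Type v) [Field K] [Algebra k K]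

/-! ### The algebras `L`, `Lˢ` and the group `M`

Below `K` plays the role of the separable closure of `k`. -/

/-- `L = k[X]/f`. -/
abbrev LAlg := AdjoinRoot f

/-- `Lˢ`, the base change of `L` to `K`. -/
abbrev LSep := K ⊗[k] AdjoinRoot f

/-- The Galois group acts on `Lˢ` through the factor `K`: one has
`σ • (a ⊗ b) = σ a ⊗ b` (the underlying scalar action is Mathlib's). -/
instance : MulSemiringAction (K ≃ₐ[k] K) (LSep f K) :=
  { (inferInstance : DistribMulAction (K ≃ₐ[k] K) (LSep f K)) with
    smul_one := fun σ => by
      rw [Algebra.TensorProduct.one_def, TensorProduct.smul_tmul', smul_one]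
    smul_mul := fun σ x y => by
      induction x using TensorProduct.induction_on with
      | zero => simp
      | add x x' hx hx' => simp only [add_mul, smul_add, hx, hx']
      | tmul a b =>
        induction y using TensorProduct.induction_on with
        | zero => simp
        | add y y' hy hy' => simp only [mul_add, smul_add, hy, hy']
        | tmul c d =>
          simp only [TensorProduct.smul_tmul', Algebra.TensorProduct.tmul_mul_tmul, smul_mul'] }

/-- The Galois action on the units of `Lˢ`. -/
instance : MulDistribMulAction (K ≃ₐ[k] K) (LSep f K)ˣ where
  smul σ := Units.map (MulSemiringAction.toRingHom (K ≃ₐ[k] K) (LSep f K) σ : _ →* _)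
  one_smul a := by
    ext
    exact one_smul (K ≃ₐ[k] K) (a.1 : LSep f K)
  mul_smul σ τ a := by
    ext
    exact mul_smul σ τ (a.1 : LSep f K)
  smul_mul σ a b := map_mul _ a b
  smul_one σ := map_one _

lemma val_smul (σ : K ≃ₐ[k] K) (a : (LSep f K)ˣ) : ((σ • a : (LSep f K)ˣ) : LSep f K) = σ • a.1 :=
  rfl

/-- For a root `ω` of `f` in `K`, the `k`-algebra map `L → K` sending `X` to `ω`. -/
def rootHom (ω : f.rootSet K) : LAlg f →ₐ[k] K :=
  AdjoinRoot.liftAlgHom f (Algebra.ofId k K) ω.1 (aeval_eq_zero_of_mem_rootSet ω.2)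

lemma rootHom_root (ω : f.rootSet K) : rootHom f K ω (AdjoinRoot.root f) = ω.1 :=
  AdjoinRoot.liftAlgHom_root f (Algebra.ofId k K) ω.1 (aeval_eq_zero_of_mem_rootSet ω.2)

/-- For a root `ω` of `f` in `K`, the `K`-algebra map `φ_ω : Lˢ → K` sending `X` to `ω`. -/
def phi (ω : f.rootSet K) : LSep f K →ₐ[K] K :=
  Algebra.TensorProduct.lift (AlgHom.id K K)
    (rootHom f K ω)
    (fun _ _ => Commute.all _ _)

/-- The norm `Lˢ → K`, sending `α` to `∏_ω φ_ω(α)`. -/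
def normSep : LSep f K →* K where
  toFun α := ∏ ω : f.rootSet K, phi f K ω α
  map_one' := by simp
  map_mul' α β := by simp [Finset.prod_mul_distrib]

/-- The action of the Galois group on the roots of `f`. -/
def rootPerm (σ : K ≃ₐ[k] K) : f.rootSet K ≃ f.rootSet K where
  toFun ω := ⟨σ ω.1, mem_rootSet.2 ⟨(mem_rootSet.1 ω.2).1, by
    rw [aeval_algEquiv, AlgHom.comp_apply, (mem_rootSet.1 ω.2).2, map_zero]⟩⟩
  invFun ω := ⟨σ.symm ω.1, mem_rootSet.2 ⟨(mem_rootSet.1 ω.2).1, by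
    rw [aeval_algEquiv, AlgHom.comp_apply, (mem_rootSet.1 ω.2).2, map_zero]⟩⟩
  left_inv ω := Subtype.ext (σ.symm_apply_apply _)
  right_inv ω := Subtype.ext (σ.apply_symm_apply _)

lemma phi_smul (σ : K ≃ₐ[k] K) (ω : f.rootSet K) (α : LSep f K) :
    phi f K (rootPerm f K σ ω) (σ • α) = σ (phi f K ω α) := by
  induction α using TensorProduct.induction_on with
  | zero => simp
  | add x y hx hy => simp only [smul_add, map_add, hx, hy]
  | tmul a b =>
    rw [TensorProduct.smul_tmul']
    simp only [phi, Algebra.TensorProduct.lift_tmul, map_mul, AlgHom.coe_id, id,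
      AlgEquiv.smul_def]
    congr 1
    have : rootHom f K (rootPerm f K σ ω) = (σ : K →ₐ[k] K).comp (rootHom f K ω) := by
      apply AdjoinRoot.algHom_ext
      rw [rootHom_root, AlgHom.comp_apply, rootHom_root]
      rfl
    exact DFunLike.congr_fun this b

lemma normSep_smul (σ : K ≃ₐ[k] K) (α : LSep f K) :
    normSep f K (σ • α) = σ (normSep f K α) := by
  change ∏ ω, phi f K ω (σ • α) = σ (∏ ω, phi f K ω α)
  rw [← Equiv.prod_comp (rootPerm f K σ), map_prod]
  exact Finset.prod_congr rfl fun ω _ => phi_smul f K σ ω α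

/-- `M`: the elements `α` of `Lˢ` with `α² = 1` and norm `1`. -/
def MGroup : Subgroup (LSep f K)ˣ :=
  (powMonoidHom 2 : (LSep f K)ˣ →* (LSep f K)ˣ).ker ⊓ (Units.map (normSep f K)).ker

instance : MulDistribMulAction (K ≃ₐ[k] K) (MGroup f K) :=
  subgroupAction _ (by
    rintro σ a ⟨ha, ha'⟩
    replace ha : a ^ 2 = 1 := ha
    replace ha' : Units.map (normSep f K) a = 1 := ha'
    refine ⟨?_, ?_⟩
    · change (σ • a) ^ 2 = 1
      rw [← smul_pow', ha, smul_one]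
    · change Units.map (normSep f K) (σ • a) = 1
      ext
      have := congrArg Units.val ha'
      change normSep f K (σ • a.1) = 1
      rw [normSep_smul]
      change normSep f K a.1 = 1 at this
      rw [this, map_one])

/-! ### The curve `y² = f(x)` over `K`, its divisors and its Jacobian

The smooth projective curve over `K` attached to `y² = f(x)` is described by its function field
`K(x)[y]/(y² - f(x))`: its closed points are the places of that field. -/

/-- The polynomial `Y² - f(x)` over `K(x)`. -/
def curvePoly : (RatFunc K)[X] :=
  X ^ 2 - C (algebraMap K[X] (RatFunc K) (f.map (algebraMap k K)))

/-- The function field of the curve over `K`. -/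
abbrev FunField := AdjoinRoot (curvePoly f K)

/-- The function `x`. -/
def xCoord : FunField f K := AdjoinRoot.of _ RatFunc.X

/-- The function `y`. -/
def yCoord : FunField f K := AdjoinRoot.root _

/-- The action of `σ` on the coefficients of rational functions. -/
def ratMap (σ : K ≃ₐ[k] K) : RatFunc K →+* RatFunc K :=
  RatFunc.mapRingHom (mapRingHom (σ : K →+* K)) (nonZeroDivisors_le_comap_nonZeroDivisors_of_injective
    _ (map_injective _ σ.injective))

lemma ratMap_algebraMap (σ : K ≃ₐ[k] K) (p : K[X]) :
    ratMap K σ (algebraMap K[X] (RatFunc K) p) =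
      algebraMap K[X] (RatFunc K) (p.map (σ : K →+* K)) := by
  have h := RatFunc.map_apply_div (mapRingHom (σ : K →+* K))
    (nonZeroDivisors_le_comap_nonZeroDivisors_of_injective _ (map_injective _ σ.injective)) p 1
  simp only [map_one, div_one] at h
  exact h

lemma curvePoly_map (σ : K ≃ₐ[k] K) : (curvePoly f K).map (ratMap K σ) = curvePoly f K := by
  simp only [curvePoly, Polynomial.map_sub, Polynomial.map_pow, map_X, map_C, ratMap_algebraMap,
    Polynomial.map_map]
  congr 4
  exact (σ : K →ₐ[k] K).comp_algebraMap

/-- The action of `σ` on the function field: on the coefficients, fixing `x` and `y`. -/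
def funMap (σ : K ≃ₐ[k] K) : FunField f K →+* FunField f K :=
  AdjoinRoot.map (ratMap K σ) _ _ (by rw [curvePoly_map])

lemma ratMap_ext {φ ψ : RatFunc K →+* RatFunc K}
    (h : ∀ p : K[X], φ (algebraMap _ _ p) = ψ (algebraMap _ _ p)) : φ = ψ :=
  IsLocalization.ringHom_ext (nonZeroDivisors K[X]) (RingHom.ext h)

/-- The Galois action on the function field: it acts on constants and fixes `x` and `y`. -/
instance : MulSemiringAction (K ≃ₐ[k] K) (FunField f K) where
  smul σ := funMap f K σ
  one_smul g := by
    change funMap f K 1 g = g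
    have : funMap f K 1 = RingHom.id _ := by
      apply AdjoinRoot.ringHom_ext
      · have h : ratMap K (1 : K ≃ₐ[k] K) = RingHom.id _ := ratMap_ext K fun p => by
          rw [ratMap_algebraMap]
          exact congrArg _ (Polynomial.map_id)
        ext p
        simp [funMap, h]
      · simp [funMap]
    rw [this, RingHom.id_apply]
  mul_smul σ τ g := by
    change funMap f K (σ * τ) g = funMap f K σ (funMap f K τ g)
    have : funMap f K (σ * τ) = (funMap f K σ).comp (funMap f K τ) := by
      apply AdjoinRoot.ringHom_ext
      · have h : ratMap K (σ * τ) = (ratMap K σ).comp (ratMap K τ) := ratMap_ext K fun p => by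
          rw [RingHom.comp_apply, ratMap_algebraMap, ratMap_algebraMap, ratMap_algebraMap,
            Polynomial.map_map]
          rfl
        ext p
        simp [funMap, h]
      · simp [funMap]
    rw [this, RingHom.comp_apply]
  smul_zero σ := map_zero (funMap f K σ)
  smul_add σ := map_add (funMap f K σ)
  smul_one σ := map_one (funMap f K σ)
  smul_mul σ := map_mul (funMap f K σ)

lemma smul_const (σ : K ≃ₐ[k] K) (c : K) :
    σ • algebraMap K (FunField f K) c = algebraMap K (FunField f K) (σ c) := by
  change funMap f K σ (AdjoinRoot.of _ (algebraMap K (RatFunc K) c)) =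
    AdjoinRoot.of _ (algebraMap K (RatFunc K) (σ c))
  rw [funMap, AdjoinRoot.map_of, IsScalarTower.algebraMap_apply K K[X] (RatFunc K),
    ratMap_algebraMap, IsScalarTower.algebraMap_apply K K[X] (RatFunc K)]
  simp

lemma smul_xCoord (σ : K ≃ₐ[k] K) : σ • xCoord f K = xCoord f K := by
  change funMap f K σ (AdjoinRoot.of _ RatFunc.X) = AdjoinRoot.of _ RatFunc.X
  rw [funMap, AdjoinRoot.map_of, ← RatFunc.algebraMap_X, ratMap_algebraMap, map_X]

lemma smul_yCoord (σ : K ≃ₐ[k] K) : σ • yCoord f K = yCoord f K :=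
  AdjoinRoot.map_root _ _ _ _

/-- A closed point of the curve over `K`: a normalized discrete valuation of the function field
that is trivial on the constants. -/
@[ext] structure Place where
  val : Valuation (FunField f K) ℤᵐ⁰
  surj : Function.Surjective val
  const : ∀ c : K, c ≠ 0 → val (algebraMap K (FunField f K) c) = 1

variable {f K}

/-- The order of vanishing of a function at a closed point. -/
def Place.ord (P : Place f K) (g : FunField f K) : ℤ := -WithZero.log (P.val g)

lemma Place.val_const_le (P : Place f K) (c : K) : P.val (algebraMap K (FunField f K) c) ≤ 1 := by
  by_cases h : c = 0
  · simp [h]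
  · rw [P.const c h]

/-- The valuation ring of a closed point, as a `K`-subspace of the function field. -/
def Place.regular (P : Place f K) : Submodule K (FunField f K) where
  carrier := {g | P.val g ≤ 1}
  zero_mem' := by simp
  add_mem' {a b} ha hb := (P.val.map_add a b).trans (max_le ha hb)
  smul_mem' c g hg := by
    change P.val (c • g) ≤ 1
    rw [Algebra.smul_def, map_mul]
    exact mul_le_one' (P.val_const_le c) hg

/-- The functions vanishing at a closed point, as a `K`-subspace of the function field. -/
def Place.vanishing (P : Place f K) : Submodule K (FunField f K) where
  carrier := {g | P.val g < 1}
  zero_mem' := by simp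
  add_mem' {a b} ha hb := (P.val.map_add a b).trans_lt (max_lt ha hb)
  smul_mem' c g hg := by
    change P.val (c • g) < 1
    rw [Algebra.smul_def, map_mul]
    exact (mul_le_of_le_one_left' (P.val_const_le c)).trans_lt hg

/-- The degree of a closed point: the dimension over `K` of its residue field. -/
def Place.deg (P : Place f K) : ℕ :=
  Module.finrank K (P.regular ⧸ P.vanishing.submoduleOf P.regular)

/-- The Galois action on closed points: `(σ • P)(g) = P(σ⁻¹ g)`. -/
instance : MulAction (K ≃ₐ[k] K) (Place f K) where
  smul σ P :=
    { val := P.val.comap (MulSemiringAction.toRingHom (K ≃ₐ[k] K) (FunField f K) σ⁻¹)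
      surj := fun a => by
        obtain ⟨g, hg⟩ := P.surj a
        refine ⟨σ • g, ?_⟩
        rw [Valuation.comap_apply, MulSemiringAction.toRingHom_apply, inv_smul_smul, hg]
      const := fun c hc => by
        rw [Valuation.comap_apply, MulSemiringAction.toRingHom_apply, smul_const]
        exact P.const _ (by simpa using hc) }
  one_smul P := by
    ext g
    change P.val ((1 : K ≃ₐ[k] K)⁻¹ • g) = P.val g
    rw [inv_one, one_smul]
  mul_smul σ τ P := by
    ext g
    change P.val ((σ * τ)⁻¹ • g) = P.val (τ⁻¹ • σ⁻¹ • g)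
    rw [mul_inv_rev, mul_smul]

lemma Place.smul_val (σ : K ≃ₐ[k] K) (P : Place f K) (g : FunField f K) :
    (σ • P).val g = P.val (σ⁻¹ • g) := rfl

lemma Place.smul_deg (σ : K ≃ₐ[k] K) (P : Place f K) : (σ • P).deg = P.deg := by
  let e : P.regular ≃+ (σ • P).regular :=
    { toFun := fun g => ⟨σ • g.1, by
        change P.val (σ⁻¹ • σ • g.1) ≤ 1
        rw [inv_smul_smul]
        exact g.2⟩
      invFun := fun g => ⟨σ⁻¹ • g.1, g.2⟩
      left_inv := fun g => Subtype.ext (inv_smul_smul _ _)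
      right_inv := fun g => Subtype.ext (smul_inv_smul _ _)
      map_add' := fun g h => Subtype.ext (smul_add _ _ _) }
  have he : (P.vanishing.submoduleOf P.regular).toAddSubgroup.map (e : P.regular →+ _) =
      ((σ • P).vanishing.submoduleOf (σ • P).regular).toAddSubgroup := by
    ext g
    constructor
    · rintro ⟨h, hh, rfl⟩
      change P.val (σ⁻¹ • σ • h.1) < 1
      rw [inv_smul_smul]
      exact hh
    · intro hg
      exact ⟨e.symm g, hg, e.apply_symm_apply g⟩
  let j := QuotientAddGroup.congr _ _ e he
  have := rank_eq_of_equiv_equiv (R := K) (R' := K) (σ : K → K)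
    (M := P.regular ⧸ P.vanishing.submoduleOf P.regular)
    (M₁ := (σ • P).regular ⧸ (σ • P).vanishing.submoduleOf (σ • P).regular) j σ.bijective ?_
  · rw [Place.deg, Place.deg, Module.finrank, Module.finrank, this]
  · intro c m
    induction m using Submodule.Quotient.induction_on with
    | H g =>
      change Submodule.Quotient.mk (e (c • g)) = Submodule.Quotient.mk (σ c • e g)
      congr 1
      apply Subtype.ext
      change σ • (c • g.1) = σ c • (σ • g.1)
      rw [Algebra.smul_def, smul_mul', smul_const, ← Algebra.smul_def]

variable (f K)

/-- Divisors on the curve over `K`. -/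
abbrev Divisor := Place f K →₀ ℤ

/-- The degree of a divisor. -/
def Divisor.deg : Divisor f K →+ ℤ :=
  (Finsupp.linearCombination ℤ fun P : Place f K => (P.deg : ℤ)).toAddMonoidHom

/-- Principal divisors: the divisors of the nonzero functions. -/
def principal : AddSubgroup (Divisor f K) where
  carrier := {D | ∃ g : (FunField f K)ˣ, ∀ P : Place f K, D P = P.ord g}
  zero_mem' := ⟨1, fun P => by simp [Place.ord]⟩
  add_mem' := by
    rintro D E ⟨g, hg⟩ ⟨h, hh⟩
    refine ⟨g * h, fun P => ?_⟩
    have h1 : P.val g ≠ 0 := (g.isUnit.map P.val).ne_zero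
    have h2 : P.val h ≠ 0 := (h.isUnit.map P.val).ne_zero
    rw [Finsupp.add_apply, hg, hh, Place.ord, Place.ord, Place.ord, Units.val_mul, map_mul,
      WithZero.log_mul h1 h2, neg_add]
  neg_mem' := by
    rintro D ⟨g, hg⟩
    refine ⟨g⁻¹, fun P => ?_⟩
    have h1 : P.val g * P.val (g⁻¹ : (FunField f K)ˣ) = 1 := by
      rw [← map_mul, Units.mul_inv, map_one]
    rw [Finsupp.neg_apply, hg, Place.ord, Place.ord, eq_inv_of_mul_eq_one_right h1,
      WithZero.log_inv]

/-- The Galois action on divisors, `σ • ∑ n_P P = ∑ n_P (σ • P)`. -/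
def divAct (σ : K ≃ₐ[k] K) : Divisor f K →+ Divisor f K :=
  Finsupp.mapDomain.addMonoidHom (σ • ·)

lemma divAct_apply (σ : K ≃ₐ[k] K) (D : Divisor f K) (P : Place f K) :
    divAct f K σ D P = D (σ⁻¹ • P) := by
  have := Finsupp.mapDomain_apply (MulAction.injective σ) D (σ⁻¹ • P)
  rwa [smul_inv_smul] at this

/-- The divisor class group of the curve over `K`. -/
def Pic := Divisor f K ⧸ principal f K

instance : AddCommGroup (Pic f K) := inferInstanceAs (AddCommGroup (Divisor f K ⧸ principal f K))

/-- The class of a divisor. -/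
def Pic.mk : Divisor f K →+ Pic f K := QuotientAddGroup.mk' (principal f K)

lemma Pic.mk_surjective : Function.Surjective (Pic.mk f K) := QuotientAddGroup.mk'_surjective _

lemma divAct_principal (σ : K ≃ₐ[k] K) : principal f K ≤ (principal f K).comap (divAct f K σ) := by
  rintro D ⟨g, hg⟩
  refine ⟨Units.map (MulSemiringAction.toRingHom (K ≃ₐ[k] K) (FunField f K) σ : _ →* _) g,
    fun P => ?_⟩
  rw [divAct_apply, hg, Place.ord, Place.ord, Place.smul_val, inv_inv]
  rfl

/-- The map on divisor classes induced by `divAct`. -/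
def picAct (σ : K ≃ₐ[k] K) : Pic f K →+ Pic f K :=
  QuotientAddGroup.map (principal f K) (principal f K) (divAct f K σ) (divAct_principal f K σ)

lemma picAct_mk (σ : K ≃ₐ[k] K) (D : Divisor f K) :
    picAct f K σ (Pic.mk f K D) = Pic.mk f K (divAct f K σ D) := rfl

/-- The Galois action on divisor classes. -/
instance : DistribMulAction (K ≃ₐ[k] K) (Pic f K) where
  smul σ := picAct f K σ
  one_smul c := by
    obtain ⟨D, rfl⟩ := Pic.mk_surjective f K c
    change picAct f K 1 _ = _
    rw [picAct_mk]
    congr 1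
    ext P
    rw [divAct_apply, inv_one, one_smul]
  mul_smul σ τ c := by
    obtain ⟨D, rfl⟩ := Pic.mk_surjective f K c
    change picAct f K (σ * τ) _ = picAct f K σ (picAct f K τ _)
    rw [picAct_mk, picAct_mk, picAct_mk]
    congr 1
    ext P
    rw [divAct_apply, divAct_apply, divAct_apply, mul_inv_rev, mul_smul]
  smul_zero σ := map_zero (picAct f K σ)
  smul_add σ := map_add (picAct f K σ)

/-- `Pic⁰`, the classes of divisors of degree zero. Over a separable closure the curve has a
rational point, and `Pic⁰` is the group of `K`-points of its Jacobian. -/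
def Pic0 : AddSubgroup (Pic f K) :=
  (Divisor.deg f K).ker.map (Pic.mk f K)

/-- The group `J[2](K)` of two-torsion points on the Jacobian. -/
def twoTorsion : AddSubgroup (Pic f K) :=
  Pic0 f K ⊓ (nsmulAddMonoidHom 2 : Pic f K →+ Pic f K).ker

lemma divAct_deg (σ : K ≃ₐ[k] K) (D : Divisor f K) :
    Divisor.deg f K (divAct f K σ D) = Divisor.deg f K D := by
  have : (Divisor.deg f K).comp (divAct f K σ) = Divisor.deg f K := by
    apply Finsupp.addHom_ext
    intro P n
    have h : divAct f K σ (Finsupp.single P n) = Finsupp.single (σ • P) n :=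
      Finsupp.mapDomain_single
    rw [AddMonoidHom.comp_apply, h, Divisor.deg, LinearMap.toAddMonoidHom_coe,
      Finsupp.linearCombination_single, Finsupp.linearCombination_single, Place.smul_deg]
  exact DFunLike.congr_fun this D

lemma smul_mem_twoTorsion (σ : K ≃ₐ[k] K) {c : Pic f K} (hc : c ∈ twoTorsion f K) :
    σ • c ∈ twoTorsion f K := by
  obtain ⟨⟨D, hD, hDc⟩, hc'⟩ := hc
  refine ⟨⟨divAct f K σ D, ?_, ?_⟩, ?_⟩
  · exact (divAct_deg f K σ D).trans hD
  · rw [← hDc]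
    rfl
  · change 2 • (σ • c) = 0
    replace hc' : 2 • c = 0 := hc'
    rw [two_nsmul, ← smul_add, ← two_nsmul, hc', smul_zero]

/-- The Galois module `J[2](K)`, written multiplicatively. -/
abbrev JTwo := Multiplicative (twoTorsion f K)

instance : CommGroup (JTwo f K) := inferInstance

instance : MulDistribMulAction (K ≃ₐ[k] K) (JTwo f K) where
  smul σ c := .ofAdd ⟨σ • c.toAdd.1, smul_mem_twoTorsion f K σ c.toAdd.2⟩
  one_smul c := congrArg Multiplicative.ofAdd (Subtype.ext (one_smul _ c.toAdd.1))
  mul_smul σ τ c := congrArg Multiplicative.ofAdd (Subtype.ext (mul_smul σ τ c.toAdd.1))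
  smul_mul σ a b :=
    congrArg Multiplicative.ofAdd (Subtype.ext (smul_add σ a.toAdd.1 b.toAdd.1))
  smul_one σ := congrArg Multiplicative.ofAdd (Subtype.ext (smul_zero σ))

/-- `P` is the Weierstrass point `(ω, 0)`. -/
def IsWeierstrass (ω : K) (P : Place f K) : Prop :=
  P.val (xCoord f K - algebraMap K (FunField f K) ω) < 1 ∧ P.val (yCoord f K) < 1

/-! ### The homomorphisms `β`, `Υ` and `γ` -/

/-- `β : M → J[2]` sends the element `α_{ω₁,ω₂}`, which has component `-1` exactly at `ω₁` and
`ω₂`, to the class of `(ω₁, 0) - (ω₂, 0)`. -/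
def IsBeta (β : MGroup f K →* JTwo f K) : Prop :=
  ∀ (ω₁ ω₂ : f.rootSet K), ω₁ ≠ ω₂ → ∀ α : MGroup f K,
    (∀ ω : f.rootSet K, phi f K ω (α.1 : LSep f K) = -1 ↔ ω = ω₁ ∨ ω = ω₂) →
    ∃ P₁ P₂ : Place f K, IsWeierstrass f K ω₁ P₁ ∧ IsWeierstrass f K ω₂ P₂ ∧
      (β α).toAdd.1 =
        Pic.mk f K (Finsupp.single P₁ (1 : ℤ) - Finsupp.single P₂ (1 : ℤ))

instance : MulDistribMulAction (K ≃ₐ[k] K) (rootsOfUnity 2 K) :=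
  subgroupAction _ (by
    intro σ a ha
    rw [mem_rootsOfUnity] at ha ⊢
    rw [← smul_pow', ha, smul_one])

variable (k) in
/-- The Brauer group `Br(k) = H²(Gal(K/k), Kˣ)`. -/
abbrev Br := H2 (K ≃ₐ[k] K) Kˣ

variable (k) in
/-- The two-torsion subgroup of the Brauer group. -/
def BrTwo : Subgroup (Br k K) := (powMonoidHom 2 : Br k K →* Br k K).ker

variable (k) in
/-- The map `H²(μ₂(K)) → Br(k)` induced by the inclusion `μ₂(K) ⊆ Kˣ`. -/
def muToBr : H2 (K ≃ₐ[k] K) (rootsOfUnity 2 K) →* Br k K :=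
  H2.map (rootsOfUnity 2 K).subtype (fun _ _ => rfl)

/-- The inclusion of `μ₂(K)` in the units of `Lˢ`. -/
def muToLSep : rootsOfUnity 2 K →* (LSep f K)ˣ :=
  (Units.map (algebraMap K (LSep f K) : K →* LSep f K)).comp (rootsOfUnity 2 K).subtype

/-- `Υ : H¹(J[2]) → Br(k)[2]` is the connecting homomorphism `H¹(J[2]) → H²(μ₂(K))` of
`1 → μ₂(K) → M → J[2] → 1`, where the last map is `β`, followed by the map
`H²(μ₂(K)) → Br(k)`. Thus `Υ` sends the class of a cocycle `c` to the class of `∂b`, for any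
continuous cochain `b : G → M` lifting `c`. -/
def IsUpsilon (β : MGroup f K →* JTwo f K)
    (Υ : H1 (K ≃ₐ[k] K) (JTwo f K) →* BrTwo k K) : Prop :=
  ∀ (ξ : H1 (K ≃ₐ[k] K) (JTwo f K)) (η : BrTwo k K), Υ ξ = η ↔
    ∃ (c : Z1 (K ≃ₐ[k] K) (JTwo f K)) (b : (K ≃ₐ[k] K) → MGroup f K)
      (a : Z2 (K ≃ₐ[k] K) (rootsOfUnity 2 K)),
      H1.mk _ _ c = ξ ∧ IsLocallyConstant b ∧ (∀ σ, β (b σ) = c.1 σ) ∧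
      (∀ p, muToLSep f K (a.1 p) = (coboundary b p).1) ∧
      muToBr k K (H2.mk _ _ a) = η.1

/-- `Γ`: the pairs `(δ, n)` in `Lˣ × kˣ` with `N(δ) = n²`. -/
def Gam : Subgroup ((LAlg f)ˣ × kˣ) where
  carrier := {g | Algebra.norm k (g.1 : LAlg f) = (g.2 : k) ^ 2}
  one_mem' := by simp
  mul_mem' := by
    intro g h hg hh
    change Algebra.norm k ((g.1 : LAlg f) * (h.1 : LAlg f)) = ((g.2 : k) * (h.2 : k)) ^ 2
    rw [map_mul, mul_pow]
    exact congrArg₂ _ hg hh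
  inv_mem' := by
    intro g hg
    have h1 : Units.map (Algebra.norm k : LAlg f →* k) g.1 = g.2 ^ 2 := Units.ext hg
    have h2 : Units.map (Algebra.norm k : LAlg f →* k) g.1⁻¹ = g.2⁻¹ ^ 2 := by
      rw [map_inv, h1, inv_pow]
    exact congrArg Units.val h2

/-- `χ : Lˣ → Γ`, `χ(ε) = (ε², N(ε))`. -/
def chi : (LAlg f)ˣ →* Gam f where
  toFun ε := ⟨(ε ^ 2, Units.map (Algebra.norm k : LAlg f →* k) ε), by
    change Algebra.norm k ((ε : LAlg f) ^ 2) = (Algebra.norm k (ε : LAlg f)) ^ 2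
    rw [map_pow]⟩
  map_one' := by ext <;> simp
  map_mul' a b := by ext <;> simp [mul_pow]

/-- The image of `kˣ` in `Γ` under `a ↦ (a, a³)`; note that `N(a) = a⁶` for `a` in `kˣ` when `f`
has degree six. -/
def kStar : Subgroup (Gam f) where
  carrier := {g | ∃ a : kˣ, g.1 = (Units.map (algebraMap k (LAlg f) : k →* LAlg f) a, a ^ 3)}
  one_mem' := ⟨1, by rw [map_one, one_pow]; rfl⟩
  mul_mem' := by
    rintro g h ⟨a, ha⟩ ⟨b, hb⟩
    exact ⟨a * b, by rw [Subgroup.coe_mul, ha, hb, map_mul, mul_pow, Prod.mk_mul_mk]⟩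
  inv_mem' := by
    rintro g ⟨a, ha⟩
    exact ⟨a⁻¹, by rw [Subgroup.coe_inv, ha, map_inv, inv_pow, Prod.inv_mk]⟩

variable {f} in
/-- `ε` in `Lˢ` satisfies `ε² = δ` and `N(ε) = n`, where `g = (δ, n)`. -/
def IsRootOf (ε : (LSep f K)ˣ) (g : Gam f) : Prop :=
  (ε : LSep f K) ^ 2 = Algebra.TensorProduct.includeRight (g.1.1 : LAlg f) ∧
    normSep f K ε = algebraMap k K g.1.2

/-- `γ : Γ/im χ → H¹(M)` sends the class of `(δ, n)` to the class of `σ ↦ σ(ε)/ε`, where `ε` is any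
element of `Lˢ` with `ε² = δ` and `N(ε) = n`. -/
def IsGamma (γ : Gam f ⧸ (chi f).range →* H1 (K ≃ₐ[k] K) (MGroup f K)) : Prop :=
  ∀ g : Gam f, (∃ ε, IsRootOf K ε g) ∧ ∀ ε, IsRootOf K ε g →
    ∃ c : Z1 (K ≃ₐ[k] K) (MGroup f K), (∀ σ, (c.1 σ).1 = σ • ε / ε) ∧
      γ (QuotientGroup.mk g) = H1.mk _ _ c

end GenusTwo

end

open Polynomial GenusTwo

/-!
The points `(ω, 0)` generate `J[2]`, and everything else is Kummer theory for the algebra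
`Lˢ = ∏_ω K`. No Riemann–Roch theorem is needed: the curve enters only through the quadratic
extension `K(x, y)` of `K(x)` and its places.

*The sequence `1 → μ₂ → M → J[2] → 1`.* Every irreducible polynomial over `K` prime to `f`, and
infinity as well, has an unramified place of the function field above it: since `K` is separably
closed of characteristic different from two and `f` has even degree, `f` is close to a square
there, hence a square in the completion by Newton's method (`exists_place_of_close_sq`). The only place at which `x - ω` and `y`
vanish is the ramified place `weierPlace`.

Let `D` be a divisor with `2D = div g`. The norm of `g` to `K(x)` has even order everywhere, so it
is a square, and Hilbert 90 for the quadratic extension gives `g = r u²` with `r` in `K(x)`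
(`exists_eq_mul_sq_of_normFun`). Up to squares `r` is a squarefree polynomial `s`; parity of the
orders at the unramified places shows that `s` divides `f` and has even degree. Hence `D` is
equivalent to a sum of the divisors `(ω, 0) - (ω₀, 0)` over the roots of `s`
(`exists_of_two_mul_eq_ord`), which is surjectivity of `β`. Conversely, let such a sum over a set
`S` of even cardinality be the divisor of `g = a + b y`. Then `g` and its conjugate `a - b y` have
the same divisor, so that `a² / g²` and `(b y)² / g²` have no poles, while `g²` is equivalent to
`∏_{ω ∈ S} (x - ω)` modulo constants and squares. If `a ≠ 0` this product is a square, and `S` is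
empty; if `a = 0` it is `f` up to a square, and `S` is the set of all roots
(`eq_empty_or_univ_of_ord_eq`). So the kernel of `β` is `μ₂`. Uniqueness of `β` holds because the
elements of `M` supported at two roots generate `M`, and implies equivariance.

*The isomorphism `γ`.* By Shapiro's lemma and Hilbert 90 for the stabilizers of the roots,
continuous cocycles with values in the units of `Lˢ` are coboundaries (`hilbert90_LSep`). A cocycle
with values in `M` is thus `σ ↦ σ(ε)/ε`, and `(ε², N(ε))` is Galois invariant, hence in `Γ`. The
class is trivial exactly when `ε` can be chosen in `L`.

*The kernel of `Υ`.* If the class of a two-cocycle with values in `μ₂` is trivial in `Br(k)`, it is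
trivial in `H²(μ₂)`, since all elements of `K` are squares and by Hilbert 90. Therefore the kernel
of `Υ` is the image of `β_*` (`IsUpsilon.exists_of_eq_one`), and `β_* ∘ γ` maps onto it. Its kernel
consists of the `(δ, n)` for which `ε` can be chosen with all `σ(ε)/ε` in `μ₂`, that is, by
Hilbert 90 once more, with `ε = t x`, where `t²` is in `k` and `x` is in `L`
(`map_gammaPre_eq_one_iff`). These are the elements of `kˣ · im χ`, because `t` has norm `t⁶`.
-/

noncomputable section

namespace GenusTwo

universe u v

/-! ### Square roots in complete fields -/

section

open UniformSpace Filter Topology in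
/-- In a complete field of residue characteristic different from two, a unit close to `1` is a
square: Newton's iteration `t ↦ (t + u / t) / 2` converges to a square root. -/
theorem exists_sq_eq_of_complete {C : Type*} [Field C] [Valued C ℤᵐ⁰] [CompleteSpace C]
    {u : C} (h2 : Valued.v (2 : C) = 1) (hu : Valued.v (u - 1) < 1) : ∃ z : C, z ^ 2 = u := by
  set c : ℤᵐ⁰ := Valued.v (u - 1) with hc
  have two_ne : (2 : C) ≠ 0 := fun h => by simp [h] at h2
  let s : ℕ → C := fun n => Nat.rec 1 (fun _ t => (t + u / t) / 2) n
  have s_succ (n : ℕ) : s (n + 1) = (s n + u / s n) / 2 := rfl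
  have inv (n : ℕ) : Valued.v (s n) = 1 ∧ Valued.v (u - s n ^ 2) ≤ c ^ (n + 1) := by
    induction n with
    | zero => exact ⟨by simp [s], by simp [s, hc]⟩
    | succ n ih =>
      obtain ⟨h1, h3⟩ := ih
      have hs : s n ≠ 0 := fun h => by simp [h] at h1
      have hlt : Valued.v (u - s n ^ 2) < 1 :=
        h3.trans_lt (pow_lt_one' hu (Nat.succ_ne_zero n))
      constructor
      · have e : s (n + 1) = s n + (u - s n ^ 2) / (2 * s n) := by
          rw [s_succ]; field_simp; ring
        rw [e, Valuation.map_add_eq_of_lt_left, h1]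
        rw [map_div₀, map_mul, h1, h2]
        simpa using hlt
      · have e : u - s (n + 1) ^ 2 = - ((u - s n ^ 2) ^ 2 / (2 * s n) ^ 2) := by
          rw [s_succ]; field_simp; ring
        rw [e, Valuation.map_neg, map_div₀, map_pow, map_pow, map_mul, h1, h2]
        simp only [mul_one, one_pow, div_one]
        calc _ ≤ (c ^ (n + 1)) ^ 2 := pow_le_pow_left' h3 2
          _ = c ^ (n + 1) * c ^ (n + 1) := sq _
          _ ≤ c ^ (n + 1) * c := mul_le_mul_right (pow_le_of_le_one zero_le hu.le (by simp)) _
          _ = c ^ (n + 1 + 1) := (pow_succ _ _).symm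
  have step (n : ℕ) : Valued.v (s (n + 1) - s n) ≤ c ^ (n + 1) := by
    have hs : s n ≠ 0 := fun h => by simpa [h] using (inv n).1
    have e : s (n + 1) - s n = (u - s n ^ 2) / (2 * s n) := by
      rw [s_succ]; field_simp; ring
    rw [e, map_div₀, map_mul, (inv n).1, h2]
    simpa using (inv n).2
  have far (N n : ℕ) : Valued.v (s (N + n) - s N) ≤ c ^ (N + 1) := by
    induction n with
    | zero => simp
    | succ n ih =>
      have : s (N + (n + 1)) - s N = (s (N + n + 1) - s (N + n)) + (s (N + n) - s N) := by
        rw [← add_assoc]; ring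
      rw [this]
      refine (Valued.v.map_add _ _).trans (max_le ((step _).trans ?_) ih)
      exact pow_le_pow_right_of_le_one' hu.le (by omega)
  have small (γ : (MonoidWithZeroHom.ValueGroup₀ (.ofClass (Valued.v : Valuation C ℤᵐ⁰)))ˣ) :
      ∃ N : ℕ, c ^ (N + 1) < MonoidWithZeroHom.ValueGroup₀.embedding γ.1 := by
    obtain ⟨N, hN⟩ := exists_pow_lt₀ hu (Units.map (MonoidWithZeroHom.ValueGroup₀.embedding
      (f := (MonoidWithZeroHom.ofClass (Valued.v : Valuation C ℤᵐ⁰)))) γ)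
    exact ⟨N, (pow_le_pow_right_of_le_one' hu.le (by omega)).trans_lt hN⟩
  have cau : CauchySeq s := by
    refine Valued.cauchy_iff.2 ⟨inferInstance, fun γ => ?_⟩
    obtain ⟨N, hN⟩ := small γ
    refine ⟨_, image_mem_map (mem_atTop N), ?_⟩
    rintro _ ⟨m, hm, rfl⟩ _ ⟨n, hn, rfl⟩
    rw [Valuation.restrict_lt_iff_lt_embedding]
    refine lt_of_le_of_lt ?_ hN
    obtain ⟨m, rfl⟩ := Nat.exists_eq_add_of_le hm
    obtain ⟨n, rfl⟩ := Nat.exists_eq_add_of_le hn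
    rw [← sub_sub_sub_cancel_right _ _ (s N)]
    exact (Valued.v.map_sub _ _).trans (max_le (far _ _) (far _ _))
  obtain ⟨z, hz⟩ := cauchySeq_tendsto_of_complete cau
  refine ⟨z, tendsto_nhds_unique (hz.pow 2) fun U hU => ?_⟩
  obtain ⟨γ, hγ⟩ := Valued.mem_nhds.1 hU
  obtain ⟨N, hN⟩ := small γ
  refine mem_map.2 (mem_of_superset (mem_atTop N) fun n hn => hγ ?_)
  change Valued.v.restrict (s n ^ 2 - u) < γ.1
  rw [Valuation.restrict_lt_iff_lt_embedding]
  refine lt_of_le_of_lt ?_ hN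
  rw [Valuation.map_sub_swap]
  exact (inv n).2.trans (pow_le_pow_right_of_le_one' hu.le (by simpa using hn))

/-- A valuation of `E` at which `d` is close to a nonzero square extends, with the same values, to
`E(√d)`: embed `E(√d)` in the completion of `E`. -/
theorem exists_valuation_adjoinRoot_sqrt {E : Type*} [Field E] (w : Valuation E ℤᵐ⁰)
    (h2 : w 2 = 1) {d a : E} (hda : w (d - a ^ 2) < w a ^ 2) :
    ∃ v : Valuation (AdjoinRoot (X ^ 2 - C d)) ℤᵐ⁰, ∀ r : E, v (AdjoinRoot.of _ r) = w r := by
  let := Valued.mk' w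
  have ha : a ≠ 0 := fun h => by simp [h] at hda
  have hwa : w a ≠ 0 := (Valuation.ne_zero_iff w).2 ha
  obtain ⟨z, hz⟩ := exists_sq_eq_of_complete (C := UniformSpace.Completion E)
    (u := ((d / a ^ 2 : E) : UniformSpace.Completion E))
    (by
      have := Valued.valuedCompletion_apply (2 : E)
      rw [show ((2 : E) : UniformSpace.Completion E) = 2 from
        map_ofNat (UniformSpace.Completion.coeRingHom (α := E)) 2] at this
      exact this.trans h2)
    (by
      have := Valued.valuedCompletion_apply (d / a ^ 2 - 1 : E)
      rw [show ((d / a ^ 2 - 1 : E) : UniformSpace.Completion E) =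
        ((d / a ^ 2 : E) : UniformSpace.Completion E) - 1 by push_cast; rfl] at this
      rw [this]
      change w _ < 1
      rw [show d / a ^ 2 - 1 = (d - a ^ 2) / a ^ 2 by field_simp, map_div₀, map_pow]
      exact (div_lt_one₀ (pow_pos (zero_lt_iff.2 hwa) 2)).2 hda)
  let j : AdjoinRoot (X ^ 2 - C d) →+* UniformSpace.Completion E :=
    AdjoinRoot.lift (UniformSpace.Completion.coeRingHom (α := E))
      (z * (a : UniformSpace.Completion E)) (by
      simp only [eval₂_sub, eval₂_pow, eval₂_X, eval₂_C]
      change (z * UniformSpace.Completion.coeRingHom a) ^ 2 - _ = 0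
      rw [mul_pow, hz, ← map_pow, sub_eq_zero]
      change UniformSpace.Completion.coeRingHom _ * _ = _
      rw [← map_mul, div_mul_cancel₀ _ (pow_ne_zero 2 ha)])
  refine ⟨(Valued.v : Valuation (UniformSpace.Completion E) ℤᵐ⁰).comap j, fun r => ?_⟩
  rw [Valuation.comap_apply, AdjoinRoot.lift_of]
  exact Valued.valuedCompletion_apply r

end

/-! ### The function field of the curve -/

section

variable {k : Type u} [Field k] (f : k[X]) (K : Type v) [Field K] [Algebra k K]

/-- The image of `f` in `K[X]`. -/
abbrev fK : K[X] := f.map (algebraMap k K)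

/-- The inclusion of the rational function field `K(x)` in the function field of the curve. -/
def ofRat : RatFunc K →+* FunField f K := AdjoinRoot.of _

/-- The inclusion of the polynomial ring `K[x]` in the function field of the curve. -/
def ofPoly : K[X] →+* FunField f K := (ofRat f K).comp (algebraMap K[X] (RatFunc K))

lemma ofPoly_apply (p : K[X]) : ofPoly f K p = ofRat f K (algebraMap K[X] (RatFunc K) p) := rfl

lemma ofPoly_X : ofPoly f K X = xCoord f K := by
  rw [ofPoly_apply, RatFunc.algebraMap_X]; rfl

lemma ofPoly_C (c : K) : ofPoly f K (C c) = algebraMap K (FunField f K) c := by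
  change AdjoinRoot.of _ _ = AdjoinRoot.of _ (algebraMap K (RatFunc K) c)
  rw [IsScalarTower.algebraMap_apply K K[X] (RatFunc K)]; rfl

lemma ofPoly_X_sub_C (c : K) :
    ofPoly f K (X - C c) = xCoord f K - algebraMap K (FunField f K) c := by
  rw [map_sub, ofPoly_X, ofPoly_C]

lemma yCoord_sq : yCoord f K ^ 2 = ofPoly f K (fK f K) := by
  have h : (X ^ 2 - C (algebraMap K[X] (RatFunc K) (fK f K))).eval₂ (ofRat f K) (yCoord f K) = 0 :=
    AdjoinRoot.eval₂_root (curvePoly f K)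
  rw [eval₂_sub, eval₂_pow, eval₂_X, eval₂_C] at h
  exact sub_eq_zero.1 h

lemma exists_add_mul_yCoord (g : FunField f K) :
    ∃ a b : RatFunc K, g = ofRat f K a + ofRat f K b * yCoord f K := by
  obtain ⟨p, rfl⟩ := AdjoinRoot.mk_surjective g
  induction p using Polynomial.induction_on with
  | C a => exact ⟨a, 0, by simp [ofRat]⟩
  | add p q hp hq =>
    obtain ⟨a, b, h⟩ := hp
    obtain ⟨a', b', h'⟩ := hq
    exact ⟨a + a', b + b', by rw [map_add, h, h', map_add, map_add]; ring⟩
  | monomial n c h =>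
    obtain ⟨a, b, h⟩ := h
    refine ⟨b * algebraMap _ _ (fK f K), a, ?_⟩
    have e : (C c * X ^ (n + 1) : (RatFunc K)[X]) = C c * X ^ n * X := by ring
    have hy : AdjoinRoot.mk (curvePoly f K) X = yCoord f K := rfl
    rw [e, map_mul, h, hy, map_mul, ← ofPoly_apply, ← yCoord_sq]
    ring

/-- The hyperelliptic involution on functions: it fixes `x` and sends `y` to `-y`. -/
def conj : FunField f K →+* FunField f K :=
  AdjoinRoot.lift (ofRat f K) (-yCoord f K) (by
    simp only [curvePoly, eval₂_sub, eval₂_pow, eval₂_X, eval₂_C, neg_sq, yCoord_sq]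
    exact sub_self _)

@[simp] lemma conj_ofRat (r : RatFunc K) : conj f K (ofRat f K r) = ofRat f K r :=
  AdjoinRoot.lift_of _

@[simp] lemma conj_ofPoly (p : K[X]) : conj f K (ofPoly f K p) = ofPoly f K p :=
  conj_ofRat f K _

@[simp] lemma conj_yCoord : conj f K (yCoord f K) = -yCoord f K := AdjoinRoot.lift_root _

@[simp] lemma conj_conj (g : FunField f K) : conj f K (conj f K g) = g := by
  obtain ⟨a, b, rfl⟩ := exists_add_mul_yCoord f K g
  simp

lemma conj_const (c : K) :
    conj f K (algebraMap K (FunField f K) c) = algebraMap K (FunField f K) c := by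
  rw [← ofPoly_C, conj_ofPoly]

/-- The norm of `a + b y` from the function field to `K(x)`. -/
def normForm (a b : RatFunc K) : RatFunc K := a ^ 2 - b ^ 2 * algebraMap K[X] _ (fK f K)

lemma mul_conj (a b : RatFunc K) :
    (ofRat f K a + ofRat f K b * yCoord f K) * conj f K (ofRat f K a + ofRat f K b * yCoord f K) =
      ofRat f K (normForm f K a b) := by
  rw [normForm, map_add, map_mul, conj_ofRat, conj_ofRat, conj_yCoord, map_sub, map_pow, map_mul,
    map_pow, ← ofPoly_apply, ← yCoord_sq]
  ring

section

variable {f K}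

lemma ofRat_injective : Function.Injective (ofRat f K) := by
  refine AdjoinRoot.of.injective_of_degree_ne_zero ?_
  rw [curvePoly, degree_X_pow_sub_C two_pos]
  decide

/-- A squarefree polynomial of positive degree is not a square of a rational function. -/
lemma not_isSquare_of_squarefree {p : K[X]} (hp : Squarefree p) (hu : ¬ IsUnit p) (r : RatFunc K) :
    r ^ 2 ≠ algebraMap K[X] (RatFunc K) p := by
  intro h
  have hint : IsIntegral K[X] (r ^ 2) := h ▸ isIntegral_algebraMap
  obtain ⟨q, rfl⟩ := IsIntegrallyClosed.isIntegral_iff.1 (hint.of_pow two_pos)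
  rw [← map_pow] at h
  have h' : q ^ 2 = p := RatFunc.algebraMap_injective K h
  have hq : IsUnit q := hp q ⟨1, by rw [← h']; ring⟩
  exact hu (h' ▸ hq.pow 2)

lemma fK_separable (hsep : f.Separable) : (fK f K).Separable := hsep.map

lemma fK_natDegree (hdeg : f.natDegree = 6) : (fK f K).natDegree = 6 := (natDegree_map _).trans hdeg

lemma fK_ne_zero (hsep : f.Separable) : fK f K ≠ 0 := (fK_separable hsep).ne_zero

lemma fK_not_isUnit (hdeg : f.natDegree = 6) : ¬ IsUnit (fK f K) := fun h => by
  have := natDegree_eq_zero_of_isUnit h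
  rw [fK_natDegree hdeg] at this
  omega

lemma normForm_ne_zero (hsep : f.Separable) (hdeg : f.natDegree = 6)
    {a b : RatFunc K} (h : ¬ (a = 0 ∧ b = 0)) : normForm f K a b ≠ 0 := by
  intro h0
  rw [normForm, sub_eq_zero] at h0
  have hf0 : algebraMap K[X] (RatFunc K) (fK f K) ≠ 0 :=
    RatFunc.algebraMap_ne_zero (fK_ne_zero hsep)
  by_cases hb : b = 0
  · simp_all
  · refine not_isSquare_of_squarefree (fK_separable hsep).squarefree
      (fK_not_isUnit hdeg) (a / b) ?_
    rw [div_pow, h0]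
    field_simp

lemma isUnit_of_ne_zero (hsep : f.Separable) (hdeg : f.natDegree = 6)
    {g : FunField f K} (hg : g ≠ 0) : IsUnit g := by
  obtain ⟨a, b, rfl⟩ := exists_add_mul_yCoord f K g
  have hn : normForm f K a b ≠ 0 := normForm_ne_zero hsep hdeg fun ⟨ha, hb⟩ => hg (by simp [ha, hb])
  exact isUnit_of_mul_isUnit_left (mul_conj f K a b ▸ hn.isUnit.map (ofRat f K))

lemma Place.val_ne_zero (hsep : f.Separable) (hdeg : f.natDegree = 6)
    (P : Place f K) {g : FunField f K} (hg : g ≠ 0) : P.val g ≠ 0 :=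
  ((isUnit_of_ne_zero hsep hdeg hg).map P.val).ne_zero

lemma add_mul_yCoord_ne_zero (hsep : f.Separable) (hdeg : f.natDegree = 6)
    {a b : RatFunc K} (h : ¬ (a = 0 ∧ b = 0)) :
    ofRat f K a + ofRat f K b * yCoord f K ≠ 0 := by
  intro h0
  have := mul_conj f K a b
  rw [h0, zero_mul, eq_comm, map_eq_zero_iff _ ofRat_injective] at this
  exact normForm_ne_zero hsep hdeg h this

end

/-! ### Rational functions up to squares -/

variable {K}

lemma exists_sq_mul_squarefree {p : K[X]} (hp : p ≠ 0) :
    ∃ h s : K[X], h ≠ 0 ∧ Squarefree s ∧ p = h ^ 2 * s := by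
  induction hn : p.natDegree using Nat.strong_induction_on generalizing p with
  | _ n ih =>
    by_cases hs : Squarefree p
    · exact ⟨1, p, one_ne_zero, hs, by simp⟩
    · simp only [Squarefree, not_forall] at hs
      obtain ⟨q, ⟨r, rfl⟩, hq⟩ := hs
      have hq0 : q ≠ 0 := by rintro rfl; simp at hp
      have hr0 : r ≠ 0 := by rintro rfl; simp at hp
      have hd : 0 < q.natDegree := Nat.pos_of_ne_zero fun h0 => hq (by
        rw [natDegree_eq_zero] at h0
        obtain ⟨c, rfl⟩ := h0
        exact isUnit_C.2 (isUnit_iff_ne_zero.2 (by simpa using hq0)))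
      rw [natDegree_mul (mul_ne_zero hq0 hq0) hr0, natDegree_mul hq0 hq0] at hn
      obtain ⟨h, s, h0, hs, rfl⟩ := ih r.natDegree (by omega) hr0 rfl
      exact ⟨q * h, s, mul_ne_zero hq0 h0, hs, by ring⟩

/-- Every nonzero rational function is a squarefree polynomial up to squares. -/
lemma RatFunc.exists_sq_mul_squarefree {r : RatFunc K} (hr : r ≠ 0) :
    ∃ (h : RatFunc K) (s : K[X]), h ≠ 0 ∧ Squarefree s ∧ r = h ^ 2 * algebraMap _ _ s := by
  have hd : r.denom ≠ 0 := r.denom_ne_zero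
  have hd' : algebraMap K[X] (RatFunc K) r.denom ≠ 0 := RatFunc.algebraMap_ne_zero hd
  obtain ⟨h, s, h0, hs, e⟩ :=
    GenusTwo.exists_sq_mul_squarefree (mul_ne_zero (RatFunc.num_ne_zero hr) hd)
  refine ⟨algebraMap _ _ h / algebraMap _ _ r.denom, s,
    div_ne_zero (RatFunc.algebraMap_ne_zero h0) hd', hs, ?_⟩
  have e' := congrArg (algebraMap K[X] (RatFunc K)) e
  rw [map_mul, map_mul, map_pow] at e'
  conv_lhs => rw [← RatFunc.num_div_denom r]
  rw [div_pow, div_mul_eq_mul_div, ← e']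
  field_simp

end

/-! ### Places of the function field over places of `K(x)` -/

section

variable {k : Type u} [Field k] {f : k[X]} {K : Type v} [Field K] [Algebra k K]
open IsDedekindDomain

/-- The height one prime of `K[X]` generated by an irreducible polynomial. -/
def primeSpec {p : K[X]} (hp : Irreducible p) : HeightOneSpectrum K[X] where
  asIdeal := Ideal.span {p}
  isPrime := (Ideal.span_singleton_prime hp.ne_zero).2 hp.prime
  ne_bot := by simpa using hp.ne_zero

/-- The `p`-adic valuation of `K(x)`. -/
def polyVal {p : K[X]} (hp : Irreducible p) : Valuation (RatFunc K) ℤᵐ⁰ :=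
  (primeSpec hp).valuation (RatFunc K)

section polyVal
variable {p : K[X]} (hp : Irreducible p)

lemma polyVal_surjective : Function.Surjective (polyVal hp) := (primeSpec hp).valuation_surjective _

lemma polyVal_self : polyVal hp (algebraMap K[X] _ p) = WithZero.exp (-1) :=
  ((primeSpec hp).valuation_of_algebraMap p).trans
    ((primeSpec hp).intValuation_singleton hp.ne_zero rfl)

lemma polyVal_lt_one_iff {q : K[X]} : polyVal hp (algebraMap K[X] _ q) < 1 ↔ p ∣ q :=
  ((primeSpec hp).valuation_lt_one_iff_mem q).trans Ideal.mem_span_singleton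

lemma polyVal_eq_one_iff {q : K[X]} : polyVal hp (algebraMap K[X] _ q) = 1 ↔ ¬ p ∣ q :=
  (primeSpec hp).valuation_eq_one_iff_notMem.trans (not_congr Ideal.mem_span_singleton)

lemma polyVal_const {c : K} (hc : c ≠ 0) : polyVal hp (algebraMap K _ c) = 1 := by
  rw [IsScalarTower.algebraMap_apply K K[X] (RatFunc K), polyVal_eq_one_iff]
  exact fun h => hp.not_isUnit (isUnit_of_dvd_unit h (isUnit_C.2 hc.isUnit))

/-- A squarefree multiple of `p` has `p`-adic order one. -/
lemma polyVal_of_squarefree {s : K[X]} (hs : Squarefree s) (h : p ∣ s) :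
    polyVal hp (algebraMap K[X] _ s) = WithZero.exp (-1) := by
  obtain ⟨q, rfl⟩ := h
  have hq : ¬ p ∣ q := fun ⟨r, hr⟩ => hp.not_isUnit (hs p ⟨r, by rw [hr]; ring⟩)
  rw [map_mul, map_mul, polyVal_self, (polyVal_eq_one_iff hp).2 hq, mul_one]

end polyVal

lemma val_algebraMap_two [NeZero (2 : K)] {w : Valuation (RatFunc K) ℤᵐ⁰}
    (hc : ∀ c : K, c ≠ 0 → w (algebraMap K _ c) = 1) : w 2 = 1 := by
  rw [← hc 2 two_ne_zero, map_ofNat (algebraMap K _)]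

/-- A normalized valuation of `K(x)` at which `f` is close to a nonzero square extends, without
ramification, to the function field of the curve. -/
lemma exists_place_of_close_sq [NeZero (2 : K)] {w : Valuation (RatFunc K) ℤᵐ⁰}
    (hw : Function.Surjective w) (hc : ∀ c : K, c ≠ 0 → w (algebraMap K _ c) = 1)
    {a : RatFunc K} (ha : w (algebraMap K[X] _ (fK f K) - a ^ 2) < w a ^ 2) :
    ∃ P : Place f K, ∀ r, P.val (ofRat f K r) = w r := by
  obtain ⟨v, hv⟩ : ∃ v : Valuation (FunField f K) ℤᵐ⁰, ∀ r, v (ofRat f K r) = w r :=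
    exists_valuation_adjoinRoot_sqrt w (val_algebraMap_two hc) ha
  refine ⟨⟨v, fun c => ?_, fun c h => ?_⟩, hv⟩
  · obtain ⟨r, rfl⟩ := hw c
    exact ⟨_, hv r⟩
  · rw [← hc c h, ← hv]
    rfl

/-- Over a separably closed field of characteristic different from two, every polynomial is a
square modulo every irreducible polynomial: the residue field is purely inseparable over `K`, and
odd powers detect squares. -/
lemma exists_dvd_sub_sq [IsSepClosed K] [NeZero (2 : K)] {p : K[X]} (hp : Irreducible p)
    (g : K[X]) : ∃ a : K[X], p ∣ g - a ^ 2 := by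
  have := Fact.mk hp
  let c : AdjoinRoot p := AdjoinRoot.mk p g
  suffices h : ∃ b, c = b ^ 2 by
    obtain ⟨b, hb⟩ := h
    obtain ⟨a, rfl⟩ := AdjoinRoot.mk_surjective b
    exact ⟨a, by rw [← AdjoinRoot.mk_eq_zero, map_sub, map_pow, ← hb]; exact sub_self _⟩
  have : Module.Finite K (AdjoinRoot p) := PowerBasis.finite (AdjoinRoot.powerBasis hp.ne_zero)
  have : Algebra.IsAlgebraic K (AdjoinRoot p) := Algebra.IsAlgebraic.of_finite _ _
  obtain ⟨q, hq⟩ := ExpChar.exists K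
  obtain ⟨n, x, hx⟩ := IsPurelyInseparable.pow_mem K q c
  obtain ⟨z, rfl⟩ := IsSepClosed.exists_eq_mul_self x
  have hodd : Odd (q ^ n) := by
    refine Odd.pow ?_
    cases hq with
    | zero => exact odd_one
    | prime h =>
      refine h.odd_of_ne_two ?_
      rintro rfl
      exact two_ne_zero (α := K) (by exact_mod_cast CharP.cast_eq_zero K 2)
  obtain ⟨j, hj⟩ := hodd
  by_cases h0 : c = 0
  · exact ⟨0, by simp [h0]⟩
  · refine ⟨algebraMap K _ z / c ^ j, ?_⟩
    rw [hj, map_mul, pow_succ, pow_mul] at hx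
    rw [div_pow, sq (algebraMap K _ z), hx]
    field_simp
    ring

/-- There is an unramified place above every irreducible polynomial prime to `f`. -/
lemma exists_place_of_irreducible [IsSepClosed K] [NeZero (2 : K)] {p : K[X]} (hp : Irreducible p)
    (hpf : ¬ p ∣ fK f K) : ∃ P : Place f K, ∀ r, P.val (ofRat f K r) = polyVal hp r := by
  obtain ⟨a, ha⟩ := exists_dvd_sub_sq hp (fK f K)
  refine exists_place_of_close_sq (polyVal_surjective hp) (fun c => polyVal_const hp)
    (a := algebraMap _ _ a) ?_
  rw [(polyVal_eq_one_iff hp).2, one_pow, ← map_pow, ← map_sub]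
  · exact (polyVal_lt_one_iff hp).2 ha
  · exact fun h => hpf ((dvd_sub_left (dvd_pow h two_ne_zero)).1 ha)

lemma inftyValuation_algebraMap [DecidableEq (RatFunc K)] {p : K[X]} (hp : p ≠ 0) :
    RatFunc.inftyValuation K (algebraMap K[X] _ p) = WithZero.exp (p.natDegree : ℤ) :=
  RatFunc.inftyValuation.polynomial K hp

/-- There is an unramified place above infinity, as `f` has even degree. -/
lemma exists_place_infty [IsSepClosed K] [NeZero (2 : K)] [DecidableEq (RatFunc K)]
    (hdeg : f.natDegree = 6) :
    ∃ P : Place f K, ∀ r, P.val (ofRat f K r) = RatFunc.inftyValuation K r := by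
  have hd := fK_natDegree (K := K) hdeg
  obtain ⟨s, hs⟩ := IsSepClosed.exists_eq_mul_self (fK f K).leadingCoeff
  have hf0 : fK f K ≠ 0 := by rintro h; simp [h] at hd
  have hs0 : s ≠ 0 := by rintro rfl; exact hf0 (leadingCoeff_eq_zero.1 (hs.trans (zero_mul 0)))
  refine exists_place_of_close_sq (a := algebraMap _ _ (C s * X ^ 3))
    (fun c => ?_) (fun c hc => ?_) ?_
  · induction c using WithZero.expRecOn with
    | zero => exact ⟨0, map_zero _⟩
    | exp n => exact ⟨RatFunc.X ^ n, RatFunc.inftyValuation.X_zpow K n⟩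
  · exact RatFunc.inftyValuation.C K hc
  · have h3 : (C s * X ^ 3 : K[X]) ≠ 0 := mul_ne_zero (C_ne_zero.2 hs0) (pow_ne_zero _ X_ne_zero)
    rw [inftyValuation_algebraMap h3, ← map_pow, ← map_sub, natDegree_C_mul_X_pow _ _ hs0,
      ← WithZero.exp_nsmul]
    by_cases h0 : fK f K - (C s * X ^ 3) ^ 2 = 0
    · rw [h0, map_zero, map_zero]; exact WithZero.exp_pos
    rw [inftyValuation_algebraMap h0, WithZero.exp_lt_exp]
    have e : (C s * X ^ 3 : K[X]) ^ 2 = C (s * s) * X ^ 6 := by simp only [map_mul]; ring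
    have := natDegree_lt_natDegree h0
      (degree_sub_lt_left (q := (C s * X ^ 3) ^ 2) (p := fK f K) ?_ hf0 ?_)
    · rw [hd] at this
      simp only [nsmul_eq_mul]
      push_cast
      omega
    · rw [e, degree_C_mul_X_pow _ (mul_ne_zero hs0 hs0), degree_eq_natDegree hf0, hd]
    · rw [e, leadingCoeff_C_mul_X_pow, hs]

end

/-! ### The norm to `K(x)` and the Weierstrass places -/

section

variable {k : Type u} [Field k] {f : k[X]} {K : Type v} [Field K] [Algebra k K]

/-- The norm from the function field of the curve to `K(x)`, given by the norm form on any
representation `a + b y`. -/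
def normFun : FunField f K →*₀ RatFunc K where
  toFun g := normForm f K (exists_add_mul_yCoord f K g).choose
    (exists_add_mul_yCoord f K g).choose_spec.choose
  map_zero' := ofRat_injective (f := f) (by
    rw [← mul_conj, ← (exists_add_mul_yCoord f K 0).choose_spec.choose_spec, zero_mul, map_zero])
  map_one' := ofRat_injective (f := f) (by
    rw [← mul_conj, ← (exists_add_mul_yCoord f K 1).choose_spec.choose_spec, map_one, map_one,
      one_mul])
  map_mul' g h := ofRat_injective (f := f) (by
    rw [← mul_conj, ← (exists_add_mul_yCoord f K (g * h)).choose_spec.choose_spec, map_mul,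
      map_mul, ← mul_conj, ← mul_conj,
      ← (exists_add_mul_yCoord f K g).choose_spec.choose_spec,
      ← (exists_add_mul_yCoord f K h).choose_spec.choose_spec]
    ring)

lemma ofRat_normFun (g : FunField f K) : ofRat f K (normFun g) = g * conj f K g := by
  change ofRat f K (normForm f K _ _) = _
  rw [← mul_conj, ← (exists_add_mul_yCoord f K g).choose_spec.choose_spec]

lemma normFun_add_mul (a b : RatFunc K) :
    normFun (ofRat f K a + ofRat f K b * yCoord f K) = normForm f K a b :=
  ofRat_injective (f := f) (by rw [ofRat_normFun, mul_conj])

/-- The order of `b y` at a Weierstrass point is odd and that of `a` is even, for `a` and `b`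
in `K(x)`; hence they differ. -/
lemma sq_ne_sq_mul_exp {s t : ℤᵐ⁰} (h : s ≠ 0 ∨ t ≠ 0) :
    s ^ 2 ≠ t ^ 2 * WithZero.exp (-1) := by
  induction s using WithZero.expRecOn with
  | zero => simpa using h
  | exp a =>
    induction t using WithZero.expRecOn with
    | zero => simp
    | exp b =>
      rw [← WithZero.exp_nsmul, ← WithZero.exp_nsmul, ← WithZero.exp_add, Ne, WithZero.exp_inj]
      simp only [nsmul_eq_mul]
      push_cast
      omega

lemma not_X_sub_C_dvd_iff {ω : K} {q : K[X]} : ¬ (X - C ω) ∣ q ↔ q.eval ω ≠ 0 :=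
  not_congr dvd_iff_isRoot

/-- The `(x - ω)`-adic valuation of `K(x)`. -/
abbrev linVal (ω : K) : Valuation (RatFunc K) ℤᵐ⁰ := polyVal (irreducible_X_sub_C ω)

section Weierstrass

lemma linVal_fK (hsep : f.Separable) {ω : K} (hω : (fK f K).eval ω = 0) :
    linVal ω (algebraMap K[X] _ (fK f K)) = WithZero.exp (-1) :=
  polyVal_of_squarefree _ (fK_separable hsep).squarefree (dvd_iff_isRoot.2 hω)

lemma linVal_normForm (hsep : f.Separable) {ω : K} (hω : (fK f K).eval ω = 0) (a b : RatFunc K) :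
    linVal ω (normForm f K a b) = max (linVal ω a ^ 2) (linVal ω b ^ 2 * WithZero.exp (-1)) := by
  by_cases h : linVal ω a ≠ 0 ∨ linVal ω b ≠ 0
  · rw [normForm, sub_eq_add_neg, Valuation.map_add_of_distinct_val, Valuation.map_neg, map_mul,
      map_pow, map_pow, linVal_fK hsep hω]
    rw [Valuation.map_neg, map_mul, map_pow, map_pow, linVal_fK hsep hω]
    exact sq_ne_sq_mul_exp h
  · push Not at h
    have ha := (Valuation.zero_iff _).1 h.1
    have hb := (Valuation.zero_iff _).1 h.2
    simp [ha, hb, normForm]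

variable (hsep : f.Separable) {ω : K} (hω : (fK f K).eval ω = 0)

/-- The Weierstrass point `(ω, 0)`: its valuation is the `(x - ω)`-adic valuation of the norm. -/
def weierPlace : Place f K where
  val :=
    { ((linVal ω).toMonoidWithZeroHom.comp normFun : FunField f K →*₀ ℤᵐ⁰) with
      map_add_le_max' := fun g h => by
        change linVal ω (normFun (g + h)) ≤ max (linVal ω (normFun g)) (linVal ω (normFun h))
        obtain ⟨a, b, rfl⟩ := exists_add_mul_yCoord f K g
        obtain ⟨a', b', rfl⟩ := exists_add_mul_yCoord f K h
        rw [show ofRat f K a + ofRat f K b * yCoord f K +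
            (ofRat f K a' + ofRat f K b' * yCoord f K) =
          ofRat f K (a + a') + ofRat f K (b + b') * yCoord f K by rw [map_add, map_add]; ring]
        simp only [normFun_add_mul, linVal_normForm hsep hω]
        refine max_le ?_ ?_
        · refine (pow_le_pow_left' (Valuation.map_add _ a a') 2).trans ?_
          rcases max_choice (linVal ω a) (linVal ω a') with h | h <;> rw [h]
          · exact le_max_of_le_left (le_max_left _ _)
          · exact le_max_of_le_right (le_max_left _ _)
        · refine (mul_le_mul_left (pow_le_pow_left' (Valuation.map_add _ b b') 2) _).trans ?_
          rcases max_choice (linVal ω b) (linVal ω b') with h | h <;> rw [h]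
          · exact le_max_of_le_left (le_max_right _ _)
          · exact le_max_of_le_right (le_max_right _ _) }
  surj := fun c => by
    change ∃ g, linVal ω (normFun g) = c
    induction c using WithZero.expRecOn with
    | zero => exact ⟨0, by simp⟩
    | exp n =>
      rcases Int.even_or_odd' n with ⟨m, rfl | rfl⟩
      · obtain ⟨r, hr⟩ := polyVal_surjective (irreducible_X_sub_C ω) (WithZero.exp m)
        refine ⟨ofRat f K r + ofRat f K 0 * yCoord f K, ?_⟩
        rw [normFun_add_mul, linVal_normForm hsep hω, hr, map_zero, ← WithZero.exp_nsmul]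
        simp
      · obtain ⟨r, hr⟩ := polyVal_surjective (irreducible_X_sub_C ω) (WithZero.exp (m + 1))
        refine ⟨ofRat f K 0 + ofRat f K r * yCoord f K, ?_⟩
        rw [normFun_add_mul, linVal_normForm hsep hω, hr, map_zero, ← WithZero.exp_nsmul,
          ← WithZero.exp_add, zero_pow two_ne_zero, max_eq_right zero_le, WithZero.exp_inj]
        simp only [nsmul_eq_mul]
        push_cast
        ring
  const := fun c hc => by
    change linVal ω (normFun (algebraMap K (FunField f K) c)) = 1
    have : algebraMap K (FunField f K) c =
        ofRat f K (algebraMap K _ c) + ofRat f K 0 * yCoord f K := by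
      rw [map_zero, zero_mul, add_zero]; rfl
    rw [this, normFun_add_mul, linVal_normForm hsep hω, polyVal_const _ hc]
    simp

lemma weierPlace_val (a b : RatFunc K) :
    (weierPlace hsep hω).val (ofRat f K a + ofRat f K b * yCoord f K) =
      max (linVal ω a ^ 2) (linVal ω b ^ 2 * WithZero.exp (-1)) :=
  (congrArg (linVal ω) (normFun_add_mul a b)).trans (linVal_normForm hsep hω a b)

lemma weierPlace_ofRat (r : RatFunc K) :
    (weierPlace hsep hω).val (ofRat f K r) = linVal ω r ^ 2 := by
  simpa using weierPlace_val hsep hω r 0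

lemma weierPlace_yCoord : (weierPlace hsep hω).val (yCoord f K) = WithZero.exp (-1) := by
  simpa using weierPlace_val hsep hω 0 1

lemma weierPlace_X_sub_C :
    (weierPlace hsep hω).val (ofPoly f K (X - C ω)) = WithZero.exp (-2) := by
  rw [ofPoly_apply, weierPlace_ofRat, polyVal_self]
  rfl

lemma isWeierstrass_weierPlace : IsWeierstrass f K ω (weierPlace hsep hω) := by
  refine ⟨?_, ?_⟩
  · rw [← ofPoly_X_sub_C, weierPlace_X_sub_C, ← WithZero.exp_zero, WithZero.exp_lt_exp]
    decide
  · rw [weierPlace_yCoord, ← WithZero.exp_zero, WithZero.exp_lt_exp]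
    decide

/-- At a point where `x` has no pole, no polynomial in `x` has one. -/
lemma Place.val_ofPoly_le_one {P : Place f K} (hx : P.val (xCoord f K) ≤ 1) (q : K[X]) :
    P.val (ofPoly f K q) ≤ 1 := by
  induction q using Polynomial.induction_on with
  | C c => rw [ofPoly_C]; exact P.val_const_le c
  | add p q hp hq => rw [map_add]; exact (P.val.map_add _ _).trans (max_le hp hq)
  | monomial n c h =>
    rw [map_mul, ofPoly_C, map_pow, ofPoly_X, map_mul, map_pow]
    exact mul_le_one' (P.val_const_le c) (pow_le_one' hx _)

lemma exists_fK_eq_mul (hsep : f.Separable) (hω : (fK f K).eval ω = 0) :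
    ∃ q : K[X], fK f K = (X - C ω) * q ∧ q.eval ω ≠ 0 := by
  obtain ⟨q, hq⟩ := dvd_iff_isRoot.2 hω
  refine ⟨q, hq, not_X_sub_C_dvd_iff.1 fun ⟨r, hr⟩ => (irreducible_X_sub_C ω).not_isUnit ?_⟩
  exact (fK_separable (K := K) hsep).squarefree _ ⟨r, by rw [hq, hr]; ring⟩

lemma IsWeierstrass.val_xCoord_le_one {P : Place f K} (hP : IsWeierstrass f K ω P) :
    P.val (xCoord f K) ≤ 1 := by
  rw [← sub_add_cancel (xCoord f K) (algebraMap K (FunField f K) ω)]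
  exact (P.val.map_add _ _).trans (max_le hP.1.le (P.val_const_le ω))

lemma IsWeierstrass.val_ofPoly_eq_one {P : Place f K} (hP : IsWeierstrass f K ω P) {q : K[X]}
    (hq : q.eval ω ≠ 0) : P.val (ofPoly f K q) = 1 := by
  obtain ⟨r, hr⟩ := X_sub_C_dvd_sub_C_eval (a := ω) (p := q)
  have e : ofPoly f K q = ofPoly f K ((X - C ω) * r) + ofPoly f K (C (q.eval ω)) := by
    rw [← map_add, ← hr, sub_add_cancel]
  rw [e, Valuation.map_add_eq_of_lt_right, ofPoly_C, P.const _ hq]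
  rw [ofPoly_C, P.const _ hq, map_mul, map_mul, ofPoly_X_sub_C]
  exact (mul_le_of_le_one_right' (Place.val_ofPoly_le_one hP.val_xCoord_le_one r)).trans_lt hP.1

/-- The Weierstrass point above `ω` is unique: its valuation is determined, up to normalization,
by its value at `y`, because even and odd orders do not interfere. -/
lemma IsWeierstrass.eq_weierPlace (hdeg : f.natDegree = 6) {P : Place f K}
    (hP : IsWeierstrass f K ω P) : P = weierPlace hsep hω := by
  obtain ⟨q, hq, hqω⟩ := exists_fK_eq_mul hsep hω
  have hy0 : P.val (yCoord f K) ≠ 0 := by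
    have := add_mul_yCoord_ne_zero (K := K) hsep hdeg (a := 0) (b := 1) (by simp)
    exact P.val_ne_zero hsep hdeg (by simpa using this)
  obtain ⟨n, hn0, hn⟩ : ∃ n : ℕ, n ≠ 0 ∧ P.val (yCoord f K) = WithZero.exp (-1) ^ n := by
    have h1 := hP.2
    rw [← WithZero.exp_log hy0, ← WithZero.exp_zero, WithZero.exp_lt_exp] at h1
    refine ⟨(-WithZero.log (P.val (yCoord f K))).toNat, by omega, ?_⟩
    conv_lhs => rw [← WithZero.exp_log hy0]
    rw [← WithZero.exp_nsmul, WithZero.exp_inj]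
    simp only [nsmul_eq_mul]
    omega
  -- `y ^ 2` is `x - ω` up to a unit at `P`
  have ht : P.val (ofPoly f K (X - C ω)) = WithZero.exp (-1) ^ (2 * n) := by
    have h1 := congrArg P.val (yCoord_sq f K)
    rw [hq, map_mul, map_mul, hP.val_ofPoly_eq_one hqω, mul_one, map_pow, hn] at h1
    rw [← h1, ← pow_mul, mul_comm]
  let u : Valuation (RatFunc K) ℤᵐ⁰ := P.val.comap (ofRat f K)
  have hupoly (p : K[X]) : u (algebraMap _ _ p) = linVal ω (algebraMap _ _ p) ^ (2 * n) := by
    by_cases hp : p = 0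
    · simp [hp, hn0]
    obtain ⟨r, hr, hr'⟩ := exists_eq_pow_rootMultiplicity_mul_and_not_dvd p hp ω
    have h1 : u (algebraMap _ _ r) = 1 := hP.val_ofPoly_eq_one (not_X_sub_C_dvd_iff.1 hr')
    have h2 : u (algebraMap _ _ (X - C ω)) = WithZero.exp (-1) ^ (2 * n) := ht
    have h3 : linVal ω (algebraMap _ _ r) = 1 := (polyVal_eq_one_iff _).2 hr'
    have h4 : linVal ω (algebraMap _ _ (X - C ω)) = WithZero.exp (-1) := polyVal_self _
    rw [hr]
    simp only [map_mul, map_pow, h1, h2, h3, h4, mul_one]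
    rw [← pow_mul, ← pow_mul, mul_comm]
  have hu (r : RatFunc K) : u r = (linVal ω r ^ 2) ^ n := by
    rw [← RatFunc.num_div_denom r, map_div₀, map_div₀, hupoly, hupoly, ← pow_mul, div_pow]
  have key (g : FunField f K) : P.val g = (weierPlace hsep hω).val g ^ n := by
    obtain ⟨a, b, rfl⟩ := exists_add_mul_yCoord f K g
    rw [weierPlace_val]
    have ha : P.val (ofRat f K a) = (linVal ω a ^ 2) ^ n := hu a
    have hb : P.val (ofRat f K b * yCoord f K) = (linVal ω b ^ 2 * WithZero.exp (-1)) ^ n := by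
      rw [map_mul, hn, mul_pow]
      congr 1
      exact hu b
    by_cases h : linVal ω a ≠ 0 ∨ linVal ω b ≠ 0
    · rw [Valuation.map_add_of_distinct_val, ha, hb]
      · exact ((pow_left_mono n).map_max).symm
      · rw [ha, hb]
        exact fun e => sq_ne_sq_mul_exp h ((pow_left_inj₀ zero_le zero_le hn0).1 e)
    · push Not at h
      have ha := (Valuation.zero_iff _).1 h.1
      have hb := (Valuation.zero_iff _).1 h.2
      simp [ha, hb, hn0]
  -- both valuations are normalized
  have hn1 : n = 1 := by
    obtain ⟨g, hg⟩ := P.surj (WithZero.exp (-1))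
    rw [key] at hg
    generalize (weierPlace hsep hω).val g = c at hg
    induction c using WithZero.expRecOn with
    | zero => rw [zero_pow hn0] at hg; exact absurd hg.symm WithZero.exp_ne_zero
    | exp m =>
      rw [← WithZero.exp_nsmul, WithZero.exp_inj, nsmul_eq_mul] at hg
      have : IsUnit (n : ℤ) := isUnit_of_dvd_unit ⟨m, hg.symm⟩ (by decide)
      simpa using Int.natAbs_of_isUnit this
  ext g
  rw [key, hn1, pow_one]

/-- The order of `x - ω` at a point is `2` at `(ω, 0)`, up to the contribution of the poles
of `x`. -/
lemma Place.ord_X_sub_C (hdeg : f.natDegree = 6) (P : Place f K) :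
    P.ord (ofPoly f K (X - C ω)) =
      2 * Finsupp.single (weierPlace hsep hω) (1 : ℤ) P -
        WithZero.log (max 1 (P.val (xCoord f K))) := by
  classical
  rw [Finsupp.single_apply, Place.ord]
  by_cases h : weierPlace hsep hω = P
  · rw [if_pos h]
    subst h
    rw [weierPlace_X_sub_C, max_eq_left (isWeierstrass_weierPlace hsep hω).val_xCoord_le_one]
    simp
  rw [if_neg h]
  rcases lt_or_ge 1 (P.val (xCoord f K)) with hx | hx
  · rw [max_eq_right hx.le, ofPoly_X_sub_C, Valuation.map_sub_eq_of_lt_left]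
    · simp
    · exact (P.val_const_le ω).trans_lt hx
  · rw [max_eq_left hx]
    suffices h1 : P.val (ofPoly f K (X - C ω)) = 1 by rw [h1]; simp
    refine le_antisymm (Place.val_ofPoly_le_one hx _) (not_lt.1 fun hlt => h ?_)
    refine (IsWeierstrass.eq_weierPlace hsep hω hdeg ⟨by rwa [← ofPoly_X_sub_C], ?_⟩).symm
    obtain ⟨q, hq, -⟩ := exists_fK_eq_mul hsep hω
    have h1 := congrArg P.val (yCoord_sq f K)
    rw [hq, map_mul, map_mul, map_pow] at h1
    have h2 : P.val (yCoord f K) ^ 2 < 1 := by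
      rw [h1]
      exact (mul_le_of_le_one_right' (Place.val_ofPoly_le_one hx q)).trans_lt hlt
    exact (pow_lt_one_iff two_ne_zero).1 h2

end Weierstrass

end

section

variable {k : Type u} [Field k] {f : k[X]} {K : Type v} [Field K] [Algebra k K]

/-! ### Roots of `f` -/

lemma eval_rootSet (ω : f.rootSet K) : (fK f K).eval ω.1 = 0 := by
  rw [eval_map_algebraMap]
  exact aeval_eq_zero_of_mem_rootSet ω.2

lemma fK_splits [IsSepClosed K] (hsep : f.Separable) : (fK f K).Splits :=
  IsSepClosed.splits_of_separable _ (fK_separable hsep)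

lemma exists_root_of_irreducible [IsSepClosed K] (hsep : f.Separable) {p : K[X]}
    (hp : Irreducible p) (hpf : p ∣ fK f K) : ∃ ω : f.rootSet K, Associated p (X - C ω.1) := by
  obtain ⟨ω, hω⟩ := ((fK_splits hsep).of_dvd (fK_ne_zero hsep) hpf).exists_eval_eq_zero
    (degree_pos_of_irreducible hp).ne'
  refine ⟨⟨ω, mem_rootSet.2 ⟨hsep.ne_zero, ?_⟩⟩, ?_⟩
  · rw [← eval_map_algebraMap]
    exact eval_eq_zero_of_dvd_of_eval_eq_zero hpf hω
  · exact ((irreducible_X_sub_C ω).associated_of_dvd hp (dvd_iff_isRoot.2 hω)).symm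

/-- A squarefree polynomial divides `g` if all its irreducible factors do. -/
lemma squarefree_dvd_of_forall_irreducible {s g : K[X]} (hs : Squarefree s)
    (h : ∀ p, Irreducible p → p ∣ s → p ∣ g) : s ∣ g := by
  classical
  obtain ⟨q, hq⟩ := EuclideanDomain.gcd_dvd_left s g
  have hu : IsUnit q := by
    by_contra hu
    have hq0 : q ≠ 0 := by rintro rfl; rw [mul_zero] at hq; exact hs.ne_zero hq
    obtain ⟨p, hp, hpq⟩ := WfDvdMonoid.exists_irreducible_factor hu hq0
    have hps : p ∣ s := hpq.trans ⟨_, hq.trans (mul_comm _ _)⟩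
    have := mul_dvd_mul (EuclideanDomain.dvd_gcd hps (h p hp hps)) hpq
    rw [← hq] at this
    exact hp.not_isUnit (hs p this)
  have : s ∣ EuclideanDomain.gcd s g := by
    conv_lhs => rw [hq]
    exact (hu.mul_right_dvd).2 dvd_rfl
  exact this.trans (EuclideanDomain.gcd_dvd_right s g)

/-- The monic polynomial whose roots are the elements of `S`. -/
def rootProd (S : Finset (f.rootSet K)) : K[X] := ∏ ω ∈ S, (X - C ω.1)

lemma rootProd_ne_zero (S : Finset (f.rootSet K)) : rootProd S ≠ 0 :=
  Finset.prod_ne_zero_iff.2 fun ω _ => X_sub_C_ne_zero ω.1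

lemma natDegree_rootProd (S : Finset (f.rootSet K)) : (rootProd S).natDegree = S.card :=
  (natDegree_prod_of_monic _ _ fun ω _ => monic_X_sub_C _).trans (by simp)

lemma exists_eq_C_mul_rootProd [IsSepClosed K] (hsep : f.Separable) {s : K[X]}
    (hs : s ∣ fK f K) : ∃ (c : K) (S : Finset (f.rootSet K)), c ≠ 0 ∧ s = C c * rootProd S := by
  classical
  have hs0 : s ≠ 0 := ne_zero_of_dvd_ne_zero (fK_ne_zero hsep) hs
  refine ⟨s.leadingCoeff, Finset.univ.filter fun ω => s.eval ω.1 = 0,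
    leadingCoeff_ne_zero.2 hs0, ?_⟩
  have h1 := ((fK_splits hsep).of_dvd (fK_ne_zero hsep) hs).eq_prod_roots
  have h2 : s.roots.Nodup := nodup_roots ((fK_separable hsep).of_dvd hs)
  conv_lhs => rw [h1]
  congr 1
  change ∏ a ∈ (⟨s.roots, h2⟩ : Finset K), (X - C a) = rootProd _
  symm
  refine Finset.prod_bij (fun ω _ => ω.1) (fun ω hω => ?_) (fun a _ b _ h => Subtype.ext h)
    (fun a ha => ?_) (fun _ _ => rfl)
  · exact (mem_roots hs0).2 (Finset.mem_filter.1 hω).2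
  · have ha' : s.eval a = 0 := (mem_roots hs0).1 ha
    refine ⟨⟨a, mem_rootSet.2 ⟨hsep.ne_zero, ?_⟩⟩, by simpa using ha', rfl⟩
    rw [← eval_map_algebraMap]
    exact eval_eq_zero_of_dvd_of_eval_eq_zero hs ha'

lemma fK_eq_C_mul_rootProd [IsSepClosed K] (hsep : f.Separable) :
    ∃ c : K, c ≠ 0 ∧ fK f K = C c * rootProd (Finset.univ : Finset (f.rootSet K)) := by
  classical
  obtain ⟨c, S, hc, h⟩ := exists_eq_C_mul_rootProd hsep (dvd_refl (fK f K))
  refine ⟨c, hc, ?_⟩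
  suffices hS : S = Finset.univ by rw [h, hS]
  refine Finset.eq_univ_of_forall fun ω => ?_
  have h1 := eval_rootSet ω
  rw [h, rootProd, eval_mul, eval_C, eval_prod, mul_eq_zero, or_iff_right hc,
    Finset.prod_eq_zero_iff] at h1
  obtain ⟨ω', h', e⟩ := h1
  rw [eval_sub, eval_X, eval_C, sub_eq_zero] at e
  rwa [Subtype.ext e]

lemma rootProd_dvd_fK [IsSepClosed K] (hsep : f.Separable) (S : Finset (f.rootSet K)) :
    rootProd S ∣ fK f K := by
  obtain ⟨c, -, h⟩ := fK_eq_C_mul_rootProd (K := K) hsep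
  rw [h]
  exact Dvd.dvd.mul_left (Finset.prod_dvd_prod_of_subset _ _ _ (Finset.subset_univ S)) _

lemma squarefree_rootProd [IsSepClosed K] (hsep : f.Separable) (S : Finset (f.rootSet K)) :
    Squarefree (rootProd S) :=
  (fK_separable (K := K) hsep).squarefree.squarefree_of_dvd (rootProd_dvd_fK hsep S)

lemma card_rootSet [IsSepClosed K] (hsep : f.Separable) (hdeg : f.natDegree = 6) :
    Fintype.card (f.rootSet K) = 6 := by
  obtain ⟨c, hc, h⟩ := fK_eq_C_mul_rootProd (K := K) hsep
  have := congrArg natDegree h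
  rw [fK_natDegree hdeg, natDegree_C_mul hc, natDegree_rootProd] at this
  exact this.symm

/-- A product of distinct factors `x - ω` is not a square up to constants. -/
lemma eq_empty_of_rootProd_eq [IsSepClosed K] [NeZero (2 : K)] (hsep : f.Separable)
    {S : Finset (f.rootSet K)} {c : K} {q : RatFunc K}
    (h : algebraMap K[X] _ (rootProd S) = algebraMap K _ c * q ^ 2) : S = ∅ := by
  by_contra hS
  obtain ⟨e, rfl⟩ := IsSepClosed.exists_eq_mul_self c
  refine not_isSquare_of_squarefree (squarefree_rootProd hsep S) (fun hu => hS ?_)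
    (algebraMap K _ e * q) ?_
  · have := natDegree_eq_zero_of_isUnit hu
    rwa [natDegree_rootProd, Finset.card_eq_zero] at this
  · rw [h, map_mul, mul_pow, sq (algebraMap K _ e)]

/-! ### Orders of functions -/

section ord

lemma Place.val_eq_exp (P : Place f K) {g : FunField f K} (hg : P.val g ≠ 0) :
    P.val g = WithZero.exp (-P.ord g) := by
  rw [Place.ord, neg_neg, WithZero.exp_log hg]

lemma Place.ord_mul' (P : Place f K) {g h : FunField f K} (hg : P.val g ≠ 0) (hh : P.val h ≠ 0) :
    P.ord (g * h) = P.ord g + P.ord h := by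
  rw [Place.ord, Place.ord, Place.ord, map_mul, WithZero.log_mul hg hh, neg_add]

lemma Place.ord_pow (P : Place f K) (g : FunField f K) (n : ℕ) : P.ord (g ^ n) = n * P.ord g := by
  simp [Place.ord, map_pow, WithZero.log_pow]

lemma Place.ord_const (P : Place f K) {c : K} (hc : c ≠ 0) :
    P.ord (algebraMap K (FunField f K) c) = 0 := by
  rw [Place.ord, P.const c hc]; rfl

/-- The image of a point under the hyperelliptic involution. -/
def conjPlace (P : Place f K) : Place f K where
  val := P.val.comap (conj f K)
  surj := fun a => by
    obtain ⟨g, hg⟩ := P.surj a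
    exact ⟨conj f K g, by rw [Valuation.comap_apply, conj_conj, hg]⟩
  const := fun c hc => by rw [Valuation.comap_apply, conj_const, P.const c hc]

lemma conjPlace_val (P : Place f K) (g : FunField f K) :
    (conjPlace P).val g = P.val (conj f K g) := rfl

lemma conjPlace_ord (P : Place f K) (g : FunField f K) :
    (conjPlace P).ord g = P.ord (conj f K g) := rfl

/-- The Weierstrass point attached to a root of `f`. -/
def rootPlace (hsep : f.Separable) (ω : f.rootSet K) : Place f K := weierPlace hsep (eval_rootSet ω)

lemma isWeierstrass_rootPlace (hsep : f.Separable) (ω : f.rootSet K) :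
    IsWeierstrass f K ω (rootPlace hsep ω) :=
  isWeierstrass_weierPlace _ _

lemma IsWeierstrass.eq_rootPlace (hsep : f.Separable) (hdeg : f.natDegree = 6)
    {ω : f.rootSet K} {P : Place f K} (h : IsWeierstrass f K ω P) :
    P = rootPlace hsep ω :=
  h.eq_weierPlace _ _ hdeg

lemma conjPlace_rootPlace (hsep : f.Separable) (hdeg : f.natDegree = 6)
    (ω : f.rootSet K) :
    conjPlace (rootPlace hsep ω) = rootPlace hsep ω := by
  refine IsWeierstrass.eq_rootPlace hsep hdeg ⟨?_, ?_⟩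
  · rw [conjPlace_val, ← ofPoly_X_sub_C, conj_ofPoly, ofPoly_X_sub_C]
    exact (isWeierstrass_rootPlace hsep ω).1
  · rw [conjPlace_val, conj_yCoord, Valuation.map_neg]
    exact (isWeierstrass_rootPlace hsep ω).2

lemma smul_rootPlace (hsep : f.Separable) (hdeg : f.natDegree = 6)
    (σ : K ≃ₐ[k] K) (ω : f.rootSet K) :
    σ • rootPlace hsep ω = rootPlace hsep (rootPerm f K σ ω) := by
  refine IsWeierstrass.eq_rootPlace hsep hdeg ⟨?_, ?_⟩
  · have : σ⁻¹ • (xCoord f K - algebraMap K (FunField f K) (rootPerm f K σ ω).1) =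
        xCoord f K - algebraMap K (FunField f K) ω.1 := by
      rw [smul_sub, smul_xCoord, smul_const]
      congr 2
      exact σ.symm_apply_apply _
    rw [Place.smul_val, this]
    exact (isWeierstrass_rootPlace hsep ω).1
  · rw [Place.smul_val, smul_yCoord]
    exact (isWeierstrass_rootPlace hsep ω).2

lemma ofPoly_ne_zero {p : K[X]} (hp : p ≠ 0) : ofPoly f K p ≠ 0 := by
  rw [ofPoly_apply, Ne, map_eq_zero_iff _ ofRat_injective]
  exact RatFunc.algebraMap_ne_zero hp

lemma Place.ord_mul (hsep : f.Separable) (hdeg : f.natDegree = 6)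
    (P : Place f K) {g h : FunField f K} (hg : g ≠ 0) (hh : h ≠ 0) :
    P.ord (g * h) = P.ord g + P.ord h :=
  P.ord_mul' (P.val_ne_zero hsep hdeg hg) (P.val_ne_zero hsep hdeg hh)

/-- The order of the function `x - ω`; the last term depends only on the point. -/
lemma Place.ord_root (hsep : f.Separable) (hdeg : f.natDegree = 6)
    (P : Place f K) (ω : f.rootSet K) :
    P.ord (ofPoly f K (X - C ω.1)) =
      2 * Finsupp.single (rootPlace hsep ω) (1 : ℤ) P -
        WithZero.log (max 1 (P.val (xCoord f K))) :=
  P.ord_X_sub_C hsep (eval_rootSet ω) hdeg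

lemma Place.ord_rootProd (hsep : f.Separable) (hdeg : f.natDegree = 6)
    (P : Place f K) (S : Finset (f.rootSet K)) :
    P.ord (ofPoly f K (rootProd S)) =
      2 * ∑ ω ∈ S, Finsupp.single (rootPlace hsep ω) (1 : ℤ) P -
        S.card * WithZero.log (max 1 (P.val (xCoord f K))) := by
  classical
  induction S using Finset.induction_on with
  | empty => simp [rootProd, Place.ord]
  | insert ω S hω ih =>
    rw [rootProd, Finset.prod_insert hω, map_mul]
    change P.ord (_ * ofPoly f K (rootProd S)) = _
    rw [P.ord_mul hsep hdeg
      (ofPoly_ne_zero (X_sub_C_ne_zero _)) (ofPoly_ne_zero (rootProd_ne_zero S)),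
      Finset.sum_insert hω, Finset.card_insert_of_notMem hω, P.ord_root hsep hdeg, ih]
    push_cast
    ring

end ord

/-! ### Functions whose divisor is even -/

section even

lemma conj_ne_zero {g : FunField f K} (hg : g ≠ 0) : conj f K g ≠ 0 := fun h => hg (by
  rw [← conj_conj f K g, h, map_zero])

/-- A function whose norm is a square is a square up to a rational function of `x`: this is
Hilbert 90 for the quadratic extension. If `g = a + b y` has norm `H ^ 2`, then
`(g + H) ^ 2 = 2 (a + H) g`. -/
lemma exists_eq_mul_sq_of_normFun [NeZero (2 : K)] (hsep : f.Separable) (hdeg : f.natDegree = 6)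
    {g : FunField f K} (hg : g ≠ 0) {H : RatFunc K}
    (hH : normFun g = H ^ 2) :
    ∃ (r : RatFunc K) (u : FunField f K), r ≠ 0 ∧ u ≠ 0 ∧ g = ofRat f K r * u ^ 2 := by
  obtain ⟨a, b, hab⟩ := exists_add_mul_yCoord f K g
  have h2 : (2 : RatFunc K) ≠ 0 := fun h => two_ne_zero (α := K)
    ((algebraMap K (RatFunc K)).injective (by rw [map_ofNat, map_zero, h]))
  have hn : g * conj f K g = ofRat f K H ^ 2 := by rw [← ofRat_normFun, hH, map_pow]
  have hc : conj f K g = 2 * ofRat f K a - g := by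
    rw [hab, map_add, map_mul, conj_ofRat, conj_ofRat, conj_yCoord]; ring
  have key : (g + ofRat f K H) ^ 2 = g * ofRat f K (2 * (a + H)) := by
    rw [map_mul, map_add, map_ofNat]
    have : g ^ 2 = g * (2 * ofRat f K a) - ofRat f K H ^ 2 := by rw [← hn, hc]; ring
    rw [add_sq, this]; ring
  by_cases h0 : a + H = 0
  · rw [h0, mul_zero, map_zero, mul_zero] at key
    have hz : g + ofRat f K H = 0 := by
      by_contra hne
      have := ((isUnit_of_ne_zero hsep hdeg hne).pow 2)
      rw [key, isUnit_zero_iff] at this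
      exact hg (by rw [← mul_one g, ← this, mul_zero])
    have hg' : g = ofRat f K (-H) := by rw [map_neg]; exact eq_neg_of_add_eq_zero_left hz
    refine ⟨-H, 1, fun h => hg (by rw [hg', h, map_zero]), ?_, by rw [hg', one_pow, mul_one]⟩
    exact fun h => hg (by rw [← mul_one g, h, mul_zero])
  · have hr : 2 * (a + H) ≠ 0 := mul_ne_zero h2 h0
    have e : g = ofRat f K (2 * (a + H))⁻¹ * (g + ofRat f K H) ^ 2 := by
      rw [key, mul_left_comm, ← map_mul, inv_mul_cancel₀ hr, map_one, mul_one]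
    refine ⟨_, _, inv_ne_zero hr, fun h => hg ?_, e⟩
    rw [e, h]; simp

lemma normFun_ne_zero (hsep : f.Separable) (hdeg : f.natDegree = 6)
    {g : FunField f K} (hg : g ≠ 0) : normFun g ≠ 0 := by
  intro h
  have := ofRat_normFun g
  rw [h, map_zero] at this
  exact hg (((isUnit_of_ne_zero hsep hdeg (conj_ne_zero hg)).mul_left_eq_zero).1 this.symm)

variable [IsSepClosed K] [NeZero (2 : K)]

/-- The order, at an unramified place above `p`, of a rational function with squarefree part
divisible by `p`. -/
lemma exists_place_odd_ord {p s : K[X]} (hp : Irreducible p) (hpf : ¬ p ∣ fK f K)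
    (hs : Squarefree s) (hps : p ∣ s) {h : RatFunc K} (hh : h ≠ 0) :
    ∃ P : Place f K, Odd (P.ord (ofRat f K (h ^ 2 * algebraMap _ _ s))) := by
  obtain ⟨P, hP⟩ := exists_place_of_irreducible hp hpf
  refine ⟨P, ?_⟩
  rw [Place.ord, hP, map_mul, map_pow, polyVal_of_squarefree hp hs hps,
    WithZero.log_mul (pow_ne_zero 2 ((Valuation.ne_zero_iff _).2 hh)) WithZero.exp_ne_zero,
    WithZero.log_pow, WithZero.log_exp]
  exact ⟨-WithZero.log (polyVal hp h), by simp only [nsmul_eq_mul]; push_cast; ring⟩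

/-- If a polynomial has even order at all points, then it has even degree. -/
lemma even_natDegree_of_even_ord (hdeg : f.natDegree = 6) {s : K[X]} (hs : s ≠ 0)
    (h : ∀ P : Place f K, Even (P.ord (ofPoly f K s))) : Even s.natDegree := by
  classical
  obtain ⟨P, hP⟩ := exists_place_infty (K := K) hdeg
  have := h P
  rw [Place.ord, ofPoly_apply, hP, inftyValuation_algebraMap hs, WithZero.log_exp] at this
  simpa using this

/-- A rational function without poles on the curve is constant. -/
lemma exists_eq_const_of_val_le_one (hsep : f.Separable) (hdeg : f.natDegree = 6)
    {r : RatFunc K}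
    (h : ∀ P : Place f K, P.val (ofRat f K r) ≤ 1) : ∃ c : K, r = algebraMap K _ c := by
  classical
  obtain ⟨p, rfl⟩ := IsDedekindDomain.HeightOneSpectrum.mem_integers_of_valuation_le_one
    (RatFunc K) r fun v => by
      obtain ⟨p, hp⟩ := (IsPrincipalIdealRing.principal (R := K[X]) v.asIdeal).principal
      have hp0 : p ≠ 0 := by
        rintro rfl
        exact v.ne_bot (by simpa using hp)
      have hirr : Irreducible p := by
        refine ((Ideal.span_singleton_prime hp0).1 ?_).irreducible
        rw [← Ideal.submodule_span_eq, ← hp]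
        exact v.isPrime
      have hv : v = primeSpec hirr := IsDedekindDomain.HeightOneSpectrum.ext hp
      rw [hv]
      by_cases hpf : p ∣ fK f K
      · obtain ⟨ω, hω⟩ := exists_root_of_irreducible hsep hirr hpf
        have e : primeSpec hirr = primeSpec (irreducible_X_sub_C ω.1) :=
          IsDedekindDomain.HeightOneSpectrum.ext (Ideal.span_singleton_eq_span_singleton.2 hω)
        have h1 := h (rootPlace hsep ω)
        rw [rootPlace, weierPlace_ofRat] at h1
        rw [e]
        exact (pow_le_one_iff two_ne_zero).1 h1
      · obtain ⟨P, hP⟩ := exists_place_of_irreducible hirr hpf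
        exact (hP r).symm.le.trans (h P)
  obtain ⟨P, hP⟩ := exists_place_infty (K := K) hdeg
  have h1 := h P
  by_cases hp : p = 0
  · exact ⟨0, by simp [hp]⟩
  rw [hP, inftyValuation_algebraMap hp, ← WithZero.exp_zero, WithZero.exp_le_exp] at h1
  obtain ⟨c, rfl⟩ := natDegree_eq_zero.1 (show p.natDegree = 0 by omega)
  exact ⟨c, by rw [IsScalarTower.algebraMap_apply K K[X] (RatFunc K)]; rfl⟩

/-- If the divisor of `g` is twice a divisor, then the norm of `g` is a square: an irreducible
factor of its squarefree part would give a point at which the norm has the wrong order. At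
a Weierstrass point, which is ramified and its own conjugate, orders are compared modulo four. -/
lemma exists_normFun_eq_sq (hsep : f.Separable) (hdeg : f.natDegree = 6)
    {g : FunField f K} (hg : g ≠ 0) {D : Place f K → ℤ}
    (hD : ∀ P, P.ord g = 2 * D P) : ∃ H : RatFunc K, normFun g = H ^ 2 := by
  obtain ⟨h, s, h0, hs, e⟩ := RatFunc.exists_sq_mul_squarefree (normFun_ne_zero hsep hdeg hg)
  have hord (P : Place f K) : P.ord (ofRat f K (normFun g)) = 2 * D P + 2 * D (conjPlace P) := by
    rw [ofRat_normFun, P.ord_mul hsep hdeg hg (conj_ne_zero hg), ← conjPlace_ord, hD, hD]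
  have hu : IsUnit s := by
    by_contra hu
    obtain ⟨p, hp, hps⟩ := WfDvdMonoid.exists_irreducible_factor hu hs.ne_zero
    by_cases hpf : p ∣ fK f K
    · obtain ⟨ω, hω⟩ := exists_root_of_irreducible hsep hp hpf
      have h1 := hord (rootPlace hsep ω)
      rw [conjPlace_rootPlace hsep hdeg, e, Place.ord, rootPlace, weierPlace_ofRat, map_mul,
        map_pow, polyVal_of_squarefree _ hs (hω.symm.dvd.trans hps), WithZero.log_pow,
        WithZero.log_mul (pow_ne_zero 2 ((Valuation.ne_zero_iff _).2 h0)) WithZero.exp_ne_zero,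
        WithZero.log_pow, WithZero.log_exp] at h1
      simp only [nsmul_eq_mul] at h1
      push_cast at h1
      omega
    · obtain ⟨P, hP⟩ := exists_place_odd_ord hp hpf hs hps h0
      rw [← e, hord, ← mul_add] at hP
      exact Int.not_even_iff_odd.2 hP (even_two_mul _)
  obtain ⟨c, hc, rfl⟩ := isUnit_iff.1 hu
  obtain ⟨z, rfl⟩ := IsSepClosed.exists_eq_mul_self c
  refine ⟨h * algebraMap _ _ (C z), ?_⟩
  rw [e, map_mul, map_mul]; ring

/-- A divisor `D` such that `2D` is principal is, up to a principal divisor, a sum of differences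
of Weierstrass points. The function `g` with divisor `2D` is a square times a squarefree polynomial
in `x`, which must divide `f`. -/
lemma exists_of_two_mul_eq_ord (hsep : f.Separable) (hdeg : f.natDegree = 6)
    {g : FunField f K} (hg : g ≠ 0) {D : Place f K → ℤ}
    (hD : ∀ P, P.ord g = 2 * D P) (ω₀ : f.rootSet K) :
    ∃ (U : FunField f K) (S : Finset (f.rootSet K)), U ≠ 0 ∧ Even S.card ∧
      ∀ P, D P = P.ord U + ∑ ω ∈ S, (Finsupp.single (rootPlace hsep ω) (1 : ℤ) P -
        Finsupp.single (rootPlace hsep ω₀) (1 : ℤ) P) := by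
  obtain ⟨H, hH⟩ := exists_normFun_eq_sq hsep hdeg hg hD
  obtain ⟨r, u, hr, hu, hgr⟩ := exists_eq_mul_sq_of_normFun hsep hdeg hg hH
  obtain ⟨h, s, h0, hs, e⟩ := RatFunc.exists_sq_mul_squarefree hr
  have hh : ofRat f K h ≠ 0 := fun h' => h0 (ofRat_injective (f := f) (by rw [h', map_zero]))
  have hU : u * ofRat f K h ≠ 0 :=
    ((isUnit_of_ne_zero hsep hdeg hu).mul_right_eq_zero).not.2 hh
  have hU2 : (u * ofRat f K h) ^ 2 ≠ 0 := by
    rw [sq]; exact ((isUnit_of_ne_zero hsep hdeg hU).mul_right_eq_zero).not.2 hU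
  have hs' : ofPoly f K s ≠ 0 := ofPoly_ne_zero hs.ne_zero
  have hord (P : Place f K) : P.ord (ofPoly f K s) = 2 * (D P - P.ord (u * ofRat f K h)) := by
    have h1 : g = ofPoly f K s * (u * ofRat f K h) ^ 2 := by
      rw [hgr, e, map_mul, map_pow, ofPoly_apply]; ring
    have h2 := hD P
    rw [h1, P.ord_mul hsep hdeg hs' hU2, P.ord_pow] at h2
    push_cast at h2
    linarith
  have hsf : s ∣ fK f K := squarefree_dvd_of_forall_irreducible hs fun p hp hps => by
    by_contra hpf
    obtain ⟨P, hP⟩ := exists_place_odd_ord hp hpf hs hps one_ne_zero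
    rw [one_pow, one_mul, ← ofPoly_apply, hord] at hP
    exact Int.not_even_iff_odd.2 hP (even_two_mul _)
  have hev := even_natDegree_of_even_ord hdeg hs.ne_zero fun P => hord P ▸ even_two_mul _
  obtain ⟨c, S, hc, rfl⟩ := exists_eq_C_mul_rootProd hsep hsf
  rw [natDegree_C_mul hc, natDegree_rootProd] at hev
  obtain ⟨j, hj⟩ := hev
  have hX : ofPoly f K (X - C ω₀.1) ≠ 0 := ofPoly_ne_zero (X_sub_C_ne_zero _)
  have hXj : ofPoly f K (X - C ω₀.1) ^ j ≠ 0 := by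
    rw [← map_pow]; exact ofPoly_ne_zero (pow_ne_zero _ (X_sub_C_ne_zero _))
  refine ⟨u * ofRat f K h * ofPoly f K (X - C ω₀.1) ^ j, S,
    ((isUnit_of_ne_zero hsep hdeg hU).mul_right_eq_zero).not.2 hXj, ⟨j, hj⟩, fun P => ?_⟩
  have h1 := hord P
  rw [map_mul, P.ord_mul hsep hdeg (ofPoly_ne_zero (C_ne_zero.2 hc))
    (ofPoly_ne_zero (rootProd_ne_zero S)), ofPoly_C, P.ord_const hc, P.ord_rootProd hsep hdeg] at h1
  rw [P.ord_mul hsep hdeg hU hXj, P.ord_pow, P.ord_root hsep hdeg, Finset.sum_sub_distrib,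
    Finset.sum_const, nsmul_eq_mul]
  rw [hj] at h1 ⊢
  push_cast at h1 ⊢
  linarith

/-- A sum of differences of Weierstrass points, indexed by a set `S` of even cardinality, is
principal only if `S` is empty or contains all roots. If it is the divisor of `g = a + b y`, then
`div g = div (a - b y)`, so `a ^ 2` and `(b y) ^ 2` have divisor at least `2 div g`. A rational
function of `x` with this property is determined up to a constant, which leaves room for only one
of the two. -/
lemma eq_empty_or_univ_of_ord_eq (hsep : f.Separable) (hdeg : f.natDegree = 6)
    {g : FunField f K} (hg : g ≠ 0) (ω₀ : f.rootSet K)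
    {S : Finset (f.rootSet K)} (hS : Even S.card)
    (hD : ∀ P : Place f K, P.ord g = ∑ ω ∈ S, (Finsupp.single (rootPlace hsep ω) (1 : ℤ) P -
        Finsupp.single (rootPlace hsep ω₀) (1 : ℤ) P)) : S = ∅ ∨ S = Finset.univ := by
  classical
  obtain ⟨j, hj⟩ := hS
  set L : RatFunc K := algebraMap K[X] _ (X - C ω₀.1) with hL
  set T : RatFunc K := algebraMap K[X] _ (rootProd S) with hT
  have hL0 : L ≠ 0 := RatFunc.algebraMap_ne_zero (X_sub_C_ne_zero _)
  have hT0 : T ≠ 0 := RatFunc.algebraMap_ne_zero (rootProd_ne_zero S)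
  -- the function `T / L ^ (2 * j)` has the same divisor as `g ^ 2`
  have hval (P : Place f K) :
      P.val (ofRat f K T) = P.val g ^ 2 * P.val (ofRat f K (L ^ j)) ^ 2 := by
    have hT' : P.val (ofRat f K T) ≠ 0 :=
      P.val_ne_zero hsep hdeg (ofPoly_ne_zero (rootProd_ne_zero S))
    have hL' : P.val (ofRat f K (L ^ j)) ≠ 0 := by
      rw [hL, ← map_pow]
      exact P.val_ne_zero hsep hdeg (ofPoly_ne_zero (pow_ne_zero _ (X_sub_C_ne_zero _)))
    rw [P.val_eq_exp hT', P.val_eq_exp hL', P.val_eq_exp (P.val_ne_zero hsep hdeg hg), hD,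
      ← WithZero.exp_nsmul, ← WithZero.exp_nsmul, ← WithZero.exp_add, WithZero.exp_inj, hT, hL,
      map_pow, ← ofPoly_apply, ← ofPoly_apply, P.ord_pow, P.ord_root hsep hdeg,
      P.ord_rootProd hsep hdeg, Finset.sum_sub_distrib, Finset.sum_const, hj]
    simp only [nsmul_eq_mul]
    push_cast
    ring
  have hconj (P : Place f K) : P.val (conj f K g) = P.val g := by
    have h1 := hval (conjPlace P)
    simp only [conjPlace_val, conj_ofRat] at h1
    rw [hval P] at h1
    have hL' : P.val (ofRat f K (L ^ j)) ≠ 0 := by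
      rw [hL, ← map_pow]
      exact P.val_ne_zero hsep hdeg (ofPoly_ne_zero (pow_ne_zero _ (X_sub_C_ne_zero _)))
    exact ((pow_left_inj₀ zero_le zero_le two_ne_zero).1
      (mul_right_cancel₀ (pow_ne_zero 2 hL') h1)).symm
  -- a rational function `q` with `div q ≥ 2 div g` is a constant multiple of `T / L ^ (2 * j)`
  have hq {q : RatFunc K} (hq : ∀ P : Place f K, P.val (ofRat f K q) ≤ P.val g ^ 2) :
      ∃ c : K, q * (L ^ j) ^ 2 = algebraMap K _ c * T := by
    obtain ⟨c, hc⟩ := exists_eq_const_of_val_le_one hsep hdeg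
      (r := q * (L ^ j) ^ 2 / T) fun P => by
        have : P.val (ofRat f K (q * (L ^ j) ^ 2 / T)) * P.val (ofRat f K T) =
            P.val (ofRat f K q) * P.val (ofRat f K (L ^ j)) ^ 2 := by
          rw [← map_mul, ← map_mul, div_mul_cancel₀ _ hT0, map_mul, map_mul, map_pow, map_pow]
        have hT' : 0 < P.val (ofRat f K T) := zero_lt_iff.2
          (P.val_ne_zero hsep hdeg (ofPoly_ne_zero (rootProd_ne_zero S)))
        refine le_of_mul_le_mul_right ?_ hT'
        rw [this, one_mul, hval]
        exact mul_le_mul_left (hq P) _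
    exact ⟨c, by rw [← hc, div_mul_cancel₀ _ hT0]⟩
  obtain ⟨a, b, hab⟩ := exists_add_mul_yCoord f K g
  have hval2 (P : Place f K) : P.val 2 = 1 := by
    have := P.const 2 two_ne_zero
    rwa [map_ofNat (algebraMap K (FunField f K))] at this
  have hc : conj f K g = ofRat f K a - ofRat f K b * yCoord f K := by
    rw [hab, map_add, map_mul, conj_ofRat, conj_ofRat, conj_yCoord]; ring
  by_cases ha : a = 0
  · right
    -- then `b ^ 2 * f` is `∏ ω ∈ S, (x - ω)` up to constants and squares
    have hb : b ≠ 0 := by rintro rfl; exact hg (by rw [hab, ha]; simp)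
    obtain ⟨c, h1⟩ := hq (q := b ^ 2 * algebraMap _ _ (fK f K)) fun P => by
      rw [map_mul, ← ofPoly_apply, ← yCoord_sq, map_pow, ← mul_pow, map_pow]
      refine pow_le_pow_left' ?_ 2
      rw [hab, ha, map_zero, zero_add]
    obtain ⟨e, he, hf⟩ := fK_eq_C_mul_rootProd (K := K) hsep
    have hprod : rootProd (Finset.univ : Finset (f.rootSet K)) = rootProd S * rootProd Sᶜ :=
      (Finset.prod_mul_prod_compl S _).symm
    rw [hf, hprod, map_mul, map_mul, ← hT] at h1
    rw [← Finset.compl_eq_empty_iff]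
    refine eq_empty_of_rootProd_eq hsep (c := c / e) (q := (b * L ^ j)⁻¹) ?_
    have he' : algebraMap K (RatFunc K) e ≠ 0 := by simpa using he
    have heC : algebraMap K[X] (RatFunc K) (C e) = algebraMap K (RatFunc K) e :=
      (IsScalarTower.algebraMap_apply K K[X] (RatFunc K) e).symm
    rw [heC] at h1
    rw [map_div₀]
    field_simp
    apply mul_left_cancel₀ hT0
    rw [mul_comm T (algebraMap K _ c), ← h1]
    ring
  · left
    -- then `a ^ 2` is `∏ ω ∈ S, (x - ω)` up to constants and squares
    obtain ⟨c, h1⟩ := hq (q := a ^ 2) fun P => by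
      rw [map_pow, map_pow]
      refine pow_le_pow_left' ?_ 2
      have : 2 * ofRat f K a = g + conj f K g := by rw [hc, hab]; ring
      rw [← one_mul (P.val (ofRat f K a)), ← hval2 P, ← map_mul, this]
      exact (P.val.map_add _ _).trans (max_le le_rfl (hconj P).le)
    have hc0 : c ≠ 0 := by
      rintro rfl
      rw [map_zero, zero_mul] at h1
      exact mul_ne_zero (pow_ne_zero 2 ha) (pow_ne_zero 2 (pow_ne_zero j hL0)) h1
    refine eq_empty_of_rootProd_eq hsep (c := c⁻¹) (q := a * L ^ j) ?_
    have hc' : algebraMap K (RatFunc K) c ≠ 0 := by simpa using hc0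
    rw [mul_pow, h1, map_inv₀, inv_mul_cancel_left₀ hc']

end even

end

section

variable {k : Type u} [Field k] {f : k[X]} {K : Type v} [Field K] [Algebra k K]

/-! ### The algebra `Lˢ` -/

lemma phi_tmul (ω : f.rootSet K) (c : K) (x : LAlg f) :
    phi f K ω (c ⊗ₜ x) = c * rootHom f K ω x := by
  simp [phi]

/-- The components `φ_ω` together. -/
def phiPi (f : k[X]) (K : Type v) [Field K] [Algebra k K] : LSep f K →ₐ[K] (f.rootSet K → K) :=
  AlgHom.pi (phi f K)

lemma phiPi_surjective (f : k[X]) (K : Type v) [Field K] [Algebra k K] :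
    Function.Surjective (phiPi f K) := by
  classical
  intro v
  let p : K[X] := Lagrange.interpolate Finset.univ (fun ω : f.rootSet K => ω.1) v
  refine ⟨aeval ((1 : K) ⊗ₜ[k] AdjoinRoot.root f) p, funext fun ω => ?_⟩
  change phi f K ω _ = _
  rw [← aeval_algHom_apply, phi_tmul, rootHom_root, one_mul]
  exact Lagrange.eval_interpolate_at_node v Subtype.val_injective.injOn (Finset.mem_univ ω)

lemma phi_units_ne_zero (a : (LSep f K)ˣ) (ω : f.rootSet K) : phi f K ω a ≠ 0 :=
  (a.isUnit.map (phi f K ω)).ne_zero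

section algebra

variable [IsSepClosed K]

lemma phiPi_bijective (hsep : f.Separable) (hdeg : f.natDegree = 6) :
    Function.Bijective (phiPi f K) := by
  refine ⟨?_, phiPi_surjective f K⟩
  have : Module.Finite k (LAlg f) := (AdjoinRoot.powerBasis hsep.ne_zero).finite
  have h : Module.finrank K (LSep f K) = Module.finrank K (f.rootSet K → K) := by
    rw [Module.finrank_baseChange, Module.finrank_fintype_fun_eq_card, card_rootSet hsep hdeg,
      (AdjoinRoot.powerBasis hsep.ne_zero).finrank, AdjoinRoot.powerBasis_dim, hdeg]
  exact (LinearMap.injective_iff_surjective_of_finrank_eq_finrank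
    (f := (phiPi f K).toLinearMap) h).2 (phiPi_surjective f K)

lemma phi_ext (hsep : f.Separable) (hdeg : f.natDegree = 6) {a b : LSep f K}
    (h : ∀ ω, phi f K ω a = phi f K ω b) : a = b :=
  (phiPi_bijective hsep hdeg).1 (funext h)

lemma units_phi_ext (hsep : f.Separable) (hdeg : f.natDegree = 6) {a b : (LSep f K)ˣ}
    (h : ∀ ω, phi f K ω a = phi f K ω b) : a = b :=
  Units.ext (phi_ext hsep hdeg h)

/-- The units of `Lˢ` are the families of nonzero elements of `K` indexed by the roots. -/
lemma exists_units_phi_eq (hsep : f.Separable) (hdeg : f.natDegree = 6) (v : f.rootSet K → K)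
    (hv : ∀ ω, v ω ≠ 0) : ∃ a : (LSep f K)ˣ, ∀ ω, phi f K ω a = v ω := by
  obtain ⟨a, ha⟩ := phiPi_surjective f K v
  obtain ⟨b, hb⟩ := phiPi_surjective f K fun ω => (v ω)⁻¹
  have ha' (ω) : phi f K ω a = v ω := congrFun ha ω
  have hb' (ω) : phi f K ω b = (v ω)⁻¹ := congrFun hb ω
  have hab : a * b = 1 := phi_ext hsep hdeg fun ω => by
    rw [map_mul, ha', hb', map_one, mul_inv_cancel₀ (hv ω)]
  exact ⟨⟨a, b, hab, by rw [mul_comm, hab]⟩, ha'⟩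

lemma norm_pi {ι F : Type*} [Fintype ι] [Field F] (v : ι → F) : Algebra.norm F v = ∏ i, v i := by
  classical
  rw [Algebra.norm_eq_matrix_det (Pi.basisFun F ι)]
  have : Algebra.leftMulMatrix (Pi.basisFun F ι) v = Matrix.diagonal v := by
    ext i j
    rw [Algebra.leftMulMatrix_eq_repr_mul, Matrix.diagonal_apply]
    simp [Pi.single_apply]
  rw [this, Matrix.det_diagonal]

/-- The norm of `Lˢ` extends the norm of `L`. -/
lemma normSep_includeRight (hsep : f.Separable) (hdeg : f.natDegree = 6) (x : LAlg f) :
    normSep f K (Algebra.TensorProduct.includeRight x) = algebraMap k K (Algebra.norm k x) := by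
  have : Module.Finite k (LAlg f) := (AdjoinRoot.powerBasis hsep.ne_zero).finite
  let e := AlgEquiv.ofBijective (phiPi f K) (phiPi_bijective hsep hdeg)
  rw [Algebra.norm_apply, ← LinearMap.det_baseChange]
  have h1 : (Algebra.lmul k (LAlg f) x).baseChange K =
      Algebra.lmul K (LSep f K) (Algebra.TensorProduct.includeRight x) := by
    ext y
    simp
  change _ = LinearMap.det ((Algebra.lmul k (LAlg f) x).baseChange K)
  rw [h1]
  change _ = Algebra.norm K (Algebra.TensorProduct.includeRight x : LSep f K)
  rw [← Algebra.norm_eq_of_algEquiv e, norm_pi]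
  rfl

end algebra

/-! ### Galois invariants and continuity of the action -/

/-- An orbit map of a topological group is locally constant when the stabilizer is open. -/
lemma isLocallyConstant_smul_of_isOpen {G X : Type*} [Group G] [TopologicalSpace G]
    [IsTopologicalGroup G] [MulAction G X] (x : X)
    (h : IsOpen (MulAction.stabilizer G x : Set G)) : IsLocallyConstant fun σ : G => σ • x := by
  refine IsLocallyConstant.iff_exists_open _ |>.2 fun σ =>
    ⟨_, h.leftCoset σ, ⟨1, one_mem _, mul_one σ⟩, ?_⟩
  rintro _ ⟨τ, hτ, rfl⟩
  change (σ * τ) • x = σ • x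
  rw [mul_smul, show τ • x = x from hτ]

lemma isLocallyConstant_galois [Algebra.IsIntegral k K] (x : K) :
    IsLocallyConstant fun σ : K ≃ₐ[k] K => σ x :=
  isLocallyConstant_smul_of_isOpen x (stabilizer_isOpen_of_isIntegral x)

lemma isLocallyConstant_smul [Algebra.IsIntegral k K] (a : LSep f K) :
    IsLocallyConstant fun σ : K ≃ₐ[k] K => σ • a := by
  induction a using TensorProduct.induction_on with
  | zero => simp only [smul_zero]; exact IsLocallyConstant.const _
  | tmul c x => exact (isLocallyConstant_galois c).comp fun c => c ⊗ₜ x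
  | add a b ha hb => simp only [smul_add]; exact ha.add hb

lemma isLocallyConstant_units_smul [Algebra.IsIntegral k K] (a : (LSep f K)ˣ) :
    IsLocallyConstant fun σ : K ≃ₐ[k] K => σ • a :=
  IsLocallyConstant.desc _ Units.val (isLocallyConstant_smul a.1) Units.val_injective

lemma isLocallyConstant_MGroup_smul [Algebra.IsIntegral k K] (a : MGroup f K) :
    IsLocallyConstant fun σ : K ≃ₐ[k] K => σ • a :=
  IsLocallyConstant.desc _ Subtype.val (isLocallyConstant_units_smul a.1) Subtype.val_injective

/-- Galois descent for `Lˢ`: the invariants are `L`. -/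
lemma exists_eq_includeRight_of_fixed [IsGalois k K] {a : LSep f K}
    (h : ∀ σ : K ≃ₐ[k] K, σ • a = a) :
    ∃ x : LAlg f, a = Algebra.TensorProduct.includeRight x := by
  let B := Module.Free.chooseBasis k (LAlg f)
  let B' := Algebra.TensorProduct.basis K B
  have hB (σ : K ≃ₐ[k] K) (a : LSep f K) (i) : B'.repr (σ • a) i = σ (B'.repr a i) := by
    induction a using TensorProduct.induction_on with
    | zero => simp
    | tmul c x =>
      rw [TensorProduct.smul_tmul']
      simp only [B', Algebra.TensorProduct.basis_repr_tmul]
      simp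
    | add a b ha hb =>
      rw [smul_add, map_add, map_add, Finsupp.add_apply, Finsupp.add_apply, ha, hb, map_add]
  have hc (i) : ∃ c : k, algebraMap k K c = B'.repr a i :=
    (InfiniteGalois.mem_range_algebraMap_iff_fixed _).2 fun σ => by rw [← hB, h]
  choose c hc using hc
  have hsum := B'.linearCombination_repr a
  rw [Finsupp.linearCombination_apply, Finsupp.sum] at hsum
  refine ⟨∑ i ∈ (B'.repr a).support, c i • B i, ?_⟩
  rw [map_sum]
  conv_lhs => rw [← hsum]
  refine Finset.sum_congr rfl fun i _ => ?_
  rw [← hc, Algebra.TensorProduct.basis_apply, Algebra.TensorProduct.includeRight_apply,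
    TensorProduct.tmul_smul, algebraMap_smul]

end

section

variable {k : Type u} [Field k] {f : k[X]} {K : Type v} [Field K] [Algebra k K]

/-! ### Divisor classes supported at the Weierstrass points -/

/-- The residue field of `K(x)` at `x - ω` is `K`. -/
lemma exists_const_sub_lt_one (ω : K) {a : RatFunc K} (ha : linVal ω a ≤ 1) :
    ∃ c : K, linVal ω (a - algebraMap K _ c) < 1 := by
  have hden : ¬ (X - C ω) ∣ a.denom := by
    intro hd
    have hn : ¬ (X - C ω) ∣ a.num := fun hn => (irreducible_X_sub_C ω).not_isUnit
      ((RatFunc.isCoprime_num_denom a).isUnit_of_dvd' hn hd)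
    have h1 : linVal ω (algebraMap _ _ a.num) ≤ linVal ω (algebraMap _ _ a.denom) := by
      rw [← RatFunc.num_div_denom a, map_div₀] at ha
      exact (div_le_one₀ (zero_lt_iff.2 ((Valuation.ne_zero_iff _).2
        (RatFunc.algebraMap_ne_zero a.denom_ne_zero)))).1 ha
    rw [(polyVal_eq_one_iff _).2 hn] at h1
    exact absurd ((polyVal_lt_one_iff _).2 hd) (not_lt.2 h1)
  have hden' := not_X_sub_C_dvd_iff.1 hden
  refine ⟨a.num.eval ω / a.denom.eval ω, ?_⟩
  set c := a.num.eval ω / a.denom.eval ω with hc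
  have hd0 : algebraMap K[X] (RatFunc K) a.denom ≠ 0 := RatFunc.algebraMap_ne_zero a.denom_ne_zero
  have e : a - algebraMap K _ c = algebraMap K[X] _ (a.num - C c * a.denom) /
      algebraMap K[X] _ a.denom := by
    conv_lhs => rw [← RatFunc.num_div_denom a]
    rw [map_sub, map_mul, sub_div, mul_div_cancel_right₀ _ hd0]
    rfl
  rw [e, map_div₀, (polyVal_eq_one_iff _).2 hden, div_one, polyVal_lt_one_iff, dvd_iff_isRoot]
  simp [IsRoot, hc, hden']

/-- The Weierstrass points have degree one: their residue field is `K`. -/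
lemma rootPlace_deg (hsep : f.Separable) (ω : f.rootSet K) : (rootPlace hsep ω).deg = 1 := by
  set P := rootPlace hsep ω with hP
  have h1 : (1 : FunField f K) ∈ P.regular := by
    change P.val 1 ≤ 1
    rw [map_one]
  refine (finrank_eq_one_iff_of_nonzero' (Submodule.Quotient.mk ⟨1, h1⟩) ?_).2 fun w => ?_
  · rw [Ne, Submodule.Quotient.mk_eq_zero]
    intro h
    have : P.val 1 < 1 := h
    simp at this
  · induction w using Submodule.Quotient.induction_on with
    | H g =>
    obtain ⟨g, hg⟩ := g
    obtain ⟨a, b, rfl⟩ := exists_add_mul_yCoord f K g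
    have hg' : P.val (ofRat f K a + ofRat f K b * yCoord f K) ≤ 1 := hg
    rw [hP, rootPlace, weierPlace_val, max_le_iff] at hg'
    obtain ⟨c, hc⟩ := exists_const_sub_lt_one ω.1 ((pow_le_one_iff two_ne_zero).1 hg'.1)
    refine ⟨c, (Submodule.Quotient.eq _).2 ?_⟩
    change P.val (c • 1 - (ofRat f K a + ofRat f K b * yCoord f K)) < 1
    have e : c • 1 - (ofRat f K a + ofRat f K b * yCoord f K) =
        -(ofRat f K (a - algebraMap K _ c) + ofRat f K b * yCoord f K) := by
      rw [Algebra.smul_def, mul_one, map_sub]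
      change ofRat f K (algebraMap K _ c) - _ = _
      ring
    rw [e, Valuation.map_neg, hP, rootPlace, weierPlace_val]
    refine max_lt ((pow_lt_one_iff two_ne_zero).2 hc) (lt_of_le_of_ne hg'.2 fun h => ?_)
    exact sq_ne_sq_mul_exp (s := 1) (Or.inl one_ne_zero) (by rw [h, one_pow])

lemma Pic.mk_eq_zero_iff {D : Divisor f K} :
    Pic.mk f K D = 0 ↔ ∃ g : (FunField f K)ˣ, ∀ P : Place f K, D P = P.ord g :=
  QuotientAddGroup.eq_zero_iff D

variable (hsep : f.Separable) (hdeg : f.natDegree = 6) (ω₀ : f.rootSet K)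

/-- The divisor `(ω, 0) - (ω₀, 0)`. -/
def weierDiv (ω : f.rootSet K) : Divisor f K :=
  Finsupp.single (rootPlace hsep ω) 1 - Finsupp.single (rootPlace hsep ω₀) 1

lemma weierDiv_apply (ω : f.rootSet K) (P : Place f K) :
    weierDiv hsep ω₀ ω P = Finsupp.single (rootPlace hsep ω) (1 : ℤ) P -
      Finsupp.single (rootPlace hsep ω₀) (1 : ℤ) P := rfl

include hdeg in
/-- Twice `(ω, 0) - (ω₀, 0)` is the divisor of `(x - ω) / (x - ω₀)`. -/
lemma two_nsmul_mk_weierDiv (ω : f.rootSet K) : 2 • Pic.mk f K (weierDiv hsep ω₀ ω) = 0 := by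
  rw [← map_nsmul, Pic.mk_eq_zero_iff]
  have h (a : f.rootSet K) : IsUnit (ofPoly f K (X - C a.1)) :=
    isUnit_of_ne_zero hsep hdeg (ofPoly_ne_zero (X_sub_C_ne_zero _))
  refine ⟨(h ω).unit / (h ω₀).unit, fun P => ?_⟩
  have h1 : P.ord (((h ω).unit / (h ω₀).unit : (FunField f K)ˣ) : FunField f K) +
      P.ord (ofPoly f K (X - C ω₀.1)) = P.ord (ofPoly f K (X - C ω.1)) := by
    rw [← Place.ord_mul']
    · congr 1
      exact congrArg Units.val (div_mul_cancel (h ω).unit (h ω₀).unit)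
    · exact ((Units.isUnit _).map P.val).ne_zero
    · exact ((h ω₀).map P.val).ne_zero
  rw [P.ord_root hsep hdeg, P.ord_root hsep hdeg] at h1
  rw [Finsupp.smul_apply, weierDiv_apply, nsmul_eq_mul]
  push_cast
  linarith

/-- The class of `(ω, 0) - (ω₀, 0)` in `J[2]`. -/
def weierClass (ω : f.rootSet K) : JTwo f K :=
  .ofAdd ⟨Pic.mk f K (weierDiv hsep ω₀ ω), ⟨weierDiv hsep ω₀ ω, by
    change Divisor.deg f K _ = 0
    rw [weierDiv, map_sub, Divisor.deg, LinearMap.toAddMonoidHom_coe,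
      Finsupp.linearCombination_single, Finsupp.linearCombination_single, rootPlace_deg,
      rootPlace_deg, sub_self], rfl⟩, two_nsmul_mk_weierDiv hsep hdeg ω₀ ω⟩

lemma JTwo.ext {a b : JTwo f K} (h : a.toAdd.1 = b.toAdd.1) : a = b :=
  Multiplicative.toAdd.injective (Subtype.ext h)

lemma weierClass_mul_self (ω : f.rootSet K) :
    weierClass hsep hdeg ω₀ ω * weierClass hsep hdeg ω₀ ω = 1 :=
  JTwo.ext ((two_nsmul _).symm.trans (two_nsmul_mk_weierDiv hsep hdeg ω₀ ω))

lemma prod_weierClass (S : Finset (f.rootSet K)) :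
    (∏ ω ∈ S, weierClass hsep hdeg ω₀ ω).toAdd.1 = Pic.mk f K (∑ ω ∈ S, weierDiv hsep ω₀ ω) := by
  classical
  induction S using Finset.induction_on with
  | empty => simp
  | insert ω S hω ih =>
    rw [Finset.prod_insert hω, Finset.sum_insert hω, map_add, ← ih]
    rfl

lemma sum_weierDiv_apply (S : Finset (f.rootSet K)) (P : Place f K) :
    (∑ ω ∈ S, weierDiv hsep ω₀ ω) P =
      ∑ ω ∈ S, (Finsupp.single (rootPlace hsep ω) (1 : ℤ) P -
        Finsupp.single (rootPlace hsep ω₀) (1 : ℤ) P) := by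
  rw [Finsupp.finsetSum_apply]
  rfl

section closed

variable [IsSepClosed K] [NeZero (2 : K)]

omit [NeZero (2 : K)] in
/-- The sum of the `(ω, 0) - (ω₀, 0)` over all roots is the divisor of `y / (x - ω₀) ^ 3`. -/
lemma prod_univ_weierClass : ∏ ω, weierClass hsep hdeg ω₀ ω = 1 := by
  refine JTwo.ext ?_
  rw [prod_weierClass]
  refine Pic.mk_eq_zero_iff.2 ?_
  have hX : IsUnit (ofPoly f K (X - C ω₀.1)) :=
    isUnit_of_ne_zero hsep hdeg (ofPoly_ne_zero (X_sub_C_ne_zero _))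
  have hy : IsUnit (yCoord f K) := by
    refine (isUnit_pow_iff (n := 2) two_ne_zero).1 ?_
    rw [yCoord_sq]
    exact isUnit_of_ne_zero hsep hdeg (ofPoly_ne_zero (fK_ne_zero hsep))
  refine ⟨hy.unit / hX.unit ^ 3, fun P => ?_⟩
  have h1 : P.ord ((hy.unit / hX.unit ^ 3 : (FunField f K)ˣ) : FunField f K) +
      P.ord (ofPoly f K (X - C ω₀.1) ^ 3) = P.ord (yCoord f K) := by
    rw [← Place.ord_mul']
    · congr 1
      exact congrArg Units.val (div_mul_cancel hy.unit (hX.unit ^ 3))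
    · exact ((Units.isUnit _).map P.val).ne_zero
    · exact ((hX.pow 3).map P.val).ne_zero
  obtain ⟨c, hc, hf⟩ := fK_eq_C_mul_rootProd (K := K) hsep
  have h2 : 2 * P.ord (yCoord f K) = P.ord (ofPoly f K (fK f K)) := by
    rw [← yCoord_sq, P.ord_pow]; rfl
  rw [hf, map_mul, P.ord_mul hsep hdeg (ofPoly_ne_zero (C_ne_zero.2 hc))
    (ofPoly_ne_zero (rootProd_ne_zero _)), ofPoly_C, P.ord_const hc, P.ord_rootProd hsep hdeg,
    Finset.card_univ, card_rootSet hsep hdeg] at h2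
  rw [P.ord_pow, P.ord_root hsep hdeg] at h1
  rw [sum_weierDiv_apply, Finset.sum_sub_distrib, Finset.sum_const, Finset.card_univ,
    card_rootSet hsep hdeg, nsmul_eq_mul]
  push_cast at h1 h2 ⊢
  linarith

lemma eq_empty_or_univ_of_prod_weierClass_eq_one {S : Finset (f.rootSet K)} (hS : Even S.card)
    (h : ∏ ω ∈ S, weierClass hsep hdeg ω₀ ω = 1) : S = ∅ ∨ S = Finset.univ := by
  have h1 := congrArg (fun c : JTwo f K => c.toAdd.1) h
  simp only [prod_weierClass] at h1
  obtain ⟨g, hg⟩ := Pic.mk_eq_zero_iff.1 h1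
  have : Nontrivial (FunField f K) := ⟨_, _, ofPoly_ne_zero (X_ne_zero (R := K)) (f := f)⟩
  exact eq_empty_or_univ_of_ord_eq hsep hdeg g.ne_zero ω₀ hS fun P => by
    rw [← hg, sum_weierDiv_apply]

/-- The group `J[2]` is generated by the classes of differences of Weierstrass points. -/
lemma exists_prod_weierClass_eq (c : JTwo f K) :
    ∃ S : Finset (f.rootSet K), Even S.card ∧ c = ∏ ω ∈ S, weierClass hsep hdeg ω₀ ω := by
  obtain ⟨D, hD⟩ := Pic.mk_surjective f K c.toAdd.1
  have h2 : 2 • Pic.mk f K D = 0 := hD ▸ c.toAdd.2.2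
  rw [← map_nsmul, Pic.mk_eq_zero_iff] at h2
  obtain ⟨g, hg⟩ := h2
  have : Nontrivial (FunField f K) := ⟨_, _, ofPoly_ne_zero (X_ne_zero (R := K)) (f := f)⟩
  obtain ⟨U, S, hU, hS, h⟩ := exists_of_two_mul_eq_ord hsep hdeg g.ne_zero (D := D)
    (fun P => by rw [← hg, Finsupp.smul_apply, nsmul_eq_mul]; rfl) ω₀
  refine ⟨S, hS, JTwo.ext ?_⟩
  rw [prod_weierClass, ← hD, ← sub_eq_zero, ← map_sub, Pic.mk_eq_zero_iff]
  refine ⟨(isUnit_of_ne_zero hsep hdeg hU).unit, fun P => ?_⟩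
  rw [Finsupp.sub_apply, sum_weierDiv_apply, h P]
  exact add_sub_cancel_right _ _

/-! ### The group `M` -/

section MGroup

omit [IsSepClosed K] in
lemma neg_one_ne_one' : (-1 : K) ≠ 1 := fun h => by
  have : (2 : K) = 0 := by linear_combination -h
  exact two_ne_zero this

omit [IsSepClosed K] [NeZero (2 : K)] in
lemma MGroup_sq (α : MGroup f K) : α.1 ^ 2 = 1 := α.2.1

omit [IsSepClosed K] [NeZero (2 : K)] in
lemma MGroup_norm (α : MGroup f K) : ∏ ω, phi f K ω (α.1 : LSep f K) = 1 :=
  congrArg Units.val (show Units.map (normSep f K) α.1 = 1 from α.2.2)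

omit [IsSepClosed K] [NeZero (2 : K)] in
lemma phi_MGroup (α : MGroup f K) (ω : f.rootSet K) :
    phi f K ω (α.1 : LSep f K) = 1 ∨ phi f K ω (α.1 : LSep f K) = -1 := by
  have h : (phi f K ω (α.1 : LSep f K)) ^ 2 = 1 := by
    rw [← map_pow, ← Units.val_pow_eq_pow_val, MGroup_sq, Units.val_one, map_one]
  exact mul_self_eq_one_iff.1 ((sq _).symm.trans h)

open scoped Classical in
/-- The set of roots at which an element of `M` has component `-1`. -/
def negSet (α : MGroup f K) : Finset (f.rootSet K) :=
  Finset.univ.filter fun ω => phi f K ω (α.1 : LSep f K) = -1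

omit [IsSepClosed K] [NeZero (2 : K)] in
lemma mem_negSet {α : MGroup f K} {ω : f.rootSet K} :
    ω ∈ negSet α ↔ phi f K ω (α.1 : LSep f K) = -1 := by
  simp [negSet]

omit [IsSepClosed K] in
lemma phi_eq_one_iff {α : MGroup f K} {ω : f.rootSet K} :
    phi f K ω (α.1 : LSep f K) = 1 ↔ ω ∉ negSet α := by
  rw [mem_negSet]
  rcases phi_MGroup α ω with h | h <;> rw [h]
  · simp [neg_one_ne_one'.symm]
  · simp [neg_one_ne_one']

omit [IsSepClosed K] in
lemma phi_eq_ite (α : MGroup f K) (ω : f.rootSet K) [Decidable (ω ∈ negSet α)] :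
    phi f K ω (α.1 : LSep f K) = if ω ∈ negSet α then -1 else 1 := by
  split_ifs with h
  · exact mem_negSet.1 h
  · exact phi_eq_one_iff.2 h

omit [IsSepClosed K] [NeZero (2 : K)] in
lemma prod_ite_neg_one (S : Finset (f.rootSet K)) [∀ ω, Decidable (ω ∈ S)] :
    ∏ ω, (if ω ∈ S then -1 else 1 : K) = (-1) ^ S.card := by
  rw [← Finset.prod_filter, Finset.prod_const]
  congr 2
  ext ω
  simp

omit [IsSepClosed K] in
lemma even_card_negSet (α : MGroup f K) : Even (negSet α).card := by
  classical
  have h := MGroup_norm α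
  simp only [phi_eq_ite] at h
  rw [prod_ite_neg_one] at h
  exact (neg_one_pow_eq_one_iff_even neg_one_ne_one').1 h

include hsep hdeg in
lemma exists_negSet_eq {S : Finset (f.rootSet K)} (hS : Even S.card) :
    ∃ α : MGroup f K, negSet α = S := by
  classical
  obtain ⟨a, ha⟩ := exists_units_phi_eq (K := K) hsep hdeg (fun ω => if ω ∈ S then -1 else 1)
    fun ω => by split_ifs <;> simp
  refine ⟨⟨a, ?_, ?_⟩, ?_⟩
  · change a ^ 2 = 1
    refine units_phi_ext hsep hdeg fun ω => ?_
    rw [Units.val_pow_eq_pow_val, map_pow, ha, Units.val_one, map_one]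
    split_ifs <;> simp
  · change Units.map (normSep f K) a = 1
    ext
    change ∏ ω, phi f K ω a = 1
    simp only [ha]
    rw [prod_ite_neg_one, hS.neg_one_pow]
  · ext ω
    rw [mem_negSet]
    change phi f K ω (a : LSep f K) = -1 ↔ _
    rw [ha]
    split_ifs with h <;> simp [h, neg_one_ne_one'.symm]

include hsep hdeg in
omit [NeZero (2 : K)] in
/-- An element of `M` is determined by its components away from one root. -/
lemma MGroup_ext_of_ne {α α' : MGroup f K}
    (h : ∀ ω, ω ≠ ω₀ → phi f K ω (α.1 : LSep f K) = phi f K ω (α'.1 : LSep f K)) : α = α' := by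
  classical
  refine Subtype.ext (units_phi_ext hsep hdeg fun ω => ?_)
  by_cases hω : ω = ω₀
  · subst hω
    have h1 := (MGroup_norm α).trans (MGroup_norm α').symm
    rw [← Finset.mul_prod_erase _ _ (Finset.mem_univ ω),
      ← Finset.mul_prod_erase _ (fun ω' => phi f K ω' (α'.1 : LSep f K)) (Finset.mem_univ ω),
      Finset.prod_congr rfl fun ω' h' => h ω' (Finset.ne_of_mem_erase h')] at h1
    exact mul_right_cancel₀ (Finset.prod_ne_zero_iff.2 fun ω' _ => phi_units_ne_zero _ _) h1
  · exact h ω hω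

/-! ### The homomorphism `β` -/

open scoped Classical in
/-- The contribution of one root to `β`. -/
def betaComp (ω : f.rootSet K) : MGroup f K →* JTwo f K where
  toFun α := if ω ∈ negSet α then weierClass hsep hdeg ω₀ ω else 1
  map_one' := by
    rw [if_neg]
    rw [← phi_eq_one_iff]
    exact map_one _
  map_mul' α α' := by
    have h : phi f K ω ((α * α').1 : LSep f K) =
        phi f K ω (α.1 : LSep f K) * phi f K ω (α'.1 : LSep f K) := map_mul _ _ _
    rw [phi_eq_ite, phi_eq_ite, phi_eq_ite] at h
    split_ifs at h ⊢ <;>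
      simp_all [neg_one_ne_one', (neg_one_ne_one' (K := K)).symm, weierClass_mul_self]

/-- The homomorphism `β : M → J[2]`. -/
def beta : MGroup f K →* JTwo f K := ∏ ω, betaComp hsep hdeg ω₀ ω

omit [IsSepClosed K] in
lemma beta_apply (α : MGroup f K) :
    beta hsep hdeg ω₀ α = ∏ ω ∈ negSet α, weierClass hsep hdeg ω₀ ω := by
  classical
  rw [beta, MonoidHom.finsetProd_apply]
  simp only [betaComp, MonoidHom.coe_mk, OneHom.coe_mk]
  rw [Finset.prod_ite_mem, Finset.univ_inter]

omit [IsSepClosed K] [NeZero (2 : K)] in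
lemma negSet_eq_pair [DecidableEq (f.rootSet K)] {ω₁ ω₂ : f.rootSet K} {α : MGroup f K}
    (hα : ∀ ω : f.rootSet K, phi f K ω (α.1 : LSep f K) = -1 ↔ ω = ω₁ ∨ ω = ω₂) :
    negSet α = {ω₁, ω₂} := by
  ext ω
  rw [mem_negSet, hα]
  simp

omit [IsSepClosed K] in
lemma isBeta_beta : IsBeta f K (beta hsep hdeg ω₀) := by
  classical
  intro ω₁ ω₂ hne α hα
  refine ⟨_, _, isWeierstrass_rootPlace hsep ω₁, isWeierstrass_rootPlace hsep ω₂, ?_⟩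
  rw [beta_apply, prod_weierClass, negSet_eq_pair hα, Finset.sum_pair hne]
  have e : weierDiv hsep ω₀ ω₁ + weierDiv hsep ω₀ ω₂ =
      Finsupp.single (rootPlace hsep ω₁) 1 - Finsupp.single (rootPlace hsep ω₂) 1 +
        2 • weierDiv hsep ω₀ ω₂ := by
    rw [weierDiv, weierDiv]; abel
  rw [e, map_add, map_nsmul, two_nsmul_mk_weierDiv hsep hdeg, add_zero]

include hsep hdeg in
/-- Uniqueness of `β`, because the elements of `M` supported at two roots generate `M`. -/
lemma IsBeta.unique {β β' : MGroup f K →* JTwo f K} (h : IsBeta f K β) (h' : IsBeta f K β') :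
    β' = β := by
  classical
  obtain ⟨ω₀⟩ : Nonempty (f.rootSet K) := Fintype.card_pos_iff.1 (by
    rw [card_rootSet hsep hdeg]; decide)
  have hpair {ω₁ ω₂ : f.rootSet K} (hne : ω₁ ≠ ω₂) {α : MGroup f K} (hα : negSet α = {ω₁, ω₂}) :
      β' α = β α := by
    have hα' (ω : f.rootSet K) : phi f K ω (α.1 : LSep f K) = -1 ↔ ω = ω₁ ∨ ω = ω₂ := by
      rw [← mem_negSet, hα]; simp
    obtain ⟨P₁, P₂, h1, h2, e⟩ := h ω₁ ω₂ hne α hα'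
    obtain ⟨P₁', P₂', h1', h2', e'⟩ := h' ω₁ ω₂ hne α hα'
    refine JTwo.ext ?_
    rw [e, e', h1.eq_rootPlace hsep hdeg, h2.eq_rootPlace hsep hdeg, h1'.eq_rootPlace hsep hdeg,
      h2'.eq_rootPlace hsep hdeg]
  -- an element supported at `ω` and `ω₀`, or the identity when `ω = ω₀`
  have hgen (ω : f.rootSet K) : ∃ a : MGroup f K, β' a = β a ∧
      ∀ ω', ω' ≠ ω₀ → phi f K ω' (a.1 : LSep f K) = if ω' = ω then -1 else 1 := by
    by_cases hω : ω = ω₀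
    · exact ⟨1, by simp, fun ω' h' => by rw [if_neg (hω ▸ h')]; exact map_one _⟩
    · obtain ⟨a, ha⟩ := exists_negSet_eq (K := K) hsep hdeg (S := {ω, ω₀}) (by
        rw [Finset.card_pair hω]; decide)
      refine ⟨a, hpair hω ha, fun ω' h' => ?_⟩
      rw [phi_eq_ite, ha]
      simp [h']
  choose a ha1 ha2 using hgen
  ext1 α
  have hα : α = ∏ ω ∈ negSet α, a ω := by
    refine MGroup_ext_of_ne hsep hdeg ω₀ fun ω' h' => ?_
    have e : phi f K ω' ((∏ ω ∈ negSet α, a ω : MGroup f K).1 : LSep f K) =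
        ∏ ω ∈ negSet α, phi f K ω' ((a ω).1 : LSep f K) := by
      rw [Subgroup.val_finsetProd, Units.coe_prod, map_prod]
    rw [e, Finset.prod_congr rfl fun ω _ => ha2 ω ω' h', Finset.prod_ite_eq, phi_eq_ite]
  rw [hα, map_prod, map_prod]
  exact Finset.prod_congr rfl fun ω _ => ha1 ω

omit [IsSepClosed K] [NeZero (2 : K)] in
lemma negSet_smul (σ : K ≃ₐ[k] K) (α : MGroup f K) (ω : f.rootSet K) :
    rootPerm f K σ ω ∈ negSet (σ • α) ↔ ω ∈ negSet α := by
  rw [mem_negSet, mem_negSet]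
  change phi f K (rootPerm f K σ ω) (σ • (α.1 : LSep f K)) = -1 ↔ _
  rw [phi_smul]
  exact ⟨fun h => σ.injective (by rw [h, map_neg, map_one]), fun h => by rw [h, map_neg, map_one]⟩

/-- Equivariance of `β`: conjugating `β` by a Galois automorphism gives a homomorphism with the
same characterization. -/
lemma beta_smul (σ : K ≃ₐ[k] K) (α : MGroup f K) :
    beta hsep hdeg ω₀ (σ • α) = σ • beta hsep hdeg ω₀ α := by
  set β := beta hsep hdeg ω₀
  let β' : MGroup f K →* JTwo f K := (MulDistribMulAction.toMonoidHom (JTwo f K) σ⁻¹).comp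
    (β.comp (MulDistribMulAction.toMonoidHom (MGroup f K) σ))
  have h' : IsBeta f K β' := by
    intro ω₁ ω₂ hne α hα
    obtain ⟨P₁, P₂, h1, h2, e⟩ := isBeta_beta hsep hdeg ω₀ (rootPerm f K σ ω₁) (rootPerm f K σ ω₂)
      (fun h => hne ((rootPerm f K σ).injective h)) (σ • α) fun ω => by
        obtain ⟨ω, rfl⟩ := (rootPerm f K σ).surjective ω
        rw [← mem_negSet, negSet_smul, mem_negSet, hα, Equiv.apply_eq_iff_eq, Equiv.apply_eq_iff_eq]
    refine ⟨_, _, isWeierstrass_rootPlace hsep ω₁, isWeierstrass_rootPlace hsep ω₂, ?_⟩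
    change σ⁻¹ • (β (σ • α)).toAdd.1 = _
    rw [e, h1.eq_rootPlace hsep hdeg, h2.eq_rootPlace hsep hdeg, ← smul_rootPlace hsep hdeg,
      ← smul_rootPlace hsep hdeg]
    change picAct f K σ⁻¹ _ = _
    rw [picAct_mk, map_sub]
    simp [divAct, Finsupp.mapDomain_single]
  have e := DFunLike.congr_fun (IsBeta.unique hsep hdeg (isBeta_beta hsep hdeg ω₀) h') α
  rw [← e]
  change _ = σ • σ⁻¹ • β (σ • α)
  rw [smul_inv_smul]

lemma beta_surjective : Function.Surjective (beta hsep hdeg ω₀) := fun c => by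
  obtain ⟨S, hS, rfl⟩ := exists_prod_weierClass_eq hsep hdeg ω₀ c
  obtain ⟨α, rfl⟩ := exists_negSet_eq (K := K) hsep hdeg hS
  exact ⟨α, beta_apply hsep hdeg ω₀ α⟩

omit [IsSepClosed K] [NeZero (2 : K)] in
lemma muToLSep_val (ζ : rootsOfUnity 2 K) :
    (muToLSep f K ζ : LSep f K) = algebraMap K _ ((ζ : Kˣ) : K) := rfl

omit [IsSepClosed K] [NeZero (2 : K)] in
lemma phi_muToLSep (ζ : rootsOfUnity 2 K) (ω : f.rootSet K) :
    phi f K ω (muToLSep f K ζ) = ((ζ : Kˣ) : K) := by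
  rw [muToLSep_val, AlgHom.commutes]; rfl

include hsep hdeg in
omit [NeZero (2 : K)] in
lemma muToLSep_injective : Function.Injective (muToLSep f K) := fun ζ ζ' h => by
  obtain ⟨ω⟩ : Nonempty (f.rootSet K) := Fintype.card_pos_iff.1 (by
    rw [card_rootSet hsep hdeg]; decide)
  refine Subtype.ext (Units.ext ?_)
  rw [← phi_muToLSep ζ ω, h, phi_muToLSep]

omit [IsSepClosed K] [NeZero (2 : K)] in
lemma rootsOfUnity_two (ζ : rootsOfUnity 2 K) : ((ζ : Kˣ) : K) = 1 ∨ ((ζ : Kˣ) : K) = -1 := by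
  have h : (ζ : Kˣ) ^ 2 = 1 := ζ.2
  exact mul_self_eq_one_iff.1 (by rw [← sq, ← Units.val_pow_eq_pow_val, h, Units.val_one])

include hsep hdeg in
omit [NeZero (2 : K)] in
lemma muToLSep_mem (ζ : rootsOfUnity 2 K) : muToLSep f K ζ ∈ MGroup f K := by
  have h : ζ ^ 2 = 1 := Subtype.ext ζ.2
  refine ⟨?_, ?_⟩
  · change muToLSep f K ζ ^ 2 = 1
    rw [← map_pow, h, map_one]
  · change Units.map (normSep f K) _ = 1
    ext
    change ∏ ω, phi f K ω (muToLSep f K ζ) = 1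
    simp only [phi_muToLSep, Finset.prod_const, Finset.card_univ, card_rootSet hsep hdeg]
    rcases rootsOfUnity_two ζ with h | h <;> rw [h] <;> norm_num

/-- Exactness of `μ₂ → M → J[2]` at `M`. -/
lemma mem_range_muToLSep_iff (α : (LSep f K)ˣ) :
    α ∈ (muToLSep f K).range ↔ ∃ h : α ∈ MGroup f K, beta hsep hdeg ω₀ ⟨α, h⟩ = 1 := by
  constructor
  · rintro ⟨ζ, rfl⟩
    refine ⟨muToLSep_mem hsep hdeg ζ, ?_⟩
    rw [beta_apply]
    rcases rootsOfUnity_two ζ with h | h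
    · rw [Finset.prod_eq_one]
      intro ω hω
      rw [mem_negSet, phi_muToLSep, h] at hω
      exact absurd hω.symm neg_one_ne_one'
    · rw [← prod_univ_weierClass hsep hdeg ω₀]
      refine Finset.prod_congr (Finset.eq_univ_of_forall fun ω => ?_) fun _ _ => rfl
      rw [mem_negSet, phi_muToLSep, h]
  · rintro ⟨h, hα⟩
    rw [beta_apply] at hα
    rcases eq_empty_or_univ_of_prod_weierClass_eq_one hsep hdeg ω₀ (even_card_negSet _) hα
      with hS | hS
    · refine ⟨1, units_phi_ext hsep hdeg fun ω => ?_⟩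
      rw [phi_muToLSep]
      exact (phi_eq_one_iff (α := ⟨α, h⟩).2 (by rw [hS]; simp)).symm
    · refine ⟨⟨-1, by simp [mem_rootsOfUnity]⟩, units_phi_ext hsep hdeg fun ω => ?_⟩
      rw [phi_muToLSep]
      exact (mem_negSet (α := ⟨α, h⟩).1 (by rw [hS]; simp)).symm

end MGroup

end closed

end

section

/-! ### Cohomology classes and the connecting homomorphism -/

section Connecting

variable {G A B C : Type*} [Group G]
variable [CommGroup A] [MulDistribMulAction G A] [CommGroup B] [MulDistribMulAction G B]
variable [CommGroup C] [MulDistribMulAction G C]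

lemma coboundary_mul (b b' : G → A) : coboundary (b * b') = coboundary b * coboundary b' := by
  ext p
  simp only [coboundary, Pi.mul_apply, smul_mul']
  rw [← mul_div_mul_comm, mul_mul_mul_comm]

lemma coboundary_inv (b : G → A) : coboundary b⁻¹ = (coboundary b)⁻¹ := by
  rw [eq_inv_iff_mul_eq_one, ← coboundary_mul, inv_mul_cancel]
  ext p
  simp [coboundary]

lemma coboundary_smul_div (a : A) : coboundary (fun σ : G => σ • a / a) = 1 := by
  ext p
  simp only [coboundary, Pi.one_apply, smul_div', mul_smul]
  rw [mul_comm, div_mul_div_cancel, div_self']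

lemma coboundary_eq_one_iff {b : G → A} :
    coboundary b = 1 ↔ ∀ σ τ, b (σ * τ) = b σ * σ • b τ := by
  refine ⟨fun h σ τ => ?_, fun h => ?_⟩
  · exact (div_eq_one.1 (congrFun h (σ, τ))).symm
  · ext p
    exact div_eq_one.2 (h p.1 p.2).symm

lemma map_coboundary (φ : A →* B) (hφ : ∀ (σ : G) (a : A), φ (σ • a) = σ • φ a) (b : G → A)
    (p : G × G) : φ (coboundary b p) = coboundary (fun σ => φ (b σ)) p := by
  simp [coboundary, hφ]

lemma coboundary_cocycle (b : G → A) (σ τ ρ : G) :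
    σ • coboundary b (τ, ρ) * coboundary b (σ, τ * ρ) =
      coboundary b (σ * τ, ρ) * coboundary b (σ, τ) := by
  simp only [coboundary, smul_div', smul_mul', mul_smul, mul_assoc]
  rw [div_mul_div_comm, div_mul_div_comm, div_eq_div_iff_mul_eq_mul]
  ac_rfl

variable [TopologicalSpace G]

lemma H1.mk_surjective : Function.Surjective (H1.mk G A) := QuotientGroup.mk'_surjective _

lemma H1.mk_eq_one_iff {c : Z1 G A} : H1.mk G A c = 1 ↔ ∃ a : A, ∀ σ, c.1 σ = σ • a / a :=
  QuotientGroup.eq_one_iff c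

lemma H2.mk_eq_one_iff {a : Z2 G A} :
    H2.mk G A a = 1 ↔ ∃ b : G → A, IsLocallyConstant b ∧ a.1 = coboundary b :=
  QuotientGroup.eq_one_iff a

lemma H1.map_mk (φ : A →* B) (hφ : ∀ (σ : G) (a : A), φ (σ • a) = σ • φ a) (c : Z1 G A) :
    H1.map φ hφ (H1.mk G A c) = H1.mk G B (Z1.map φ hφ c) := rfl

variable (ι : A →* B) (π : B →* C)

/-- `b` is a continuous cochain lifting the cocycle `c` along `π`, and the `2`-cocycle `a` is its
coboundary: this is the recipe computing the connecting homomorphism. -/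
structure IsConnecting (c : Z1 G C) (b : G → B) (a : Z2 G A) : Prop where
  locConst : IsLocallyConstant b
  lift : ∀ σ, π (b σ) = c.1 σ
  cob : ∀ p, ι (a.1 p) = coboundary b p

variable {ι π}

lemma IsConnecting.mul {c c' : Z1 G C} {b b' : G → B} {a a' : Z2 G A} (h : IsConnecting ι π c b a)
    (h' : IsConnecting ι π c' b' a') : IsConnecting ι π (c * c') (b * b') (a * a') where
  locConst := h.locConst.mul h'.locConst
  lift σ := by
    rw [Pi.mul_apply, map_mul, h.lift, h'.lift]; rfl
  cob p := by
    rw [coboundary_mul, Pi.mul_apply, ← h.cob, ← h'.cob, ← map_mul]; rfl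

lemma IsConnecting.inv {c : Z1 G C} {b : G → B} {a : Z2 G A} (h : IsConnecting ι π c b a) :
    IsConnecting ι π c⁻¹ b⁻¹ a⁻¹ where
  locConst := h.locConst.inv
  lift σ := by
    rw [Pi.inv_apply, map_inv, h.lift]; rfl
  cob p := by
    rw [coboundary_inv, Pi.inv_apply, ← h.cob, ← map_inv]; rfl

variable (hι : ∀ (σ : G) (a : A), ι (σ • a) = σ • ι a)
  (hπ : ∀ (σ : G) (b : B), π (σ • b) = σ • π b)
  (hinj : Function.Injective ι) (hsurj : Function.Surjective π)
  (hex : ∀ b : B, π b = 1 ↔ b ∈ ι.range)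
  (hB : ∀ b : B, IsLocallyConstant fun σ : G => σ • b)

include hι hπ hinj hsurj hex hB

/-- The class of the `2`-cocycle depends only on the class of the `1`-cocycle. -/
lemma IsConnecting.mk_eq_one {c : Z1 G C} {b : G → B} {a : Z2 G A} (h : IsConnecting ι π c b a)
    (hc : H1.mk G C c = 1) : H2.mk G A a = 1 := by
  obtain ⟨j, hj⟩ := H1.mk_eq_one_iff.1 hc
  obtain ⟨m, rfl⟩ := hsurj j
  have hz (σ : G) : ∃ z : A, ι z = b σ / (σ • m / m) := by
    refine (hex _).1 ?_
    rw [_root_.map_div, _root_.map_div, hπ, h.lift, hj, div_self']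
  choose z hz using hz
  refine H2.mk_eq_one_iff.2 ⟨z, IsLocallyConstant.desc z ι ?_ hinj, ?_⟩
  · have : ι ∘ z = fun σ => b σ / (σ • m / m) := funext hz
    rw [this]
    exact h.locConst.div ((hB m).div (IsLocallyConstant.const m))
  · ext p
    apply hinj
    rw [h.cob, map_coboundary ι hι, funext hz]
    have : (fun σ => b σ / (σ • m / m)) = b * (fun σ : G => σ • m / m)⁻¹ := by
      ext σ; simp [div_eq_mul_inv]
    rw [this, coboundary_mul, coboundary_inv, coboundary_smul_div, inv_one, mul_one]

variable [IsTopologicalGroup G]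

/-- Every cocycle has a continuous lift, whose coboundary is a continuous cocycle. -/
lemma exists_isConnecting (c : Z1 G C) : ∃ (b : G → B) (a : Z2 G A), IsConnecting ι π c b a := by
  let s := Function.surjInv hsurj
  let b : G → B := fun σ => s (c.1 σ)
  have hb (σ) : π (b σ) = c.1 σ := Function.surjInv_eq hsurj _
  have hbl : IsLocallyConstant b := c.2.1.comp s
  have hz (p : G × G) : ∃ z : A, ι z = coboundary b p := by
    refine (hex _).1 ?_
    rw [map_coboundary π hπ]
    simp only [hb]
    exact congrFun (coboundary_eq_one_iff.2 c.2.2) p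
  choose a ha using hz
  have hact : IsLocallyConstant fun p : G × G => p.1 • b p.2 := by
    have h1 : IsLocallyConstant fun p : G × G => b p.2 := hbl.comp_continuous continuous_snd
    refine IsLocallyConstant.iff_eventually_eq _ |>.2 fun p => ?_
    have h2 := IsLocallyConstant.iff_eventually_eq _ |>.1
      ((hB (b p.2)).comp_continuous (continuous_fst (Y := G))) p
    filter_upwards [IsLocallyConstant.iff_eventually_eq _ |>.1 h1 p, h2] with q hq hq'
    rw [hq]
    exact hq'
  refine ⟨b, ⟨a, IsLocallyConstant.desc a ι ?_ hinj, fun σ τ ρ => hinj ?_⟩, hbl, hb, ha⟩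
  · have : ι ∘ a = coboundary b := funext ha
    rw [this]
    exact ((hbl.comp_continuous continuous_fst).mul hact).div (hbl.comp_continuous continuous_mul)
  · rw [map_mul, map_mul, hι, ha, ha, ha, ha]
    exact coboundary_cocycle b σ τ ρ

/-- The connecting homomorphism of a short exact sequence of discrete modules. -/
lemma exists_connecting : ∃ δ : H1 G C →* H2 G A, ∀ (ξ : H1 G C) (η : H2 G A), δ ξ = η ↔
    ∃ c b a, H1.mk G C c = ξ ∧ IsConnecting ι π c b a ∧ H2.mk G A a = η := by
  choose b a h using exists_isConnecting (ι := ι) hι hπ hinj hsurj hex hB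
  have key {c c' : Z1 G C} {b' : G → B} {a' : Z2 G A} (hcc : H1.mk G C c' = H1.mk G C c)
      (h' : IsConnecting ι π c' b' a') : H2.mk G A a' = H2.mk G A (a c) := by
    rw [← div_eq_one, ← _root_.map_div, div_eq_mul_inv]
    refine (h'.mul (h c).inv).mk_eq_one hι hπ hinj hsurj hex hB ?_
    rw [map_mul, map_inv, hcc, mul_inv_cancel]
  let δ₀ : Z1 G C →* H2 G A := MonoidHom.mk' (fun c => H2.mk G A (a c)) fun c c' => by
    rw [← map_mul]
    exact (key rfl ((h c).mul (h c'))).symm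
  refine ⟨QuotientGroup.lift (B1 G C) δ₀ fun c hc =>
    (h c).mk_eq_one hι hπ hinj hsurj hex hB (H1.mk_eq_one_iff.2 hc), fun ξ η => ⟨?_, ?_⟩⟩
  · rintro rfl
    obtain ⟨c, rfl⟩ := H1.mk_surjective ξ
    exact ⟨c, _, _, rfl, h c, rfl⟩
  · rintro ⟨c, b', a', rfl, h', rfl⟩
    exact (key rfl h').symm

end Connecting

/-! ### Hilbert 90 -/

section Hilbert90

variable {k : Type u} [Field k] {K : Type v} [Field K] [Algebra k K]

/-- Hilbert 90 for a subgroup of the Galois group, by means of a Poincaré series on a finite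
Galois subextension `E`, which is nonzero by independence of characters. -/
lemma hilbert90_subgroup [IsGalois k K] (H : Subgroup (K ≃ₐ[k] K)) {χ : (K ≃ₐ[k] K) → Kˣ}
    (hχ : IsLocallyConstant χ) (hc : ∀ σ ∈ H, ∀ τ ∈ H, (χ (σ * τ) : K) = χ σ * σ (χ τ)) :
    ∃ b : K, b ≠ 0 ∧ ∀ σ ∈ H, (χ σ : K) = σ b / b := by
  classical
  have h1 : χ 1 = 1 := by
    have := hc 1 H.one_mem 1 H.one_mem
    rw [mul_one] at this
    exact Units.ext ((mul_eq_left₀ (χ 1).ne_zero).1 this.symm)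
  obtain ⟨E, hE, hEχ⟩ : ∃ E : IntermediateField k K, FiniteDimensional k E ∧
      ∀ σ ∈ E.fixingSubgroup, χ σ = 1 := by
    have h2 : {σ | χ σ = 1} ∈ nhds (1 : K ≃ₐ[k] K) :=
      (hχ.isOpen_fiber 1).mem_nhds h1
    obtain ⟨E, hE, hE'⟩ := (krullTopology_mem_nhds_one_iff k K _).1 h2
    exact ⟨E, hE, hE'⟩
  have hχE {σ τ : K ≃ₐ[k] K} (hσ : σ ∈ H) (hτ : τ ∈ H)
      (h : (σ : K →ₐ[k] K).comp E.val = (τ : K →ₐ[k] K).comp E.val) : χ σ = χ τ := by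
    have hv : σ⁻¹ * τ ∈ E.fixingSubgroup := by
      rw [IntermediateField.mem_fixingSubgroup_iff]
      intro x hx
      have := DFunLike.congr_fun h ⟨x, hx⟩
      change σ x = τ x at this
      change σ⁻¹ (τ x) = x
      rw [← this]
      exact σ.symm_apply_apply x
    have := hc σ hσ (σ⁻¹ * τ) (H.mul_mem (H.inv_mem hσ) hτ)
    rw [mul_inv_cancel_left, hEχ _ hv, Units.val_one, map_one, mul_one] at this
    exact (Units.ext this).symm
  -- the values of the cocycle, extended by zero to the embeddings that do not come from `H`
  let w (q : E →ₐ[k] K) : K :=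
    if h : ∃ σ ∈ H, (σ : K →ₐ[k] K).comp E.val = q then χ h.choose else 0
  have hw {σ : K ≃ₐ[k] K} (hσ : σ ∈ H) : w ((σ : K →ₐ[k] K).comp E.val) = χ σ := by
    have h : ∃ τ ∈ H, (τ : K →ₐ[k] K).comp E.val = (σ : K →ₐ[k] K).comp E.val := ⟨σ, hσ, rfl⟩
    simp only [w, dif_pos h]
    rw [hχE h.choose_spec.1 hσ h.choose_spec.2]
  have hw' {σ : K ≃ₐ[k] K} (hσ : σ ∈ H) (q : E →ₐ[k] K) :
      w ((σ : K →ₐ[k] K).comp q) = χ σ * σ (w q) := by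
    by_cases h : ∃ τ ∈ H, (τ : K →ₐ[k] K).comp E.val = q
    · obtain ⟨τ, hτ, rfl⟩ := h
      rw [hw hτ, ← hc σ hσ τ hτ, ← hw (H.mul_mem hσ hτ)]
      rfl
    · have h' : ¬ ∃ τ ∈ H, (τ : K →ₐ[k] K).comp E.val = (σ : K →ₐ[k] K).comp q := by
        rintro ⟨τ, hτ, e⟩
        refine h ⟨σ⁻¹ * τ, H.mul_mem (H.inv_mem hσ) hτ, AlgHom.ext fun x => ?_⟩
        have := DFunLike.congr_fun e x
        change τ x = σ (q x) at this
        change σ⁻¹ (τ x) = q x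
        rw [this]
        exact σ.symm_apply_apply _
      simp only [w, dif_neg h, dif_neg h', map_zero, mul_zero]
  obtain ⟨x, hx⟩ : ∃ x : E, ∑ q : E →ₐ[k] K, w q * q x ≠ 0 := by
    by_contra hcon
    push Not at hcon
    have := Fintype.linearIndependent_iff.1 (linearIndependent_toLinearMap k E K) w (by
      ext x
      simpa using hcon x) E.val
    have h2 := hw H.one_mem
    have e : ((1 : K ≃ₐ[k] K) : K →ₐ[k] K).comp E.val = E.val := rfl
    rw [e, this] at h2
    exact (χ 1).ne_zero h2.symm
  set S : K := ∑ q : E →ₐ[k] K, w q * q x with hS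
  refine ⟨S⁻¹, inv_ne_zero hx, fun σ hσ => ?_⟩
  have key : S = χ σ * σ S := by
    have e := Equiv.sum_comp (AlgEquiv.arrowCongr (AlgEquiv.refl (R := k) (A₁ := E)) σ)
      fun q : E →ₐ[k] K => w q * q x
    refine e.symm.trans ?_
    rw [hS, map_sum, Finset.mul_sum]
    refine Finset.sum_congr rfl fun q _ => ?_
    have e' : AlgEquiv.arrowCongr (AlgEquiv.refl (R := k) (A₁ := E)) σ q =
        (σ : K →ₐ[k] K).comp q := AlgHom.ext fun x => rfl
    rw [e', hw' hσ, map_mul]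
    change _ * σ (q x) = _
    ring
  have hσS : σ S ≠ 0 := by simpa using hx
  rw [map_inv₀, div_inv_eq_mul, eq_inv_mul_iff_mul_eq₀ hσS, mul_comm]
  exact key.symm

/-- Hilbert 90 for the units of `Lˢ`: Shapiro's lemma reduces it to the stabilizers of the
roots. -/
lemma hilbert90_LSep [IsSepClosed K] [IsGalois k K] {f : k[X]} (hsep : f.Separable)
    (hdeg : f.natDegree = 6) {c : (K ≃ₐ[k] K) → (LSep f K)ˣ} (hc : IsLocallyConstant c)
    (hcoc : ∀ σ τ, c (σ * τ) = c σ * σ • c τ) :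
    ∃ ε : (LSep f K)ˣ, ∀ σ, c σ = σ • ε / ε := by
  classical
  have hperm (σ τ : K ≃ₐ[k] K) (ω : f.rootSet K) :
      rootPerm f K (σ * τ) ω = rootPerm f K σ (rootPerm f K τ ω) := rfl
  have hinv (σ : K ≃ₐ[k] K) (ω : f.rootSet K) :
      rootPerm f K σ⁻¹ (rootPerm f K σ ω) = ω := Subtype.ext (σ.symm_apply_apply _)
  have hphi (σ τ : K ≃ₐ[k] K) (ω : f.rootSet K) :
      phi f K (rootPerm f K σ ω) (c (σ * τ)) =
        phi f K (rootPerm f K σ ω) (c σ) * σ (phi f K ω (c τ)) := by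
    rw [hcoc, Units.val_mul, map_mul, val_smul, phi_smul]
  -- trivialize the cocycle on the stabilizer of each root
  have hstab (ω : f.rootSet K) : ∃ b : K, b ≠ 0 ∧ ∀ σ : K ≃ₐ[k] K, rootPerm f K σ ω = ω →
      phi f K ω (c σ) = σ b / b := by
    let H : Subgroup (K ≃ₐ[k] K) :=
      { carrier := {σ | rootPerm f K σ ω = ω}
        one_mem' := rfl
        mul_mem' := fun {σ τ} (hσ : _ = _) (hτ : _ = _) => by
          change rootPerm f K (σ * τ) ω = ω
          rw [hperm, hτ, hσ]
        inv_mem' := fun {σ} (hσ : _ = _) => by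
          change rootPerm f K σ⁻¹ ω = ω
          conv_lhs => rw [← hσ]
          rw [hinv] }
    obtain ⟨b, hb, h⟩ := hilbert90_subgroup H
      (χ := fun σ => Units.map (phi f K ω : LSep f K →* K) (c σ))
      (hc.comp (Units.map (phi f K ω : LSep f K →* K))) (fun σ (hσ : _ = _) τ _ => by
        have := hphi σ τ ω
        rw [hσ] at this
        exact this)
    exact ⟨b, hb, h⟩
  choose e he0 he using hstab
  -- choose representatives of the orbits of roots
  let r : Setoid (f.rootSet K) :=
    { r := fun ω ω' => ∃ σ : K ≃ₐ[k] K, rootPerm f K σ ω = ω'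
      iseqv := ⟨fun ω => ⟨1, rfl⟩, fun {ω ω'} ⟨σ, h⟩ => ⟨σ⁻¹, by rw [← h, hinv]⟩,
        fun {ω ω' ω''} ⟨σ, h⟩ ⟨τ, h'⟩ => ⟨τ * σ, by rw [hperm, h, h']⟩⟩ }
  let rep (ω : f.rootSet K) : f.rootSet K := (Quotient.mk r ω).out
  have hrep (σ : K ≃ₐ[k] K) (ω : f.rootSet K) : rep (rootPerm f K σ ω) = rep ω :=
    congrArg Quotient.out (Quotient.sound (s := r)
      (show ∃ τ : K ≃ₐ[k] K, rootPerm f K τ (rootPerm f K σ ω) = ω from ⟨σ⁻¹, hinv σ ω⟩))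
  have hρ (ω : f.rootSet K) : ∃ ρ : K ≃ₐ[k] K, rootPerm f K ρ (rep ω) = ω :=
    Quotient.mk_out (s := r) ω
  choose ρ hρ using hρ
  have hne (a : (LSep f K)ˣ) (ω) : phi f K ω a ≠ 0 := phi_units_ne_zero a ω
  -- the component of `ε` at `ω` is forced by the one at the representative of the orbit
  obtain ⟨ε, hε⟩ := exists_units_phi_eq (K := K) hsep hdeg
    (fun ω => ρ ω (e (rep ω)) / phi f K ω (c (ρ ω)))
    fun ω => div_ne_zero (by simpa using he0 _) (hne _ _)
  refine ⟨ε, fun σ => units_phi_ext hsep hdeg fun ω' => ?_⟩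
  obtain ⟨ω, rfl⟩ := (rootPerm f K σ).surjective ω'
  set ω' := rootPerm f K σ ω with hω'
  set τ := (ρ ω')⁻¹ * (σ * ρ ω) with hτ
  have hτr : rootPerm f K τ (rep ω) = rep ω := by
    rw [hτ, hperm, hperm, hρ, ← hω', ← hrep σ ω, ← hω']
    have := hinv (ρ ω') (rep ω')
    rwa [hρ] at this
  have hστ : σ * ρ ω = ρ ω' * τ := by rw [hτ, mul_inv_cancel_left]
  have h1 := hphi σ (ρ ω) ω
  have h2 := hphi (ρ ω') τ (rep ω')
  rw [hρ, ← hστ] at h2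
  rw [← hω', h2, hω', hrep, ← hω', he _ _ hτr, map_div₀] at h1
  have e1 : ρ ω' (τ (e (rep ω))) = σ (ρ ω (e (rep ω))) :=
    (DFunLike.congr_fun hστ (e (rep ω))).symm
  rw [e1] at h1
  have hdiv : phi f K ω' ((σ • ε / ε : (LSep f K)ˣ) : LSep f K) =
      σ (phi f K ω ε) / phi f K ω' ε := by
    rw [eq_div_iff (hne _ _), ← map_mul, ← Units.val_mul, div_mul_cancel, val_smul, hω', phi_smul]
  rw [hdiv, hε, hε, map_div₀, hω', hrep, ← hω']
  have n1 : σ (phi f K ω (c (ρ ω))) ≠ 0 := by simpa using hne _ _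
  have n2 : ρ ω' (e (rep ω)) ≠ 0 := by simpa using he0 _
  have n3 := hne (c (ρ ω')) ω'
  rw [div_div_div_eq, eq_div_iff (mul_ne_zero n1 n2), ← mul_assoc, ← h1]
  field_simp

end Hilbert90

end

section

variable {k : Type u} [Field k] {f : k[X]} {K : Type v} [Field K] [Algebra k K]

/-! ### The homomorphism `γ` -/

section Gamma

lemma LSep_includeRight_injective :
    Function.Injective (Algebra.TensorProduct.includeRight : LAlg f →ₐ[k] LSep f K) :=
  Algebra.TensorProduct.includeRight_injective (algebraMap k K).injective

lemma smul_includeRight (σ : K ≃ₐ[k] K) (x : LAlg f) :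
    σ • (Algebra.TensorProduct.includeRight x : LSep f K) =
      Algebra.TensorProduct.includeRight x := by
  rw [Algebra.TensorProduct.includeRight_apply, TensorProduct.smul_tmul', smul_one]

/-- The inclusion of the units of `L` in those of `Lˢ`. -/
def inclUnits (f : k[X]) (K : Type v) [Field K] [Algebra k K] : (LAlg f)ˣ →* (LSep f K)ˣ :=
  Units.map (Algebra.TensorProduct.includeRight : LAlg f →ₐ[k] LSep f K)

lemma inclUnits_val (x : (LAlg f)ˣ) :
    (inclUnits f K x : LSep f K) = Algebra.TensorProduct.includeRight (x : LAlg f) := rfl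

lemma smul_inclUnits (σ : K ≃ₐ[k] K) (x : (LAlg f)ˣ) : σ • inclUnits f K x = inclUnits f K x :=
  Units.ext (smul_includeRight σ x.1)

lemma inclUnits_injective : Function.Injective (inclUnits f K) := fun _ _ h =>
  Units.ext (LSep_includeRight_injective (congrArg Units.val h))

/-- Galois descent for the units of `Lˢ`. -/
lemma exists_eq_inclUnits_of_fixed [IsGalois k K] {a : (LSep f K)ˣ}
    (h : ∀ σ : K ≃ₐ[k] K, σ • a = a) : ∃ x : (LAlg f)ˣ, a = inclUnits f K x := by
  obtain ⟨x, hx⟩ := exists_eq_includeRight_of_fixed (a := (a : LSep f K))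
    fun σ => congrArg Units.val (h σ)
  obtain ⟨y, hy⟩ := exists_eq_includeRight_of_fixed (a := ((a⁻¹ : (LSep f K)ˣ) : LSep f K))
    fun σ => congrArg Units.val (show σ • a⁻¹ = a⁻¹ by rw [smul_inv', h])
  have hxy : x * y = 1 := LSep_includeRight_injective (K := K) (by
    rw [map_mul, ← hx, ← hy, Units.mul_inv, map_one])
  exact ⟨⟨x, y, hxy, by rw [mul_comm, hxy]⟩, Units.ext hx⟩

/-- The norm on the units of `Lˢ`. -/
abbrev normUnits (f : k[X]) (K : Type v) [Field K] [Algebra k K] : (LSep f K)ˣ →* Kˣ :=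
  Units.map (normSep f K)

lemma normUnits_smul (σ : K ≃ₐ[k] K) (a : (LSep f K)ˣ) :
    normUnits f K (σ • a) = σ • normUnits f K a :=
  Units.ext (normSep_smul f K σ a.1)

lemma mem_MGroup_iff {a : (LSep f K)ˣ} : a ∈ MGroup f K ↔ a ^ 2 = 1 ∧ normUnits f K a = 1 :=
  Iff.rfl

lemma isRootOf_iff {ε : (LSep f K)ˣ} {g : Gam f} : IsRootOf K ε g ↔
    ε ^ 2 = inclUnits f K g.1.1 ∧ normUnits f K ε = Units.map (algebraMap k K : k →* K) g.1.2 := by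
  rw [IsRootOf, Units.ext_iff, Units.ext_iff]
  rfl

lemma smul_units_algebraMap (σ : K ≃ₐ[k] K) (n : kˣ) :
    σ • Units.map (algebraMap k K : k →* K) n = Units.map (algebraMap k K : k →* K) n :=
  Units.ext (σ.commutes n.1)

lemma IsRootOf.smul_div_mem {ε : (LSep f K)ˣ} {g : Gam f} (h : IsRootOf K ε g)
    (σ : K ≃ₐ[k] K) : σ • ε / ε ∈ MGroup f K := by
  obtain ⟨h1, h2⟩ := isRootOf_iff.1 h
  refine mem_MGroup_iff.2 ⟨?_, ?_⟩
  · rw [div_pow, ← smul_pow', h1, smul_inclUnits, div_self']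
  · rw [_root_.map_div, normUnits_smul, h2, smul_units_algebraMap, div_self']

lemma IsRootOf.mul {ε ε' : (LSep f K)ˣ} {g g' : Gam f} (h : IsRootOf K ε g)
    (h' : IsRootOf K ε' g') : IsRootOf K (ε * ε') (g * g') := by
  rw [isRootOf_iff] at h h' ⊢
  refine ⟨?_, ?_⟩
  · rw [mul_pow, h.1, h'.1, ← map_mul]; rfl
  · rw [map_mul, h.2, h'.2, ← map_mul]; rfl

lemma IsRootOf.div_mem {ε ε' : (LSep f K)ˣ} {g : Gam f} (h : IsRootOf K ε g)
    (h' : IsRootOf K ε' g) : ε / ε' ∈ MGroup f K := by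
  rw [isRootOf_iff] at h h'
  exact mem_MGroup_iff.2 ⟨by rw [div_pow, h.1, h'.1, div_self'],
    by rw [_root_.map_div, h.2, h'.2, div_self']⟩

lemma IsRootOf.div_MGroup {ε : (LSep f K)ˣ} {g : Gam f} (h : IsRootOf K ε g) (m : MGroup f K) :
    IsRootOf K (ε / m.1) g := by
  obtain ⟨h1, h2⟩ := mem_MGroup_iff.1 m.2
  rw [isRootOf_iff] at h ⊢
  exact ⟨by rw [div_pow, h1, div_one, h.1], by rw [_root_.map_div, h2, div_one, h.2]⟩

variable [Algebra.IsIntegral k K]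

/-- The cocycle `σ ↦ σ(ε)/ε` attached to a square root `ε` of an element of `Γ`. -/
def IsRootOf.cocycle {ε : (LSep f K)ˣ} {g : Gam f} (h : IsRootOf K ε g) :
    Z1 (K ≃ₐ[k] K) (MGroup f K) :=
  ⟨fun σ => ⟨σ • ε / ε, h.smul_div_mem σ⟩,
    IsLocallyConstant.desc _ Subtype.val
      ((isLocallyConstant_units_smul ε).div (IsLocallyConstant.const ε)) Subtype.val_injective,
    fun σ τ => Subtype.ext (by
      have := coboundary_eq_one_iff.1 (coboundary_smul_div (G := K ≃ₐ[k] K) ε) σ τ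
      exact this)⟩

lemma IsRootOf.mk_cocycle_eq {ε ε' : (LSep f K)ˣ} {g : Gam f} (h : IsRootOf K ε g)
    (h' : IsRootOf K ε' g) : H1.mk _ _ h.cocycle = H1.mk _ _ h'.cocycle := by
  rw [← div_eq_one, ← _root_.map_div, H1.mk_eq_one_iff]
  refine ⟨⟨ε / ε', h.div_mem h'⟩, fun σ => Subtype.ext ?_⟩
  change (σ • ε / ε) / (σ • ε' / ε') = σ • (ε / ε') / (ε / ε')
  rw [smul_div', div_div_div_comm]

lemma IsRootOf.mk_cocycle_mul {ε ε' : (LSep f K)ˣ} {g g' : Gam f} (h : IsRootOf K ε g)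
    (h' : IsRootOf K ε' g') :
    H1.mk _ _ (h.mul h').cocycle = H1.mk _ _ h.cocycle * H1.mk _ _ h'.cocycle := by
  rw [← map_mul]
  congr 1
  refine Subtype.ext (funext fun σ => Subtype.ext ?_)
  change σ • (ε * ε') / (ε * ε') = (σ • ε / ε) * (σ • ε' / ε')
  rw [smul_mul', mul_div_mul_comm]

variable [IsSepClosed K] [NeZero (2 : K)] (hsep : f.Separable) (hdeg : f.natDegree = 6)
include hsep hdeg

omit [Algebra.IsIntegral k K] [NeZero (2 : K)] in
lemma normUnits_inclUnits (x : (LAlg f)ˣ) : normUnits f K (inclUnits f K x) =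
    Units.map (algebraMap k K : k →* K) (Units.map (Algebra.norm k : LAlg f →* k) x) :=
  Units.ext (normSep_includeRight hsep hdeg x.1)

omit [Algebra.IsIntegral k K] in
/-- Every `(δ, n)` in `Γ` has a square root in `Lˢ` of norm `n`: take square roots of the
components of `δ`, and correct one sign. -/
lemma exists_isRootOf (g : Gam f) : ∃ ε : (LSep f K)ˣ, IsRootOf K ε g := by
  classical
  obtain ⟨ω₀⟩ : Nonempty (f.rootSet K) := Fintype.card_pos_iff.1 (by
    rw [card_rootSet hsep hdeg]; decide)
  have hv (ω : f.rootSet K) : ∃ z : K, phi f K ω (inclUnits f K g.1.1) = z * z :=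
    IsSepClosed.exists_eq_mul_self _
  choose v hv using hv
  have hv0 (ω) : v ω ≠ 0 := fun h => phi_units_ne_zero (inclUnits f K g.1.1) ω (by
    rw [hv, h, zero_mul])
  have hn : (∏ ω, v ω) * ∏ ω, v ω = algebraMap k K g.1.2 * algebraMap k K g.1.2 := by
    rw [← Finset.prod_mul_distrib, Finset.prod_congr rfl fun ω _ => (hv ω).symm]
    have := normSep_includeRight (K := K) hsep hdeg g.1.1
    rw [show Algebra.norm k (g.1.1 : LAlg f) = (g.1.2 : k) ^ 2 from g.2, map_pow, sq] at this
    exact this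
  obtain ⟨s, hs, hs'⟩ : ∃ s : K, s * s = 1 ∧ s * ∏ ω, v ω = algebraMap k K g.1.2 := by
    rcases mul_self_eq_mul_self_iff.1 hn with h | h
    · exact ⟨1, by ring, by rw [h, one_mul]⟩
    · exact ⟨-1, by ring, by rw [h]; ring⟩
  have hs0 : s ≠ 0 := by rintro rfl; simp at hs
  obtain ⟨ε, hε⟩ := exists_units_phi_eq (K := K) hsep hdeg
    (fun ω => (if ω = ω₀ then s else 1) * v ω)
    fun ω => mul_ne_zero (by split_ifs <;> simp [hs0]) (hv0 ω)
  refine ⟨ε, phi_ext hsep hdeg fun ω => ?_, ?_⟩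
  · rw [map_pow, hε, ← inclUnits_val, hv]
    split_ifs
    · linear_combination (v ω * v ω) * hs
    · ring
  · change ∏ ω, phi f K ω ε = _
    simp only [hε]
    rw [Finset.prod_mul_distrib, Finset.prod_ite_eq']
    simpa using hs'

/-- The homomorphism `γ`, on `Γ`. -/
def gammaPre : Gam f →* H1 (K ≃ₐ[k] K) (MGroup f K) :=
  MonoidHom.mk' (fun g => H1.mk _ _ (exists_isRootOf (K := K) hsep hdeg g).choose_spec.cocycle)
    fun g g' => by
      rw [← IsRootOf.mk_cocycle_mul]
      exact IsRootOf.mk_cocycle_eq _ _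

lemma gammaPre_apply {ε : (LSep f K)ˣ} {g : Gam f} (h : IsRootOf K ε g) :
    gammaPre hsep hdeg g = H1.mk _ _ h.cocycle :=
  IsRootOf.mk_cocycle_eq _ _

omit [Algebra.IsIntegral k K] [NeZero (2 : K)] in
lemma isRootOf_chi (x : (LAlg f)ˣ) : IsRootOf K (inclUnits f K x) (chi f x) := by
  rw [isRootOf_iff]
  exact ⟨by rw [← map_pow]; rfl, normUnits_inclUnits hsep hdeg x⟩

lemma gammaPre_chi (x : (LAlg f)ˣ) : gammaPre (K := K) hsep hdeg (chi f x) = 1 := by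
  rw [gammaPre_apply hsep hdeg (isRootOf_chi hsep hdeg x), H1.mk_eq_one_iff]
  refine ⟨1, fun σ => Subtype.ext ?_⟩
  change σ • inclUnits f K x / inclUnits f K x = σ • 1 / 1
  rw [smul_inclUnits, div_self', smul_one, div_one]

/-- The homomorphism `γ : Γ/im χ → H¹(M)`. -/
def gamma : Gam f ⧸ (chi f).range →* H1 (K ≃ₐ[k] K) (MGroup f K) :=
  QuotientGroup.lift _ (gammaPre hsep hdeg) (by
    rintro _ ⟨x, rfl⟩
    exact gammaPre_chi hsep hdeg x)

lemma gamma_mk (g : Gam f) :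
    gamma (K := K) hsep hdeg (QuotientGroup.mk g) = gammaPre hsep hdeg g := rfl

lemma isGamma_gamma : IsGamma f K (gamma hsep hdeg) := fun g =>
  ⟨exists_isRootOf hsep hdeg g, fun _ h => ⟨h.cocycle, fun _ => rfl, gammaPre_apply hsep hdeg h⟩⟩

lemma IsGamma.unique {γ' : Gam f ⧸ (chi f).range →* H1 (K ≃ₐ[k] K) (MGroup f K)}
    (h : IsGamma f K γ') : γ' = gamma hsep hdeg := by
  refine MonoidHom.ext fun x => ?_
  obtain ⟨g, rfl⟩ := QuotientGroup.mk_surjective x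
  obtain ⟨ε, hε⟩ := (h g).1
  obtain ⟨c, hc, e⟩ := (h g).2 ε hε
  rw [e, gamma_mk, gammaPre_apply hsep hdeg hε]
  congr 1
  exact Subtype.ext (funext fun σ => Subtype.ext (hc σ))

omit [Algebra.IsIntegral k K] [NeZero (2 : K)] in
/-- An element of `Γ` with a square root coming from `L` lies in the image of `χ`. -/
lemma eq_chi_of_isRootOf {g : Gam f} {x : (LAlg f)ˣ} (h : IsRootOf K (inclUnits f K x) g) :
    g = chi f x := by
  rw [isRootOf_iff, normUnits_inclUnits hsep hdeg, ← map_pow] at h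
  refine Subtype.ext (Prod.ext (inclUnits_injective (K := K) h.1).symm ?_)
  refine Units.ext ((algebraMap k K).injective ?_)
  exact (congrArg Units.val h.2).symm

variable [IsGalois k K]

lemma gamma_injective : Function.Injective (gamma (K := K) hsep hdeg) := by
  refine (injective_iff_map_eq_one _).2 fun x hx => ?_
  obtain ⟨g, rfl⟩ := QuotientGroup.mk_surjective x
  obtain ⟨ε, hε⟩ := exists_isRootOf (K := K) hsep hdeg g
  rw [gamma_mk, gammaPre_apply hsep hdeg hε, H1.mk_eq_one_iff] at hx
  obtain ⟨m, hm⟩ := hx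
  obtain ⟨x, hx⟩ := exists_eq_inclUnits_of_fixed (a := ε / m.1) fun σ => by
    have : σ • ε / ε = σ • m.1 / m.1 := congrArg Subtype.val (hm σ)
    rw [smul_div', div_eq_div_iff_mul_eq_mul, mul_comm ε, ← div_eq_div_iff_mul_eq_mul, this]
  rw [QuotientGroup.eq_one_iff]
  exact ⟨x, (eq_chi_of_isRootOf hsep hdeg (hx ▸ hε.div_MGroup m)).symm⟩

omit [Algebra.IsIntegral k K] [IsSepClosed K] [NeZero (2 : K)] hsep hdeg in
lemma exists_units_of_fixed {a : Kˣ} (h : ∀ σ : K ≃ₐ[k] K, σ • a = a) :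
    ∃ n : kˣ, a = Units.map (algebraMap k K : k →* K) n := by
  obtain ⟨n, hn⟩ := (InfiniteGalois.mem_range_algebraMap_iff_fixed (k := k) a.1).2
    fun σ => congrArg Units.val (h σ)
  have hn0 : n ≠ 0 := by rintro rfl; exact a.ne_zero (by rw [← hn, map_zero])
  exact ⟨Units.mk0 n hn0, Units.ext hn.symm⟩

lemma gamma_surjective : Function.Surjective (gamma (K := K) hsep hdeg) := by
  intro ξ
  obtain ⟨c, rfl⟩ := H1.mk_surjective ξ
  obtain ⟨ε, hε⟩ := hilbert90_LSep hsep hdeg (c := fun σ => (c.1 σ).1) (c.2.1.comp Subtype.val)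
    fun σ τ => congrArg Subtype.val (c.2.2 σ τ)
  have hM (σ) := mem_MGroup_iff.1 (hε σ ▸ (c.1 σ).2)
  obtain ⟨δ, hδ⟩ := exists_eq_inclUnits_of_fixed (a := ε ^ 2) fun σ => by
    have := (hM σ).1
    rwa [div_pow, div_eq_one, ← smul_pow'] at this
  obtain ⟨n, hn⟩ := exists_units_of_fixed (k := k) (a := normUnits f K ε) fun σ => by
    have := (hM σ).2
    rwa [_root_.map_div, div_eq_one, normUnits_smul] at this
  have hg : (δ, n) ∈ Gam f := by
    refine (algebraMap k K).injective ?_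
    have h1 := normUnits_inclUnits (K := K) hsep hdeg δ
    rw [← hδ, map_pow, hn, ← map_pow] at h1
    exact (congrArg Units.val h1).symm
  have hroot : IsRootOf K ε ⟨(δ, n), hg⟩ := isRootOf_iff.2 ⟨hδ, hn⟩
  refine ⟨QuotientGroup.mk ⟨(δ, n), hg⟩, ?_⟩
  rw [gamma_mk, gammaPre_apply hsep hdeg hroot]
  congr 1
  exact Subtype.ext (funext fun σ => Subtype.ext (hε σ).symm)

end Gamma

/-! ### The homomorphism `Υ` and its kernel -/

section Upsilon

lemma hilbert90_units [IsGalois k K] {u : (K ≃ₐ[k] K) → Kˣ} (hu : IsLocallyConstant u)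
    (h : ∀ σ τ, u (σ * τ) = u σ * σ • u τ) : ∃ s : Kˣ, ∀ σ, u σ = σ • s / s := by
  obtain ⟨b, hb, hb'⟩ := hilbert90_subgroup (⊤ : Subgroup (K ≃ₐ[k] K)) hu
    fun σ _ τ _ => congrArg Units.val (h σ τ)
  refine ⟨Units.mk0 b hb, fun σ => Units.ext ?_⟩
  rw [hb' σ trivial, Units.val_div_eq_div_val]
  rfl

variable [IsSepClosed K] [NeZero (2 : K)] [IsGalois k K]
variable (hsep : f.Separable) (hdeg : f.natDegree = 6)

omit [NeZero (2 : K)] [IsGalois k K] in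
/-- The inclusion of `μ₂` in `M`. -/
def muToM : rootsOfUnity 2 K →* MGroup f K :=
  (muToLSep f K).codRestrict (MGroup f K) (muToLSep_mem hsep hdeg)

omit [IsSepClosed K] [NeZero (2 : K)] [IsGalois k K] in
lemma smul_algebraMap_units (σ : K ≃ₐ[k] K) (t : Kˣ) :
    σ • Units.map (algebraMap K (LSep f K) : K →* LSep f K) t =
      Units.map (algebraMap K (LSep f K) : K →* LSep f K) (σ • t) := by
  ext
  change σ • algebraMap K (LSep f K) t.1 = algebraMap K (LSep f K) (σ t.1)
  rw [Algebra.TensorProduct.algebraMap_apply, Algebra.TensorProduct.algebraMap_apply,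
    TensorProduct.smul_tmul']
  rfl

omit [IsSepClosed K] [NeZero (2 : K)] [IsGalois k K] in
lemma muToLSep_smul (σ : K ≃ₐ[k] K) (ζ : rootsOfUnity 2 K) :
    muToLSep f K (σ • ζ) = σ • muToLSep f K ζ :=
  (smul_algebraMap_units σ ζ.1).symm

variable {β : MGroup f K →* JTwo f K}
  (hβ : ∀ (σ : K ≃ₐ[k] K) (α : MGroup f K), β (σ • α) = σ • β α)
  (hsurj : Function.Surjective β)
  (hex : ∀ α : (LSep f K)ˣ, α ∈ (muToLSep f K).range ↔ ∃ h : α ∈ MGroup f K, β ⟨α, h⟩ = 1)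

include hsep hdeg hβ hsurj hex in
omit [NeZero (2 : K)] in
/-- The homomorphism `Υ` exists. -/
lemma exists_isUpsilon :
    ∃ Υ : H1 (K ≃ₐ[k] K) (JTwo f K) →* BrTwo k K, IsUpsilon f K β Υ := by
  obtain ⟨δ, hδ⟩ := exists_connecting (ι := muToM hsep hdeg) (π := β)
    (G := K ≃ₐ[k] K) (fun σ ζ => Subtype.ext (muToLSep_smul σ ζ)) hβ
    (fun ζ ζ' h => muToLSep_injective hsep hdeg (congrArg Subtype.val h)) hsurj
    (fun b => by
      have h1 := hex b.1
      constructor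
      · intro h
        obtain ⟨ζ, hζ⟩ := h1.2 ⟨b.2, h⟩
        exact ⟨ζ, Subtype.ext hζ⟩
      · rintro ⟨ζ, hζ⟩
        obtain ⟨_, h⟩ := h1.1 ⟨ζ, congrArg Subtype.val hζ⟩
        exact h)
    isLocallyConstant_MGroup_smul
  refine ⟨((muToBr k K).comp δ).codRestrict (BrTwo k K) fun ξ => ?_, fun ξ η => ?_⟩
  · change muToBr k K (δ ξ) ^ 2 = 1
    obtain ⟨c, b, a, -, -, h⟩ := (hδ ξ _).1 rfl
    have ha : a ^ 2 = 1 := Subtype.ext (funext fun p => Subtype.ext (a.1 p).2)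
    rw [← map_pow, ← h, ← map_pow, ha, map_one, map_one]
  · rw [Subtype.ext_iff]
    change muToBr k K (δ ξ) = η.1 ↔ _
    constructor
    · intro h
      obtain ⟨c, b, a, hc, hcon, ha⟩ := (hδ ξ _).1 rfl
      exact ⟨c, b, a, hc, hcon.locConst, hcon.lift, fun p => congrArg Subtype.val (hcon.cob p),
        by rw [ha, h]⟩
    · rintro ⟨c, b, a, hc, h1, h2, h3, h4⟩
      rw [(hδ ξ (H2.mk _ _ a)).2 ⟨c, b, a, hc, ⟨h1, h2, fun p => Subtype.ext (h3 p)⟩, rfl⟩, h4]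

variable {Υ : H1 (K ≃ₐ[k] K) (JTwo f K) →* BrTwo k K}

omit [IsSepClosed K] [NeZero (2 : K)] [IsGalois k K] in
lemma IsUpsilon.map_eq_one (h : IsUpsilon f K β Υ) (ξ : H1 (K ≃ₐ[k] K) (MGroup f K)) :
    Υ (H1.map β hβ ξ) = 1 := by
  obtain ⟨c, rfl⟩ := H1.mk_surjective ξ
  refine (h _ _).2 ⟨Z1.map β hβ c, c.1, 1, rfl, c.2.1, fun σ => rfl, fun p => ?_, ?_⟩
  · rw [coboundary_eq_one_iff.2 c.2.2]
    exact map_one _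
  · rw [map_one, map_one]; rfl

include hsep hdeg hex in
/-- The kernel of `Υ` is the image of `H¹(M)`: as `H²(μ₂)` injects in the Brauer group by Kummer
theory, a lift to `M` can be corrected by signs to become a cocycle. -/
lemma IsUpsilon.exists_of_eq_one (h : IsUpsilon f K β Υ) {ξ : H1 (K ≃ₐ[k] K) (JTwo f K)}
    (hξ : Υ ξ = 1) : ∃ η, H1.map β hβ η = ξ := by
  obtain ⟨c, b, a, rfl, hb, hlift, hcob, ha⟩ := (h ξ 1).1 hξ
  have ha' : H2.mk _ _ (Z2.map (rootsOfUnity 2 K).subtype (fun (_ : K ≃ₐ[k] K) _ => rfl) a) = 1 :=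
    ha
  obtain ⟨u, hu, hau⟩ := H2.mk_eq_one_iff.1 ha'
  have hau' (p) : ((a.1 p : rootsOfUnity 2 K) : Kˣ) = coboundary u p := congrFun hau p
  -- the square of `u` is a cocycle, hence `u` is `σ ↦ σ(t)/t` up to signs
  obtain ⟨s, hs⟩ := hilbert90_units (u := u ^ 2) (hu.comp (· ^ 2)) (coboundary_eq_one_iff.1 (by
    ext1 p
    rw [sq, coboundary_mul, Pi.mul_apply, ← hau', ← sq]
    exact (a.1 p).2))
  obtain ⟨t, ht⟩ : ∃ t : Kˣ, s = t ^ 2 := by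
    obtain ⟨z, hz⟩ := IsSepClosed.exists_eq_mul_self (s : K)
    have hz0 : z ≠ 0 := by rintro rfl; exact s.ne_zero (by rw [hz, zero_mul])
    exact ⟨Units.mk0 z hz0, Units.ext (by rw [hz, sq]; rfl)⟩
  let z (σ : K ≃ₐ[k] K) : rootsOfUnity 2 K := ⟨u σ / (σ • t / t), by
    have := hs σ
    rw [Pi.pow_apply] at this
    rw [mem_rootsOfUnity, div_pow, div_pow, this, ht, smul_pow', div_self']⟩
  have hz : IsLocallyConstant z := by
    refine IsLocallyConstant.desc _ (fun ζ : rootsOfUnity 2 K => (ζ : Kˣ)) ?_ Subtype.val_injective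
    refine hu.div (IsLocallyConstant.div ?_ (IsLocallyConstant.const t))
    exact IsLocallyConstant.desc _ Units.val (isLocallyConstant_galois t.1) Units.val_injective
  have hza : coboundary z = a.1 := by
    ext1 p
    apply Subtype.ext
    have e := map_coboundary (rootsOfUnity 2 K).subtype (fun (_ : K ≃ₐ[k] K) _ => rfl) z p
    have e' : (fun σ => (rootsOfUnity 2 K).subtype (z σ)) = u * (fun σ => σ • t / t)⁻¹ := by
      ext1 σ
      change u σ / (σ • t / t) = u σ * (σ • t / t)⁻¹
      rw [div_eq_mul_inv]
    rw [e', coboundary_mul, coboundary_inv, coboundary_smul_div, inv_one, mul_one] at e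
    exact e.trans (hau' p).symm
  let b' : (K ≃ₐ[k] K) → MGroup f K := b * fun σ => (muToM hsep hdeg (z σ))⁻¹
  have hcoc : coboundary b' = 1 := by
    have e : b' = b * (fun σ => muToM hsep hdeg (z σ))⁻¹ := rfl
    rw [e, coboundary_mul, coboundary_inv]
    ext1 p
    rw [Pi.mul_apply, Pi.inv_apply, ← map_coboundary (muToM hsep hdeg)
      (fun σ ζ => Subtype.ext (muToLSep_smul σ ζ)), hza, Pi.one_apply, mul_inv_eq_one]
    exact Subtype.ext (hcob p).symm
  have hb'l : IsLocallyConstant b' := hb.mul (hz.comp fun ζ => (muToM hsep hdeg ζ)⁻¹)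
  refine ⟨H1.mk _ _ ⟨b', hb'l, coboundary_eq_one_iff.1 hcoc⟩, ?_⟩
  rw [H1.map_mk]
  congr 1
  refine Subtype.ext (funext fun σ => ?_)
  change β (b σ * (muToM hsep hdeg (z σ))⁻¹) = c.1 σ
  obtain ⟨h1, h2⟩ := (hex _).1 ⟨z σ, rfl⟩
  rw [map_mul, map_inv, hlift, show β (muToM hsep hdeg (z σ)) = 1 from h2, inv_one, mul_one]

omit [IsSepClosed K] [NeZero (2 : K)] [IsGalois k K] in
lemma inclUnits_algebraMap (a : kˣ) :
    inclUnits f K (Units.map (algebraMap k (LAlg f) : k →* LAlg f) a) =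
      Units.map (algebraMap K (LSep f K) : K →* LSep f K)
        (Units.map (algebraMap k K : k →* K) a) := by
  ext
  change Algebra.TensorProduct.includeRight (algebraMap k (LAlg f) a) =
    algebraMap K (LSep f K) (algebraMap k K a)
  rw [AlgHom.commutes, ← IsScalarTower.algebraMap_apply]

omit [NeZero (2 : K)] [IsGalois k K] in
include hsep hdeg in
lemma normUnits_algebraMap (t : Kˣ) :
    normUnits f K (Units.map (algebraMap K (LSep f K) : K →* LSep f K) t) = t ^ 6 := by
  ext
  change ∏ ω, phi f K ω (algebraMap K (LSep f K) t) = (t : K) ^ 6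
  simp only [AlgHom.commutes, Algebra.algebraMap_self, RingHom.id_apply, Finset.prod_const,
    Finset.card_univ, card_rootSet hsep hdeg]

include hsep hdeg in
omit [NeZero (2 : K)] [IsGalois k K] in
/-- A square root of `a` in `K` has norm `a³`. -/
lemma isRootOf_algebraMap {g : Gam f} {a : kˣ} {t : Kˣ}
    (hg : g.1 = (Units.map (algebraMap k (LAlg f) : k →* LAlg f) a, a ^ 3))
    (ht : t ^ 2 = Units.map (algebraMap k K : k →* K) a) :
    IsRootOf K (Units.map (algebraMap K (LSep f K) : K →* LSep f K) t) g := by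
  rw [isRootOf_iff, hg]
  refine ⟨?_, ?_⟩
  · rw [inclUnits_algebraMap, ← ht, map_pow]
  · rw [normUnits_algebraMap hsep hdeg, map_pow, ← ht, ← pow_mul]

include hsep hdeg in
lemma exists_mem_kStar (a : kˣ) :
    ∃ g : Gam f, g.1 = (Units.map (algebraMap k (LAlg f) : k →* LAlg f) a, a ^ 3) := by
  refine ⟨⟨(Units.map (algebraMap k (LAlg f) : k →* LAlg f) a, a ^ 3), ?_⟩, rfl⟩
  change Algebra.norm k (algebraMap k (LAlg f) a) = ((a : k) ^ 3) ^ 2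
  rw [Algebra.norm_algebraMap, (AdjoinRoot.powerBasis hsep.ne_zero).finrank,
    AdjoinRoot.powerBasis_dim, hdeg, ← pow_mul]

include hex in
/-- If the class of `σ(ε)/ε` dies in `H¹(J[2])`, then `ε` can be changed by an element of `M` so
that `σ(ε)/ε` is a sign for every `σ`. By Hilbert 90 and Galois descent, `ε` is then the product of
an element of `Lˣ` and a square root in `K` of an element of `kˣ`. -/
lemma mem_of_map_gammaPre_eq_one (hsurj : Function.Surjective β) {g : Gam f}
    (h : H1.map β hβ (gammaPre hsep hdeg g) = 1) : g ∈ kStar f ⊔ (chi f).range := by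
  obtain ⟨ε, hε⟩ := exists_isRootOf (K := K) hsep hdeg g
  rw [gammaPre_apply hsep hdeg hε, H1.map_mk, H1.mk_eq_one_iff] at h
  obtain ⟨j, hj⟩ := h
  obtain ⟨m, rfl⟩ := hsurj j
  have hε' := hε.div_MGroup m
  set ε' := ε / m.1
  have hz (σ : K ≃ₐ[k] K) : ∃ ζ : rootsOfUnity 2 K, muToLSep f K ζ = σ • ε' / ε' := by
    refine (hex _).2 ⟨hε'.smul_div_mem σ, ?_⟩
    have e : (⟨σ • ε' / ε', hε'.smul_div_mem σ⟩ : MGroup f K) =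
        hε.cocycle.1 σ / (σ • m / m) := Subtype.ext (by
      change σ • (ε / m.1) / (ε / m.1) = (σ • ε / ε) / (σ • m.1 / m.1)
      rw [smul_div', div_div_div_comm])
    rw [e, _root_.map_div, _root_.map_div, hβ, div_eq_one]
    exact hj σ
  choose ζ hζ using hz
  have hinj := muToLSep_injective (K := K) hsep hdeg
  have hl : IsLocallyConstant ζ := by
    refine IsLocallyConstant.desc ζ (muToLSep f K) ?_ hinj
    rw [show muToLSep f K ∘ ζ = fun σ => σ • ε' / ε' from funext hζ]
    exact (isLocallyConstant_units_smul ε').div (IsLocallyConstant.const ε')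
  -- `σ(t)/t = σ(ε')/ε'`, so that `t ^ 2` and `ε'/t` are Galois invariant
  obtain ⟨t, ht⟩ := hilbert90_units (k := k) (u := fun σ => (ζ σ : Kˣ)) (hl.comp Subtype.val)
    fun σ τ => by
      have e : ζ (σ * τ) = ζ σ * σ • ζ τ := hinj (by
        rw [map_mul, muToLSep_smul, hζ, hζ, hζ]
        exact coboundary_eq_one_iff.1 (coboundary_smul_div (G := K ≃ₐ[k] K) ε') σ τ)
      rw [e]
      rfl
  obtain ⟨a, ha⟩ := exists_units_of_fixed (k := k) (a := t ^ 2) fun σ => by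
    have h2 : (ζ σ : Kˣ) ^ 2 = 1 := (ζ σ).2
    rw [show (ζ σ : Kˣ) = σ • t / t from ht σ, div_pow, div_eq_one] at h2
    rw [smul_pow', h2]
  set T := Units.map (algebraMap K (LSep f K) : K →* LSep f K) t
  obtain ⟨x, hx⟩ := exists_eq_inclUnits_of_fixed (k := k) (a := T⁻¹ * ε') fun σ => by
    have e : σ • ε' / ε' = σ • T / T := by
      rw [← hζ, smul_algebraMap_units, ← _root_.map_div, ← ht]
      rfl
    rw [smul_mul', smul_inv', inv_mul_eq_iff_eq_mul, ← mul_assoc, ← div_eq_iff_eq_mul, e,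
      div_eq_mul_inv]
  obtain ⟨g₀, hg₀⟩ := exists_mem_kStar hsep hdeg a
  have hT := isRootOf_algebraMap hsep hdeg (g := g₀⁻¹) (a := a⁻¹) (t := t⁻¹)
    (by rw [Subgroup.coe_inv, hg₀, map_inv, inv_pow, Prod.inv_mk])
    (by rw [inv_pow, ha, map_inv])
  have hgx := hT.mul hε'
  rw [map_inv, hx] at hgx
  rw [← mul_inv_cancel_left g₀ g, eq_chi_of_isRootOf hsep hdeg hgx]
  exact Subgroup.mul_mem_sup ⟨a, hg₀⟩ ⟨x, rfl⟩

include hex in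
/-- The kernel of `β_* ∘ γ`: its elements are those with a square root in `Kˣ · Lˣ`. -/
lemma map_gammaPre_eq_one_iff (hsurj : Function.Surjective β) (g : Gam f) :
    H1.map β hβ (gammaPre hsep hdeg g) = 1 ↔ g ∈ kStar f ⊔ (chi f).range := by
  refine ⟨mem_of_map_gammaPre_eq_one hsep hdeg hβ hex hsurj, fun h => ?_⟩
  suffices H : kStar f ⊔ (chi f).range ≤ ((H1.map β hβ).comp (gammaPre hsep hdeg)).ker from H h
  refine sup_le ?_ ?_
  · rintro g ⟨a, hg⟩
    obtain ⟨z, hz⟩ := IsSepClosed.exists_eq_mul_self (algebraMap k K a)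
    have hz0 : z ≠ 0 := by
      rintro rfl
      exact (Units.map (algebraMap k K : k →* K) a).ne_zero (by simp at hz)
    have ht : (Units.mk0 z hz0) ^ 2 = Units.map (algebraMap k K : k →* K) a :=
      Units.ext (by rw [Units.val_pow_eq_pow_val, sq]; exact hz.symm)
    have hT := isRootOf_algebraMap hsep hdeg hg ht
    change H1.map β hβ (gammaPre hsep hdeg g) = 1
    rw [gammaPre_apply hsep hdeg hT, H1.map_mk, H1.mk_eq_one_iff]
    refine ⟨1, fun σ => ?_⟩
    rw [smul_one, div_one]
    refine ((hex _).1 ⟨⟨σ • Units.mk0 z hz0 / Units.mk0 z hz0, ?_⟩, ?_⟩).2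
    · rw [mem_rootsOfUnity, div_pow, ← smul_pow', ht, smul_units_algebraMap, div_self']
    · rw [smul_algebraMap_units]
      exact _root_.map_div (Units.map (algebraMap K (LSep f K) : K →* LSep f K)) _ _
  · rintro _ ⟨x, rfl⟩
    change H1.map β hβ (gammaPre hsep hdeg (chi f x)) = 1
    rw [gammaPre_chi, map_one]

end Upsilon

/-- The map induced by `β_* ∘ γ` on `Γ/(kˣ · im χ)` is an isomorphism to `ker Υ`. -/
lemma exists_mulEquiv_ker [IsSepClosed K] [NeZero (2 : K)] [IsGalois k K]
    (hsep : f.Separable) (hdeg : f.natDegree = 6) {β : MGroup f K →* JTwo f K}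
    (hβ : ∀ (σ : K ≃ₐ[k] K) (α : MGroup f K), β (σ • α) = σ • β α)
    (hsurj : Function.Surjective β)
    (hex : ∀ α : (LSep f K)ˣ, α ∈ (muToLSep f K).range ↔ ∃ h : α ∈ MGroup f K, β ⟨α, h⟩ = 1)
    {Υ : H1 (K ≃ₐ[k] K) (JTwo f K) →* BrTwo k K} (hΥ : IsUpsilon f K β Υ) :
    ∃ e : Gam f ⧸ (kStar f ⊔ (chi f).range) ≃* Υ.ker,
      ∀ g : Gam f, (e (QuotientGroup.mk g) : H1 (K ≃ₐ[k] K) (JTwo f K)) =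
        H1.map β hβ (gamma hsep hdeg (QuotientGroup.mk g)) := by
  let Θ : Gam f →* Υ.ker := ((H1.map β hβ).comp (gammaPre hsep hdeg)).codRestrict Υ.ker
    fun g => IsUpsilon.map_eq_one hβ hΥ (gammaPre hsep hdeg g)
  have hΘ : Function.Surjective Θ := by
    rintro ⟨ξ, hξ⟩
    obtain ⟨η, rfl⟩ := hΥ.exists_of_eq_one hsep hdeg hβ hex hξ
    obtain ⟨x, rfl⟩ := gamma_surjective hsep hdeg η
    obtain ⟨g, rfl⟩ := QuotientGroup.mk_surjective x
    exact ⟨g, rfl⟩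
  have hker : kStar f ⊔ (chi f).range = Θ.ker := by
    ext g
    rw [← map_gammaPre_eq_one_iff hsep hdeg hβ hex hsurj]
    exact (Subtype.ext_iff (a1 := Θ g) (a2 := 1)).symm
  exact ⟨(QuotientGroup.quotientMulEquivOfEq hker).trans
    (QuotientGroup.quotientKerEquivOfSurjective Θ hΘ), fun g => rfl⟩

end

end GenusTwo

end

theorem mainTheorem2 {k : Type*} [Field k] (hk : (2 : k) ≠ 0)
    (f : k[X]) (hdeg : f.natDegree = 6) (hsep : f.Separable)
    (K : Type*) [Field K] [Algebra k K] [IsSepClosure k K] :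
    -- the map `β : M → J[2]` exists and is unique
    ∃ β : MGroup f K →* JTwo f K, IsBeta f K β ∧ (∀ β', IsBeta f K β' → β' = β) ∧
    -- it is Galois equivariant, and `1 → μ₂(K) → M → J[2] → 1` is exact
    ∃ hβ : ∀ (σ : K ≃ₐ[k] K) (α : MGroup f K), β (σ • α) = σ • β α,
      Function.Surjective β ∧
      Function.Injective (muToLSep f K) ∧
      (∀ α : (LSep f K)ˣ, α ∈ (muToLSep f K).range ↔ ∃ h : α ∈ MGroup f K, β ⟨α, h⟩ = 1) ∧
    -- the connecting homomorphism `Υ : H¹(J[2]) → Br(k)[2]` exists (its graph determines it)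
    ∃ Υ : H1 (K ≃ₐ[k] K) (JTwo f K) →* BrTwo k K, IsUpsilon f K β Υ ∧
    -- the isomorphism `γ : Γ/im χ → H¹(M)` exists and is unique
    ∃ γ : Gam f ⧸ (chi f).range →* H1 (K ≃ₐ[k] K) (MGroup f K),
      IsGamma f K γ ∧ (∀ γ', IsGamma f K γ' → γ' = γ) ∧ Function.Bijective γ ∧
    -- `β_* ∘ γ` induces an isomorphism from `Γ/(kˣ · im χ)` to the kernel of `Υ`
    ∃ e : Gam f ⧸ (kStar f ⊔ (chi f).range) ≃* Υ.ker,
      ∀ g : Gam f, (e (QuotientGroup.mk g) : H1 (K ≃ₐ[k] K) (JTwo f K)) =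
        H1.map β hβ (γ (QuotientGroup.mk g)) := by
  have := IsSepClosure.sep_closed (K := K) k
  have : NeZero (2 : K) := ⟨fun h => hk ((algebraMap k K).injective (by
    rw [map_ofNat, h, map_zero]))⟩
  obtain ⟨ω₀⟩ : Nonempty (f.rootSet K) := Fintype.card_pos_iff.1 (by
    rw [card_rootSet hsep hdeg]; decide)
  have hβ := beta_smul (K := K) hsep hdeg ω₀
  have hsurj := beta_surjective (K := K) hsep hdeg ω₀
  have hex := mem_range_muToLSep_iff (K := K) hsep hdeg ω₀
  obtain ⟨Υ, hΥ⟩ := exists_isUpsilon hsep hdeg hβ hsurj hex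
  exact ⟨beta hsep hdeg ω₀, isBeta_beta hsep hdeg ω₀,
    fun _ h => IsBeta.unique hsep hdeg (isBeta_beta hsep hdeg ω₀) h, hβ, hsurj,
    muToLSep_injective hsep hdeg, hex, Υ, hΥ, gamma hsep hdeg, isGamma_gamma hsep hdeg,
    fun _ h => h.unique hsep hdeg, ⟨gamma_injective hsep hdeg, gamma_surjective hsep hdeg⟩,
    exists_mulEquiv_ker hsep hdeg hβ hsurj hex hΥ⟩
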